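/- Let $M=\mathbb T^d=\mathbb R^d/\mathbb Z^d$ and identify every tangent space $T_xM$ with $\mathbb R^d$; for nearby points $x,y\in M$ let $y-x\in T_xM$ denote the small vector $v$ with $y=x+v \bmod \mathbb Z^d$ (in general, the representative of $y-x$ in $[-\tfrac12,\tfrac12)^d$). Let $f\in\mathrm{Diff}^1(M)$ be Anosov and fix an adapted (continuous) Riemannian metric on $M$, with norms $\|\cdot\|=\|\cdot\|_x$ on $T_xM$, distance $d$ and open balls $B(x,r)$: there is a continuous $Df$-invariant splitting $TM=E^s\oplus E^u$ into non-zero bundles with $$\lambda_0=\min_{x}\min_{v\in E^u_x\setminus\{0\}}\frac{\|Df\,v\|}{\|v\|}>1,\qquad \mu_0=\max_{x}\max_{v\in E^s_x\setminus\{0\}}\frac{\|Df\,v\|}{\|v\|}<1 .$$ Let $\lambda=\min\{\lambda_0,\mu_0^{-1}\}>1$ be the hyperbolicity strength. For $\alpha>0$ and $v=v^s+v^u\in E^s_x\oplus E^u_x$, write $v\in C^u_\alpha(x)$ if $\|v^s\|\le\alpha\|v^u\|$ and $v\in C^s_\alpha(x)$ if $\|v^u\|\le\alpha\|v^s\|$.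 A diffeomorphism $g\in\mathrm{Diff}^1(M)$ is an $(\varepsilon,N)$-sparse deformation of $f$ if there are $x_1,\dots,x_N\in M$ and $0<r<\varepsilon$ such that $d(x_i,x_j)>\varepsilon^{1/2}$ for all $i\ne j$ and, off $B_r=\bigcup_i B(x_i,r)$, $g$ is $\varepsilon$-close to $f$ in $C^1$: for all $x\in M\setminus B_r$, $d(f(x),g(x))<\varepsilon$ and $\|D_xf-D_xg\|<\varepsilon$ (operator norm from $\|\cdot\|_x$ to $\|\cdot\|_{f(x)}$). It $(\alpha,\rho,\Lambda)$-respects the domination of $f$ if for all $x\in M$ and all $y,z\in B(x,\rho)$ with $y-x\in C^u_\alpha(x)$ and $g(z)-g(x)\in C^s_\alpha(g(x))$: 1. if $y\neq x$ and $z\ne x$, then $\displaystyle \frac{\|g(y)-g(x)\|_{g(x)}}{\|y-x\|_x}>\Lambda\,\frac{\|g(z)-g(x)\|_{g(x)}}{\|z-x\|_x}$; 2. $g(y)-g(x)\in C^u_\alpha(g(x))$ and $z-x\in C^s_\alpha(x)$. **Theorem.** Let $f$ be as above, $1<\Lambda<\lambda$ and $\alpha>0$. There is $\varepsilon_1=\varepsilon_1(f,\Lambda,\alpha)>0$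 such that for all $0<\varepsilon<\varepsilon_1$, all integers $N\ge1$, with $\rho=\varepsilon^{1/2}-2\varepsilon$, and every $g\in\mathrm{Diff}^1(M)$ which is an $(\varepsilon,N)$-sparse deformation of $f$ and which $(\alpha,\rho,\Lambda)$-respects the domination of $f$, the following holds. The diffeomorphism $g$ has a dominated splitting $TM=E^{cs}\oplus E^{cu}$ with $\dim E^{cs}=\dim E^s$; that is, a continuous $Dg$-invariant splitting into non-zero bundles such that for some integer $\ell\ge1$, $\|Dg^\ell u\|\le\frac12\|Dg^\ell v\|$ for all $x\in M$ and all unit vectors $u\in E^{cs}_x$, $v\in E^{cu}_x$. Moreover there are foliations $\mathcal F^{cs}$, $\mathcal F^{cu}$ of $M$, of dimensions $\dim E^{cs}$ and $\dim E^{cu}$, such that 1. each is a continuous foliation with $C^1$ leaves (it is given locally by homeomorphisms of open sets of $M$ onto $\mathbb R^k\times\mathbb R^{d-k}$ mapping plaques onto the $k$-planes $\mathbb R^k\times\{s\}$, on each of which the inverse is a $C^1$ immersion; the leaves are the sets swept out by finite chains of plaques); 2. the leaves of $\mathcal F^{cs}$ and $\mathcal F^{cu}$ are everywhere tangent to $E^{cs}$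 and $E^{cu}$ respectively; 3. both foliations are invariant under $g$: the image under $g$ of the leaf through $x$ is the leaf through $g(x)$. -/

import Mathlib

open scoped Topology

noncomputable section

namespace TorusDyn

/-- `ℝᵈ` with its Euclidean structure; it is also every tangent space `T_xM` of the torus. -/
abbrev E (d : ℕ) : Type := EuclideanSpace ℝ (Fin d)

/-- The torus `M = 𝕋ᵈ = (ℝ/ℤ)ᵈ`. -/
abbrev T (d : ℕ) : Type := UnitAddTorus (Fin d)

/-- The universal covering `ℝᵈ → 𝕋ᵈ`. -/
def proj {d : ℕ} (v : E d) : T d := fun i => ((v i : ℝ) : UnitAddCircle)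

/-- The difference `y - x` of two points of the torus, as a vector: the representative in
`[-1/2, 1/2)ᵈ`. For nearby points it is the small vector `v` with `y = x + proj v`. -/
def diffVec {d : ℕ} (y x : T d) : E d :=
  WithLp.toLp 2 fun i => ((AddCircle.equivIco (1 : ℝ) (-1 / 2) (y i - x i) : ℝ))

/-- The map `p` into the torus has derivative `L` at `u`. -/
def HasTorusFDerivAt {V : Type*} [NormedAddCommGroup V] [NormedSpace ℝ V] {d : ℕ}
    (p : V → T d) (L : V →L[ℝ] E d) (u : V) : Prop :=
  HasFDerivAt (fun w => diffVec (p w) (p u)) L u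

/-- `Diff¹(𝕋ᵈ)`: homeomorphisms of the torus with an invertible derivative at each point that
depends continuously on the point. The field `D` is determined by the homeomorphism. -/
structure TorusDiffeo (d : ℕ) where
  toHomeo : T d ≃ₜ T d
  D : T d → E d ≃L[ℝ] E d
  continuous_D : Continuous fun x => (D x : E d →L[ℝ] E d)
  hasDeriv : ∀ x, HasTorusFDerivAt (fun v : E d => toHomeo (x + proj v)) (D x : E d →L[ℝ] E d) 0

instance (d : ℕ) : CoeFun (TorusDiffeo d) (fun _ => T d → T d) := ⟨fun g => g.toHomeo⟩

/-- The derivative `D_x gⁿ` of the iterate `gⁿ`, by the chain rule. -/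
def TorusDiffeo.Diter {d : ℕ} (g : TorusDiffeo d) : ℕ → T d → (E d →L[ℝ] E d)
  | 0, _ => ContinuousLinearMap.id ℝ (E d)
  | n + 1, x => (g.D (g^[n] x) : E d →L[ℝ] E d).comp (g.Diter n x)

/-- A (continuous) Riemannian metric on the torus. -/
structure TorusMetric (d : ℕ) where
  inner : T d → E d →L[ℝ] E d →L[ℝ] ℝ
  symm : ∀ x v w, inner x v w = inner x w v
  pos : ∀ x v, v ≠ 0 → 0 < inner x v v
  continuous_inner : Continuous inner

/-- The norm `‖v‖ₓ` of a tangent vector at `x`. -/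
def TorusMetric.norm {d : ℕ} (h : TorusMetric d) (x : T d) (v : E d) : ℝ :=
  Real.sqrt (h.inner x v v)

/-- The Riemannian distance: the infimum of the lengths of the `C¹` curves from `x` to `y`
(each curve is written as the image of a curve in the universal cover). -/
def TorusMetric.dist {d : ℕ} (h : TorusMetric d) (x y : T d) : ℝ :=
  sInf {l : ℝ | ∃ γ : ℝ → E d, ContDiff ℝ 1 γ ∧ proj (γ 0) = x ∧ proj (γ 1) = y ∧
    l = ∫ t in (0 : ℝ)..1, h.norm (proj (γ t)) (deriv γ t)}

/-- The open Riemannian ball. -/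
def TorusMetric.ball {d : ℕ} (h : TorusMetric d) (x : T d) (r : ℝ) : Set (T d) :=
  {y | h.dist x y < r}

/-- A continuous splitting `TM = E₁ ⊕ E₂`, encoded by the projections onto `E₁(x)` along
`E₂(x)`. -/
structure Splitting (d : ℕ) where
  P : T d → E d →L[ℝ] E d
  idem : ∀ x v, P x (P x v) = P x v
  continuous_P : Continuous P

/-- The first bundle `E₁(x)`. -/
def Splitting.fst {d : ℕ} (S : Splitting d) (x : T d) : Submodule ℝ (E d) :=
  LinearMap.range (S.P x : E d →ₗ[ℝ] E d)

/-- The second bundle `E₂(x)`. -/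
def Splitting.snd {d : ℕ} (S : Splitting d) (x : T d) : Submodule ℝ (E d) :=
  LinearMap.ker (S.P x : E d →ₗ[ℝ] E d)

/-- Both bundles are non-zero and invariant under the derivative of `g`. -/
structure Splitting.IsInvariant {d : ℕ} (S : Splitting d) (g : TorusDiffeo d) : Prop where
  fst_ne_bot : ∀ x, S.fst x ≠ ⊥
  snd_ne_bot : ∀ x, S.snd x ≠ ⊥
  map_fst : ∀ x, (S.fst x).map (g.D x : E d →ₗ[ℝ] E d) = S.fst (g x)
  map_snd : ∀ x, (S.snd x).map (g.D x : E d →ₗ[ℝ] E d) = S.snd (g x)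

/-- The splitting `E₁ ⊕ E₂` is dominated for `g`: for some `ℓ ≥ 1`, all unit vectors
`u ∈ E₁(x)`, `v ∈ E₂(x)` satisfy `‖Dgˡ u‖ / ‖Dgˡ v‖ ≤ 1/2`. -/
structure IsDominatedSplitting {d : ℕ} (h : TorusMetric d) (g : TorusDiffeo d)
    (S : Splitting d) : Prop where
  invariant : S.IsInvariant g
  dominated : ∃ l : ℕ, 1 ≤ l ∧ ∀ x, ∀ u ∈ S.fst x, ∀ v ∈ S.snd x,
    h.norm x u = 1 → h.norm x v = 1 →
      h.norm (g^[l] x) (g.Diter l x u) / h.norm (g^[l] x) (g.Diter l x v) ≤ 1 / 2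

/-- `λ₀`, the minimal expansion of `Df` along `E^u` (the second bundle). -/
def minExpansion {d : ℕ} (h : TorusMetric d) (f : TorusDiffeo d) (S : Splitting d) : ℝ :=
  sInf {a : ℝ | ∃ x, ∃ v ∈ S.snd x, v ≠ 0 ∧ a = h.norm (f x) (f.D x v) / h.norm x v}

/-- `μ₀`, the maximal value of `‖Df v‖ / ‖v‖` along `E^s` (the first bundle). -/
def maxContraction {d : ℕ} (h : TorusMetric d) (f : TorusDiffeo d) (S : Splitting d) : ℝ :=
  sSup {a : ℝ | ∃ x, ∃ v ∈ S.fst x, v ≠ 0 ∧ a = h.norm (f x) (f.D x v) / h.norm x v}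

/-- `f` is Anosov with hyperbolic splitting `E^s ⊕ E^u = S`, and the metric `h` is adapted
to `f`. -/
structure IsAnosov {d : ℕ} (h : TorusMetric d) (f : TorusDiffeo d) (S : Splitting d) : Prop where
  invariant : S.IsInvariant f
  expansion : 1 < minExpansion h f S
  contraction : maxContraction h f S < 1

/-- The hyperbolicity strength `min {λ₀, μ₀⁻¹}`. -/
def hyperbolicityStrength {d : ℕ} (h : TorusMetric d) (f : TorusDiffeo d)
    (S : Splitting d) : ℝ :=
  min (minExpansion h f S) (maxContraction h f S)⁻¹

/-- The cone `C^s_α(x)` of aperture `α` around the first bundle. -/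
def coneS {d : ℕ} (h : TorusMetric d) (S : Splitting d) (α : ℝ) (x : T d) : Set (E d) :=
  {v | h.norm x (v - S.P x v) ≤ α * h.norm x (S.P x v)}

/-- The cone `C^u_α(x)` of aperture `α` around the second bundle. -/
def coneU {d : ℕ} (h : TorusMetric d) (S : Splitting d) (α : ℝ) (x : T d) : Set (E d) :=
  {v | h.norm x (S.P x v) ≤ α * h.norm x (v - S.P x v)}

/-- `g` is an `(ε, N)`-sparse deformation of `f`. The condition `d_{C¹}(g, f) < ε` off the
strong support is written pointwise: the complement of the support is compact. -/
def IsSparseDeformation {d : ℕ} (h : TorusMetric d) (f g : TorusDiffeo d) (ε : ℝ) (N : ℕ) :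
    Prop :=
  ∃ (c : Fin N → T d) (r : ℝ), 0 < r ∧ r < ε ∧
    (∀ x, x ∉ ⋃ i, h.ball (c i) r →
      h.dist (f x) (g x) < ε ∧
      ∀ v : E d, v ≠ 0 → h.norm (f x) (f.D x v - g.D x v) < ε * h.norm x v) ∧
    ∀ i j, i ≠ j → Real.sqrt ε < h.dist (c i) (c j)

/-- `g` `(α, ρ, Λ)`-respects the domination of an Anosov diffeomorphism with hyperbolic
splitting `S`. The inequality between the quotients is asked where they make sense. -/
def RespectsDomination {d : ℕ} (h : TorusMetric d) (S : Splitting d) (g : TorusDiffeo d)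
    (α ρ Λ : ℝ) : Prop :=
  ∀ x, ∀ y ∈ h.ball x ρ, ∀ z ∈ h.ball x ρ,
    diffVec y x ∈ coneU h S α x → diffVec (g z) (g x) ∈ coneS h S α (g x) →
      (y ≠ x → z ≠ x →
        h.norm (g x) (diffVec (g y) (g x)) / h.norm x (diffVec y x) >
          Λ * (h.norm (g x) (diffVec (g z) (g x)) / h.norm x (diffVec z x))) ∧
      diffVec (g y) (g x) ∈ coneU h S α (g x) ∧ diffVec z x ∈ coneS h S α x

/-- A continuous foliation of dimension `k` with `C¹` leaves on `𝕋ᵈ`, given by an atlas of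
foliated charts onto `ℝᵏ × ℝᵈ⁻ᵏ`: the plaques, i.e. the preimages of the planes `ℝᵏ × {s}`, are
`C¹`-immersed, and two charts have locally the same plaques. -/
structure C1Foliation (d k : ℕ) where
  atlas : Set (OpenPartialHomeomorph (T d) (E k × E (d - k)))
  cover : ∀ x, ∃ φ ∈ atlas, x ∈ φ.source
  target_eq : ∀ φ ∈ atlas, φ.target = Set.univ
  compatible : ∀ φ ∈ atlas, ∀ ψ ∈ atlas, ∀ x, x ∈ φ.source → x ∈ ψ.source →
    ∃ W ∈ 𝓝 x, ∀ y ∈ W, ∀ z ∈ W, ((φ y).2 = (φ z).2 ↔ (ψ y).2 = (ψ z).2)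
  c1_plaques : ∀ φ ∈ atlas, ∀ s : E (d - k), ∃ L : E k → (E k →L[ℝ] E d), Continuous L ∧
    ∀ u, Function.Injective (L u) ∧ HasTorusFDerivAt (fun u' => φ.symm (u', s)) (L u) u

/-- Two points lie in a common plaque. -/
def C1Foliation.SamePlaque {d k : ℕ} (F : C1Foliation d k) (x y : T d) : Prop :=
  ∃ φ ∈ F.atlas, x ∈ φ.source ∧ y ∈ φ.source ∧ (φ x).2 = (φ y).2

/-- The leaf through `x`: all points that are joined to `x` by a finite chain of plaques. -/
def C1Foliation.leaf {d k : ℕ} (F : C1Foliation d k) (x : T d) : Set (T d) :=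
  {y | Relation.ReflTransGen F.SamePlaque x y}

/-- At each point the leaf has the tangent space prescribed by the bundle `B`. -/
def C1Foliation.IsTangentTo {d k : ℕ} (F : C1Foliation d k) (B : T d → Submodule ℝ (E d)) :
    Prop :=
  ∀ φ ∈ F.atlas, ∀ (u : E k) (s : E (d - k)) (L : E k →L[ℝ] E d),
    HasTorusFDerivAt (fun u' => φ.symm (u', s)) L u →
      LinearMap.range (L : E k →ₗ[ℝ] E d) = B (φ.symm (u, s))

/-- `g` maps leaves onto leaves. -/
def C1Foliation.IsInvariant {d k : ℕ} (F : C1Foliation d k) (g : TorusDiffeo d) : Prop :=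
  ∀ x, g '' F.leaf x = F.leaf (g x)

end TorusDyn

end

/-!
The deformation `g` is `C¹`-close to the Anosov diffeomorphism `f` only off some balls of radius
smaller than `ε`, and nothing is known about its derivative inside them. Two scales make up for
this. At the scale `R ∼ √ε`, much larger than the balls, the increments of `g` respect the cones
and the domination of `f`; letting the increments shrink, so does the derivative
(`ConeSystem.deriv_dom`). At the scale `δ ∼ ε`, with a large factor, `g` contracts the stable
displacements as `f` does: the distance of `g` to `f` is at most `K * ε` everywhere
(`exists_tdist_le_of_isSparseDeformation`). In an exceptional ball this is topological: the
boundary of the ball is mapped into a small box, whose complement is connected, and the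
homeomorphism `g` maps points outside the ball to points outside the box, so the ball has to be
mapped into the box. Together these facts form a `ConeSystem`, for `g` and, with the bundles
exchanged, for `g⁻¹` (`exists_coneSystem`).

Given a `ConeSystem`, call two points stably related if they remain forever at distance `O(δ)`,
their difference staying in the stable cones. The rest of the argument concerns this relation.

* Uniqueness (`ConeSystem.eq_of_stableRel`): two points which are stably related to a third one and
  differ in an unstable direction coincide. Otherwise, by the domination, their distance would
  outgrow exponentially their distances to the third point, against the triangle inequality.
* Existence (`ConeSystem.exists_plaque`): the stable disk of size `δ` at `gⁿ(y)` is pulled back by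
  `g⁻ⁿ`, keeping the points whose orbit has stable displacement at most `δ` from that of `y`. Over
  a ball of `E^s` of uniform size, contraction makes the constraints strict and transversality of
  the cones makes the stable coordinate an open map; the ball being connected, the pulled back set
  covers it. The plaque is an ultrafilter limit of these sets as `n → ∞`.
* Regularity (`ConeSystem.PlaqueFamily.hasTorusFDerivAt`): the vectors whose forward iterates stay
  in the stable cones form a continuous bundle of the dimension of `E^s`, by the linear versions of
  the two previous points (`ConeSystem.exists_stable_graph`, `continuous_projection`). Each limit
  direction of stably related points lies in this bundle, so that the plaques are `C¹` and tangent
  to it.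

The stable relation is therefore, locally, the plaque relation of a foliation; it is invariant
under `g`, hence so is the foliation (`ConeSystem.foliation_isInvariant`). The same construction for
`g⁻¹` gives the centre-unstable foliation, and the two bundles are complementary and dominated by
`ConeSystem.deriv_dom`.
-/

noncomputable section

namespace TorusDyn

variable {d : ℕ}

/-! ### Small differences on the torus -/


/-- The Euclidean distance on the torus. -/
def tdist (y x : T d) : ℝ := ‖diffVec y x‖

lemma proj_zero : proj (0 : E d) = 0 := by
  funext i; simp [proj]

lemma proj_add (v w : E d) : proj (v + w) = proj v + proj w := by
  funext i; simp [proj]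

lemma proj_neg (v : E d) : proj (-v) = -proj v := by
  funext i; simp [proj]

lemma proj_sub (v w : E d) : proj (v - w) = proj v - proj w := by
  funext i; simp [proj]

lemma continuous_proj : Continuous (proj : E d → T d) := by
  refine continuous_pi fun i => ?_
  exact (AddCircle.continuous_mk' (1 : ℝ)).comp (by fun_prop : Continuous fun v : E d => v i)

lemma proj_diffVec (y x : T d) : proj (diffVec y x) = y - x := by
  funext i
  simp [proj, diffVec, AddCircle.coe_equivIco]

lemma add_proj_diffVec (y x : T d) : x + proj (diffVec y x) = y := by
  rw [proj_diffVec]; abel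

lemma diffVec_apply_mem (y x : T d) (i : Fin d) :
    diffVec y x i ∈ Set.Ico (-1 / 2 : ℝ) (1 / 2) := by
  have := (AddCircle.equivIco (1 : ℝ) (-1 / 2) (y i - x i)).2
  rw [show (1 / 2 : ℝ) = -1 / 2 + 1 by norm_num]
  exact this

lemma norm_diffVec_apply (y x : T d) (i : Fin d) : |diffVec y x i| = ‖y i - x i‖ := by
  have h1 := diffVec_apply_mem y x i
  have h2 : ((diffVec y x i : ℝ) : UnitAddCircle) = y i - x i := by
    have := congrFun (proj_diffVec y x) i
    simpa [proj] using this
  rw [← h2]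
  refine ((AddCircle.norm_coe_eq_abs_iff (1 : ℝ) one_ne_zero).2 ?_).symm
  rw [abs_le]; constructor <;> norm_num <;> linarith [h1.1, h1.2]

lemma tdist_eq (y x : T d) : tdist y x = ‖(WithLp.toLp 2 fun i => ‖y i - x i‖ : E d)‖ := by
  simp only [tdist, EuclideanSpace.norm_eq]
  congr 1
  refine Finset.sum_congr rfl fun i _ => ?_
  simp [norm_diffVec_apply]

lemma continuous_tdist : Continuous fun p : T d × T d => tdist p.1 p.2 := by
  simp only [tdist_eq, EuclideanSpace.norm_eq]
  fun_prop

lemma tdist_comm (y x : T d) : tdist y x = tdist x y := by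
  simp only [tdist_eq, norm_sub_rev]

lemma tdist_nonneg (y x : T d) : 0 ≤ tdist y x := norm_nonneg _

lemma tdist_triangle (z y x : T d) : tdist z x ≤ tdist z y + tdist y x := by
  simp only [tdist_eq]
  refine le_trans ?_ (norm_add_le _ _)
  simp only [EuclideanSpace.norm_eq]
  refine Real.sqrt_le_sqrt (Finset.sum_le_sum fun i _ => ?_)
  simp only [PiLp.add_apply, Real.norm_eq_abs, sq_abs]
  exact pow_le_pow_left₀ (norm_nonneg _) (norm_sub_le_norm_sub_add_norm_sub _ _ _) 2

lemma diffVec_self (x : T d) : diffVec x x = 0 := by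
  ext i
  have := norm_diffVec_apply x x i
  simpa using this

lemma tdist_self (x : T d) : tdist x x = 0 := by simp [tdist, diffVec_self]

lemma diffVec_eq_zero {y x : T d} : diffVec y x = 0 ↔ y = x := by
  constructor
  · intro h
    rw [← add_proj_diffVec y x, h, proj_zero, add_zero]
  · rintro rfl; exact diffVec_self _

lemma tdist_eq_zero {y x : T d} : tdist y x = 0 ↔ y = x := by
  rw [tdist, norm_eq_zero, diffVec_eq_zero]

lemma tdist_pos {y x : T d} (h : y ≠ x) : 0 < tdist y x :=
  lt_of_le_of_ne (tdist_nonneg _ _) fun h' => h (tdist_eq_zero.1 h'.symm)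

lemma abs_apply_le_norm (v : E d) (i : Fin d) : |v i| ≤ ‖v‖ := by
  simpa using PiLp.norm_apply_le v i

/-- A short vector is the difference of the points that it joins. -/
lemma diffVec_add_proj (x : T d) {v : E d} (hv : ‖v‖ < 1 / 2) : diffVec (x + proj v) x = v := by
  ext i
  have h2 := abs_lt.1 ((abs_apply_le_norm v i).trans_lt hv)
  have : AddCircle.equivIco (1 : ℝ) (-1 / 2) ((x + proj v) i - x i) = ⟨v i, by
      constructor <;> linarith [h2.1, h2.2]⟩ := by
    rw [← Equiv.eq_symm_apply]
    simp [proj, AddCircle.equivIco, QuotientAddGroup.equivIcoMod]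
  change ((AddCircle.equivIco (1 : ℝ) (-1 / 2) ((x + proj v) i - x i) : ℝ)) = v i
  rw [this]

/-- The difference vector has the least length among the lifts of a difference. -/
lemma tdist_add_proj_le (x : T d) (v : E d) : tdist (x + proj v) x ≤ ‖v‖ := by
  rw [tdist_eq]
  simp only [EuclideanSpace.norm_eq]
  refine Real.sqrt_le_sqrt (Finset.sum_le_sum fun i _ => ?_)
  simp only [Real.norm_eq_abs, sq_abs, Pi.add_apply, add_sub_cancel_left, proj]
  rw [← sq_abs (v i)]
  refine pow_le_pow_left₀ (norm_nonneg _) ?_ 2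
  rw [UnitAddCircle.norm_eq]
  exact round_le (v i) 0 |>.trans (by simp)

lemma tdist_add_proj (x : T d) {v : E d} (hv : ‖v‖ < 1 / 2) : tdist (x + proj v) x = ‖v‖ := by
  rw [tdist, diffVec_add_proj x hv]

lemma diffVec_add {z y x : T d} (h : tdist z y + tdist y x < 1 / 2) :
    diffVec z x = diffVec z y + diffVec y x := by
  have : z = x + proj (diffVec z y + diffVec y x) := by
    rw [proj_add, proj_diffVec, proj_diffVec]; abel
  conv_lhs => rw [this]
  exact diffVec_add_proj x ((norm_add_le _ _).trans_lt h)

lemma diffVec_comm {y x : T d} (h : tdist y x < 1 / 2) : diffVec x y = -diffVec y x := by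
  have : x = y + proj (-diffVec y x) := by
    rw [proj_neg, proj_diffVec]; abel
  conv_lhs => rw [this]
  exact diffVec_add_proj y (by simpa [tdist] using h)

lemma diffVec_sub {z y x : T d} (h : tdist z x + tdist y x < 1 / 2) :
    diffVec z y = diffVec z x - diffVec y x := by
  have h1 : tdist x y = tdist y x := tdist_comm _ _
  have h2 := tdist_nonneg z x
  rw [diffVec_add (z := z) (y := x) (x := y) (by rw [h1]; exact h),
    diffVec_comm (y := y) (x := x) (by linarith), sub_eq_add_neg]

lemma tendsto_tdist {X : Type*} {l : Filter X} {a b : X → T d} {a₀ b₀ : T d}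
    (ha : Filter.Tendsto a l (𝓝 a₀)) (hb : Filter.Tendsto b l (𝓝 b₀)) :
    Filter.Tendsto (fun n => tdist (a n) (b n)) l (𝓝 (tdist a₀ b₀)) := by
  have h1 := continuous_tdist.tendsto (a₀, b₀)
  have h2 : Filter.Tendsto (fun n => (a n, b n)) l (𝓝 (a₀, b₀)) := ha.prodMk_nhds hb
  simpa only [Function.comp_def] using h1.comp h2

lemma tendsto_diffVec {X : Type*} {l : Filter X} {a b : X → T d} {a₀ b₀ : T d}
    (ha : Filter.Tendsto a l (𝓝 a₀)) (hb : Filter.Tendsto b l (𝓝 b₀))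
    (h : tdist a₀ b₀ < 1 / 2) :
    Filter.Tendsto (fun n => diffVec (a n) (b n)) l (𝓝 (diffVec a₀ b₀)) := by
  have e1 : Filter.Tendsto (fun n => tdist (a n) a₀) l (𝓝 0) := by
    simpa [tdist_self] using tendsto_tdist ha (tendsto_const_nhds (x := a₀))
  have e2 : Filter.Tendsto (fun n => tdist b₀ (b n)) l (𝓝 0) := by
    simpa [tdist_self] using tendsto_tdist (tendsto_const_nhds (x := b₀)) hb
  have f1 : Filter.Tendsto (fun n => diffVec (a n) a₀) l (𝓝 0) :=
    tendsto_zero_iff_norm_tendsto_zero.2 e1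
  have f2 : Filter.Tendsto (fun n => diffVec b₀ (b n)) l (𝓝 0) :=
    tendsto_zero_iff_norm_tendsto_zero.2 e2
  have key : Filter.Tendsto (fun n => diffVec (a n) a₀ + diffVec a₀ b₀ + diffVec b₀ (b n)) l
      (𝓝 (diffVec a₀ b₀)) := by
    simpa using (f1.add (tendsto_const_nhds (x := diffVec a₀ b₀))).add f2
  refine key.congr' ?_
  have e3 : Filter.Tendsto (fun n => tdist (a n) a₀ + tdist a₀ b₀ + tdist b₀ (b n)) l
      (𝓝 (tdist a₀ b₀)) := by
    simpa using (e1.add (tendsto_const_nhds (x := tdist a₀ b₀))).add e2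
  filter_upwards [e3.eventually (gt_mem_nhds h)] with n hn
  have h1 := tdist_nonneg (a n) a₀
  have h2 := tdist_nonneg b₀ (b n)
  have h3 := tdist_triangle (a n) a₀ b₀
  rw [← diffVec_add (by linarith), ← diffVec_add (by linarith)]

lemma eventually_tdist_lt (x : T d) {r : ℝ} (hr : 0 < r) : ∀ᶠ y in 𝓝 x, tdist y x < r := by
  have := tendsto_tdist (Filter.tendsto_id (x := 𝓝 x)) (tendsto_const_nhds (x := x))
  rw [tdist_self] at this
  exact this.eventually (gt_mem_nhds hr)

lemma norm_proj_le (v : E d) : ‖proj v‖ ≤ ‖v‖ := by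
  rw [pi_norm_le_iff_of_nonneg (norm_nonneg _)]
  intro i
  refine le_trans ?_ (abs_apply_le_norm v i)
  simp only [proj, UnitAddCircle.norm_eq]
  exact round_le (v i) 0 |>.trans (by simp)

lemma dist_le_tdist (y x : T d) : dist y x ≤ tdist y x := by
  rw [dist_eq_norm, ← proj_diffVec]
  exact norm_proj_le _

/-- Uniform continuity of a map on the torus, in terms of the Euclidean distance. -/
lemma exists_tdist_lt_of_continuous {Y : Type*} [PseudoMetricSpace Y] {F : T d → Y}
    (hF : Continuous F) {η : ℝ} (hη : 0 < η) :
    ∃ r > 0, ∀ x y, tdist y x < r → dist (F y) (F x) < η := by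
  obtain ⟨r, hr, h⟩ := Metric.uniformContinuous_iff.1
    (CompactSpace.uniformContinuous_of_continuous hF) η hη
  exact ⟨r, hr, fun x y hxy => h ((dist_le_tdist y x).trans_lt hxy)⟩

lemma exists_tdist_lt_of_continuous_torus {F : T d → T d}
    (hF : Continuous F) {η : ℝ} (hη : 0 < η) :
    ∃ r > 0, ∀ x y, tdist y x < r → tdist (F y) (F x) < η := by
  have h0 : UniformContinuous fun p : T d × T d => tdist p.1 p.2 :=
    CompactSpace.uniformContinuous_of_continuous continuous_tdist
  obtain ⟨s, hs, h1⟩ := Metric.uniformContinuous_iff.1 h0 η hη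
  obtain ⟨r, hr, h⟩ := exists_tdist_lt_of_continuous hF hs
  refine ⟨r, hr, fun x y hxy => ?_⟩
  have := h1 (a := (F y, F x)) (b := (F x, F x)) (by
    simpa [Prod.dist_eq, hs] using h x y hxy)
  rw [tdist_self, Real.dist_eq, sub_zero, abs_of_nonneg (tdist_nonneg _ _)] at this
  exact this

lemma tdist_le_sqrt (y x : T d) : tdist y x ≤ Real.sqrt d := by
  rw [tdist, EuclideanSpace.norm_eq]
  refine Real.sqrt_le_sqrt ?_
  calc ∑ i, ‖diffVec y x i‖ ^ 2 ≤ ∑ _i : Fin d, (1 : ℝ) := by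
        refine Finset.sum_le_sum fun i _ => ?_
        have h := diffVec_apply_mem y x i
        have : |diffVec y x i| ≤ 1 := abs_le.2 ⟨by linarith [h.1], by linarith [h.2]⟩
        simpa using this
    _ = d := by simp

/-! ### Differential calculus for maps into the torus -/

section Calculus
variable {V : Type*} [NormedAddCommGroup V] [NormedSpace ℝ V]

lemma HasTorusFDerivAt.tendsto_diffVec {q : V → T d} {L : V →L[ℝ] E d} {u : V}
    (hq : HasTorusFDerivAt q L u) :
    Filter.Tendsto (fun w => diffVec (q w) (q u)) (𝓝 u) (𝓝 0) := by
  have h : Filter.Tendsto (fun w => diffVec (q w) (q u)) (𝓝 u) (𝓝 (diffVec (q u) (q u))) :=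
    HasFDerivAt.continuousAt hq
  rwa [diffVec_self] at h

lemma HasTorusFDerivAt.hasFDerivAt_diffVec {q : V → T d} {L : V →L[ℝ] E d} {u : V}
    (hq : HasTorusFDerivAt q L u) {x : T d} (hx : tdist (q u) x < 1 / 2) :
    HasFDerivAt (fun w => diffVec (q w) x) L u := by
  have h1 : HasFDerivAt (fun w => diffVec (q w) (q u) + diffVec (q u) x) L u :=
    HasFDerivAt.add_const (diffVec (q u) x) hq
  refine h1.congr_of_eventuallyEq ?_
  have h2 := (tendsto_zero_iff_norm_tendsto_zero.1 hq.tendsto_diffVec).eventually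
    (gt_mem_nhds (sub_pos.2 hx))
  filter_upwards [h2] with w hw
  exact diffVec_add (by change ‖_‖ + _ < _; linarith)

/-- The chain rule. -/
lemma HasTorusFDerivAt.comp {q : V → T d} {L : V →L[ℝ] E d} {u : V} {p : T d → T d}
    {A : E d →L[ℝ] E d} (hp : HasTorusFDerivAt (fun v : E d => p (q u + proj v)) A 0)
    (hq : HasTorusFDerivAt q L u) : HasTorusFDerivAt (fun w => p (q w)) (A.comp L) u := by
  have h1 : HasFDerivAt (fun v : E d => diffVec (p (q u + proj v)) (p (q u)))
      A (diffVec (q u) (q u)) := by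
    rw [diffVec_self]
    simpa [HasTorusFDerivAt, proj_zero] using hp
  have h2 := HasFDerivAt.comp u h1 hq
  simpa [HasTorusFDerivAt, Function.comp_def, add_proj_diffVec] using h2

lemma hasTorusFDerivAt_add_proj (x : T d) (A : V →L[ℝ] E d) (u : V) :
    HasTorusFDerivAt (fun w => x + proj (A w)) A u := by
  have h1 : HasFDerivAt (fun w => A w - A u) A u := A.hasFDerivAt.sub_const _
  refine HasFDerivAt.congr_of_eventuallyEq h1 ?_
  have : ∀ᶠ w in 𝓝 u, ‖A w - A u‖ < 1 / 2 := by
    have h : Filter.Tendsto (fun w => ‖A w - A u‖) (𝓝 u) (𝓝 ‖A u - A u‖) :=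
      ((A.continuous.sub continuous_const).norm).tendsto u
    rw [sub_self, norm_zero] at h
    exact h.eventually (gt_mem_nhds (by norm_num))
  filter_upwards [this] with w hw
  have e : x + proj (A w) = (x + proj (A u)) + proj (A w - A u) := by rw [proj_sub]; abel
  rw [e, diffVec_add_proj _ hw]

lemma HasTorusFDerivAt.unique {q : V → T d} {L L' : V →L[ℝ] E d} {u : V}
    (h : HasTorusFDerivAt q L u) (h' : HasTorusFDerivAt q L' u) : L = L' :=
  HasFDerivAt.unique h h'

end Calculus

namespace TorusDiffeo

/-- The derivative at an arbitrary vector of the map read in the universal covering. -/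
lemma hasDeriv_at (g : TorusDiffeo d) (x : T d) (v : E d) :
    HasTorusFDerivAt (fun w : E d => g (x + proj w)) (g.D (x + proj v) : E d →L[ℝ] E d) v := by
  have := HasTorusFDerivAt.comp (p := g) (q := fun w : E d => x + proj w) (u := v)
    (g.hasDeriv (x + proj v)) (hasTorusFDerivAt_add_proj x (ContinuousLinearMap.id ℝ (E d)) v)
  simpa using this

/-- The inverse diffeomorphism. -/
def symm (g : TorusDiffeo d) : TorusDiffeo d where
  toHomeo := g.toHomeo.symm
  D x := (g.D (g.toHomeo.symm x)).symm
  continuous_D := by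
    have h : ∀ x, (((g.D (g.toHomeo.symm x)).symm : E d ≃L[ℝ] E d) : E d →L[ℝ] E d) =
        ContinuousLinearMap.inverse ((g.D (g.toHomeo.symm x) : E d →L[ℝ] E d)) := fun x =>
      (ContinuousLinearMap.inverse_equiv _).symm
    simp only [h]
    refine continuous_iff_continuousAt.2 fun x => ?_
    have h1 := (contDiffAt_map_inverse (n := 0) (𝕜 := ℝ) (g.D (g.toHomeo.symm x))).continuousAt
    exact ContinuousAt.comp (f := fun x => (g.D (g.toHomeo.symm x) : E d →L[ℝ] E d)) h1
      (g.continuous_D.comp g.toHomeo.symm.continuous).continuousAt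
  hasDeriv x := by
    set y := g.toHomeo.symm x with hy
    have hx : g.toHomeo y = x := by simp [hy]
    have h1 : HasFDerivAt (fun w : E d => diffVec (g (y + proj w)) x)
        (g.D y : E d →L[ℝ] E d) 0 := by
      have := g.hasDeriv y
      simpa [HasTorusFDerivAt, proj_zero, hx] using this
    have hc : ContinuousAt (fun v : E d => diffVec (g.toHomeo.symm (x + proj v)) y) 0 := by
      have h2 : Filter.Tendsto (fun v : E d => g.toHomeo.symm (x + proj v)) (𝓝 0) (𝓝 y) := by
        have : Continuous fun v : E d => g.toHomeo.symm (x + proj v) :=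
          g.toHomeo.symm.continuous.comp (continuous_const.add continuous_proj)
        have h3 := this.tendsto 0
        simpa [proj_zero] using h3
      have h3 := TorusDyn.tendsto_diffVec h2 (tendsto_const_nhds (x := y))
        (by rw [tdist_self]; norm_num)
      simpa [ContinuousAt, proj_zero, ← hy] using h3
    have h4 : HasFDerivAt (fun v : E d => diffVec (g.toHomeo.symm (x + proj v)) y)
        ((g.D y).symm : E d →L[ℝ] E d) 0 := by
      refine HasFDerivAt.of_local_left_inverse (f := fun w : E d => diffVec (g (y + proj w)) x)
        (f' := g.D y) hc ?_ ?_
      · simpa [proj_zero, ← hy, diffVec_self] using h1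
      · filter_upwards [Metric.ball_mem_nhds (0 : E d) (by norm_num : (0 : ℝ) < 1 / 2)] with v hv
        rw [mem_ball_zero_iff] at hv
        simp only [add_proj_diffVec, Homeomorph.apply_symm_apply]
        exact diffVec_add_proj x hv
    simpa [HasTorusFDerivAt, proj_zero, ← hy] using h4

@[simp] lemma symm_apply_apply (g : TorusDiffeo d) (x : T d) : g.symm (g x) = x :=
  g.toHomeo.symm_apply_apply x

@[simp] lemma apply_symm_apply (g : TorusDiffeo d) (x : T d) : g (g.symm x) = x :=
  g.toHomeo.apply_symm_apply x

lemma symm_D (g : TorusDiffeo d) (x : T d) : g.symm.D x = (g.D (g.symm x)).symm := rfl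

lemma continuous (g : TorusDiffeo d) : Continuous g := g.toHomeo.continuous

lemma continuous_iterate (g : TorusDiffeo d) (n : ℕ) : Continuous (g^[n]) :=
  g.continuous.iterate n

lemma iterate_symm_iterate (g : TorusDiffeo d) (n : ℕ) (x : T d) : g.symm^[n] (g^[n] x) = x :=
  Function.LeftInverse.iterate g.symm_apply_apply n x

lemma iterate_iterate_symm (g : TorusDiffeo d) (n : ℕ) (x : T d) : g^[n] (g.symm^[n] x) = x :=
  Function.LeftInverse.iterate g.apply_symm_apply n x

lemma hasDeriv_iterate (g : TorusDiffeo d) (n : ℕ) (x : T d) :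
    HasTorusFDerivAt (fun v : E d => g^[n] (x + proj v)) (g.Diter n x) 0 := by
  induction n with
  | zero =>
    simpa [Diter] using hasTorusFDerivAt_add_proj x (ContinuousLinearMap.id ℝ (E d)) 0
  | succ n ih =>
    have := HasTorusFDerivAt.comp (p := g) (q := fun v : E d => g^[n] (x + proj v)) (u := 0)
      (by simpa [proj_zero] using g.hasDeriv (g^[n] x)) ih
    simpa [Function.iterate_succ_apply', Diter] using this

lemma continuous_Diter (g : TorusDiffeo d) (n : ℕ) : Continuous (g.Diter n) := by
  induction n with
  | zero => exact continuous_const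
  | succ n ih =>
    exact (g.continuous_D.comp (g.continuous_iterate n)).clm_comp ih

lemma Diter_succ_apply (g : TorusDiffeo d) (n : ℕ) (x : T d) (v : E d) :
    g.Diter (n + 1) x v = g.D (g^[n] x) (g.Diter n x v) := rfl

lemma Diter_succ_apply' (g : TorusDiffeo d) (n : ℕ) (x : T d) (v : E d) :
    g.Diter (n + 1) x v = g.Diter n (g x) (g.D x v) := by
  induction n generalizing v with
  | zero => rfl
  | succ n ih => rw [Diter_succ_apply, ih, Diter_succ_apply, Function.iterate_succ_apply]

lemma symm_Diter_Diter (g : TorusDiffeo d) (n : ℕ) (x : T d) (v : E d) :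
    g.symm.Diter n (g^[n] x) (g.Diter n x v) = v := by
  induction n generalizing x v with
  | zero => rfl
  | succ n ih =>
    rw [Diter_succ_apply', Diter_succ_apply, Function.iterate_succ_apply', symm_apply_apply,
      symm_D, symm_apply_apply, ContinuousLinearEquiv.symm_apply_apply, ih]

lemma Diter_injective (g : TorusDiffeo d) (n : ℕ) (x : T d) :
    Function.Injective (g.Diter n x) :=
  Function.LeftInverse.injective (g.symm_Diter_Diter n x)

lemma Diter_symm_Diter (g : TorusDiffeo d) (n : ℕ) (x : T d) (v : E d) :
    g.Diter n x (g.symm.Diter n (g^[n] x) v) = v := by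
  obtain ⟨w, rfl⟩ := (LinearMap.injective_iff_surjective
    (f := (g.Diter n x : E d →ₗ[ℝ] E d))).1 (g.Diter_injective n x) v
  exact congrArg _ (g.symm_Diter_Diter n x w)

lemma exists_norm_D_le (g : TorusDiffeo d) : ∃ C > 0, ∀ x, ‖(g.D x : E d →L[ℝ] E d)‖ ≤ C := by
  obtain ⟨C, hC⟩ := isCompact_univ.exists_bound_of_continuousOn g.continuous_D.continuousOn
  exact ⟨max C 1, by positivity, fun x => (hC x trivial).trans (le_max_left _ _)⟩

/-- The derivative approximates the map uniformly on small scales. -/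
lemma exists_uniform_deriv (g : TorusDiffeo d) {η : ℝ} (hη : 0 < η) :
    ∃ r > 0, ∀ x y, tdist y x < r →
      ‖diffVec (g y) (g x) - g.D x (diffVec y x)‖ ≤ η * tdist y x := by
  obtain ⟨r₁, hr₁, h₁⟩ := exists_tdist_lt_of_continuous g.continuous_D hη
  obtain ⟨r₂, hr₂, h₂⟩ := exists_tdist_lt_of_continuous_torus g.continuous
    (by norm_num : (0 : ℝ) < 1 / 2)
  refine ⟨min r₁ r₂, lt_min hr₁ hr₂, fun x y hxy => ?_⟩
  have hd : ∀ w ∈ Metric.ball (0 : E d) (min r₁ r₂), tdist (x + proj w) x < min r₁ r₂ :=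
    fun w hw => (tdist_add_proj_le x w).trans_lt (mem_ball_zero_iff.1 hw)
  have key := (convex_ball (0 : E d) (min r₁ r₂)).norm_image_sub_le_of_norm_hasFDerivWithin_le'
    (f := fun w => diffVec (g (x + proj w)) (g x))
    (f' := fun w => (g.D (x + proj w) : E d →L[ℝ] E d)) (φ := (g.D x : E d →L[ℝ] E d)) (C := η)
    (x := 0) (y := diffVec y x)
    (fun w hw => ((g.hasDeriv_at x w).hasFDerivAt_diffVec
      (h₂ _ _ ((hd w hw).trans_le (min_le_right _ _)))).hasFDerivWithinAt)
    (fun w hw => by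
      have := h₁ _ _ ((hd w hw).trans_le (min_le_left _ _))
      rw [dist_eq_norm] at this
      exact this.le)
    (Metric.mem_ball_self (lt_min hr₁ hr₂)) (mem_ball_zero_iff.2 hxy)
  simpa [add_proj_diffVec, proj_zero, diffVec_self, tdist] using key

lemma exists_lipschitz (g : TorusDiffeo d) :
    ∃ L > 0, ∀ x y, tdist (g y) (g x) ≤ L * tdist y x := by
  obtain ⟨C, hC, h⟩ := g.exists_norm_D_le
  obtain ⟨r, hr, h1⟩ := g.exists_uniform_deriv one_pos
  refine ⟨max (C + 1) (Real.sqrt d / r), lt_max_of_lt_left (by linarith), fun x y => ?_⟩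
  rcases lt_or_ge (tdist y x) r with hxy | hxy
  · have h2 : ‖g.D x (diffVec y x)‖ ≤ C * tdist y x :=
      ((g.D x : E d →L[ℝ] E d).le_opNorm _).trans
        (mul_le_mul_of_nonneg_right (h x) (norm_nonneg _))
    have h3 : tdist (g y) (g x) ≤ (C + 1) * tdist y x := by
      have := norm_le_norm_add_norm_sub' (diffVec (g y) (g x)) (g.D x (diffVec y x))
      have h4 := h1 x y hxy
      change ‖_‖ ≤ _
      linarith
    exact h3.trans (mul_le_mul_of_nonneg_right (le_max_left _ _) (tdist_nonneg _ _))
  · calc tdist (g y) (g x) ≤ Real.sqrt d / r * r := by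
          rw [div_mul_cancel₀ _ hr.ne']; exact tdist_le_sqrt _ _
      _ ≤ _ := mul_le_mul (le_max_right _ _) hxy hr.le
          (le_max_of_le_left (by linarith))

end TorusDiffeo

/-! ### Norms, splittings and cones -/

namespace TorusMetric
variable (h : TorusMetric d)

lemma inner_self_nonneg (x : T d) (v : E d) : 0 ≤ h.inner x v v := by
  rcases eq_or_ne v 0 with rfl | hv
  · simp
  · exact (h.pos x v hv).le

lemma norm_nonneg (x : T d) (v : E d) : 0 ≤ h.norm x v := Real.sqrt_nonneg _

lemma norm_sq (x : T d) (v : E d) : h.norm x v ^ 2 = h.inner x v v :=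
  Real.sq_sqrt (h.inner_self_nonneg x v)

lemma norm_smul (x : T d) (t : ℝ) (v : E d) : h.norm x (t • v) = |t| * h.norm x v := by
  simp only [norm, map_smul, smul_apply, smul_eq_mul]
  rw [← mul_assoc, ← sq, Real.sqrt_mul (sq_nonneg t), Real.sqrt_sq_eq_abs]

lemma norm_zero (x : T d) : h.norm x 0 = 0 := by simp [norm]

lemma norm_neg (x : T d) (v : E d) : h.norm x (-v) = h.norm x v := by simp [norm]

lemma norm_pos (x : T d) {v : E d} (hv : v ≠ 0) : 0 < h.norm x v :=
  Real.sqrt_pos.2 (h.pos x v hv)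

lemma inner_le_norm_mul_norm (x : T d) (v w : E d) :
    h.inner x v w ≤ h.norm x v * h.norm x w := by
  let B : LinearMap.BilinForm ℝ (E d) :=
    LinearMap.mk₂ ℝ (fun v w => h.inner x v w) (by simp) (by simp) (by simp) (by simp)
  have hB : LinearMap.IsSymm B := ⟨fun v w => h.symm x v w⟩
  have := LinearMap.BilinForm.apply_sq_le_of_symm B (fun v => h.inner_self_nonneg x v) hB v w
  change h.inner x v w ^ 2 ≤ h.inner x v v * h.inner x w w at this
  rw [← h.norm_sq, ← h.norm_sq, ← mul_pow] at this
  exact le_of_sq_le_sq this (mul_nonneg (h.norm_nonneg _ _) (h.norm_nonneg _ _))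

lemma norm_add_le (x : T d) (v w : E d) : h.norm x (v + w) ≤ h.norm x v + h.norm x w := by
  refine le_of_sq_le_sq ?_ (add_nonneg (h.norm_nonneg _ _) (h.norm_nonneg _ _))
  have h1 := h.inner_le_norm_mul_norm x v w
  have h2 : h.inner x (v + w) (v + w) =
      h.inner x v v + 2 * h.inner x v w + h.inner x w w := by
    simp only [map_add, add_apply]
    rw [h.symm x w v]; ring
  rw [h.norm_sq, h2, add_sq, h.norm_sq, h.norm_sq]
  linarith

lemma continuous_norm : Continuous fun p : T d × E d => h.norm p.1 p.2 := by
  refine Real.continuous_sqrt.comp ?_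
  exact ((h.continuous_inner.comp continuous_fst).clm_apply continuous_snd).clm_apply
    continuous_snd

/-- The norms `‖·‖ₓ` are uniformly equivalent to the Euclidean norm. -/
lemma exists_norm_equiv : ∃ c > 0, ∃ C > 0, ∀ x v, c * ‖v‖ ≤ h.norm x v ∧ h.norm x v ≤ C * ‖v‖ := by
  have hK : IsCompact (Set.univ ×ˢ Metric.sphere (0 : E d) 1 : Set (T d × E d)) :=
    isCompact_univ.prod (isCompact_sphere 0 1)
  obtain ⟨c, hc, h1⟩ := hK.exists_forall_le' h.continuous_norm.continuousOn (a := 0)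
    (fun p hp => h.norm_pos p.1 (by
      have := mem_sphere_zero_iff_norm.1 hp.2
      rintro h0; simp [h0] at this))
  obtain ⟨C, h2⟩ := hK.exists_bound_of_continuousOn h.continuous_norm.continuousOn
  refine ⟨c, hc, max C 1, by positivity, fun x v => ?_⟩
  rcases eq_or_ne v 0 with rfl | hv
  · simp [h.norm_zero]
  have hv' : 0 < ‖v‖ := _root_.norm_pos_iff.2 hv
  have hmem : ((x, ‖v‖⁻¹ • v) : T d × E d) ∈
      (Set.univ ×ˢ Metric.sphere (0 : E d) 1 : Set (T d × E d)) := by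
    refine ⟨trivial, ?_⟩
    rw [mem_sphere_zero_iff_norm, _root_.norm_smul, norm_inv, _root_.norm_norm,
      inv_mul_cancel₀ hv'.ne']
  have e : h.norm x v = ‖v‖ * h.norm x (‖v‖⁻¹ • v) := by
    rw [h.norm_smul, abs_of_pos (inv_pos.2 hv'), ← mul_assoc, mul_inv_cancel₀ hv'.ne', one_mul]
  have h3 := h1 _ hmem
  have h4 := (le_abs_self _).trans (h2 _ hmem)
  simp only at h3 h4
  rw [e, mul_comm c, mul_comm (max C 1)]
  exact ⟨mul_le_mul_of_nonneg_left h3 hv'.le,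
    mul_le_mul_of_nonneg_left (h4.trans (le_max_left _ _)) hv'.le⟩

/-- The norm of the component of `v` in the first bundle. -/
def fstNorm (S : Splitting d) (x : T d) (v : E d) : ℝ := h.norm x (S.P x v)

end TorusMetric

namespace Splitting

/-- The splitting with the two bundles exchanged. -/
def compl (S : Splitting d) : Splitting d where
  P x := ContinuousLinearMap.id ℝ (E d) - S.P x
  idem x v := by simp [S.idem]
  continuous_P := continuous_const.sub S.continuous_P

variable (S : Splitting d)

lemma compl_P (x : T d) (v : E d) : S.compl.P x v = v - S.P x v := rfl

lemma mem_fst {x : T d} {v : E d} : v ∈ S.fst x ↔ S.P x v = v := by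
  constructor
  · rintro ⟨w, rfl⟩; exact S.idem x w
  · intro hv; exact ⟨v, hv⟩

lemma mem_snd {x : T d} {v : E d} : v ∈ S.snd x ↔ S.P x v = 0 := LinearMap.mem_ker

lemma P_mem_fst (x : T d) (v : E d) : S.P x v ∈ S.fst x := ⟨v, rfl⟩

lemma compl_fst (x : T d) : S.compl.fst x = S.snd x := by
  ext v; rw [mem_fst, mem_snd, compl_P, sub_eq_self]

lemma isCompl (x : T d) : IsCompl (S.fst x) (S.snd x) := by
  rw [isCompl_iff, disjoint_iff, codisjoint_iff]
  constructor
  · rw [Submodule.eq_bot_iff]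
    rintro v ⟨h1, h2⟩
    rw [← S.mem_fst.1 h1, S.mem_snd.1 h2]
  · rw [Submodule.eq_top_iff']
    intro v
    rw [Submodule.mem_sup]
    exact ⟨S.P x v, S.P_mem_fst x v, v - S.P x v, by
      rw [mem_snd, map_sub, S.idem, sub_self], by abel⟩

lemma finrank_add (x : T d) :
    Module.finrank ℝ (S.fst x) + Module.finrank ℝ (S.snd x) = d := by
  have := Submodule.finrank_add_eq_of_isCompl (S.isCompl x)
  simpa using this

/-- The torus being connected, the bundles have constant rank: it is the trace of the
projection. -/
lemma finrank_fst_eq (x y : T d) : Module.finrank ℝ (S.fst x) = Module.finrank ℝ (S.fst y) := by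
  have htr : ∀ x, LinearMap.trace ℝ (E d) (S.P x : E d →ₗ[ℝ] E d) =
      (Module.finrank ℝ (S.fst x) : ℝ) := fun x =>
    LinearMap.IsProj.trace ⟨fun v => S.P_mem_fst x v, fun v hv => S.mem_fst.1 hv⟩
  have hc : Continuous fun x => (Module.finrank ℝ (S.fst x) : ℝ) := by
    simp only [← htr]
    let φ : (E d →L[ℝ] E d) →ₗ[ℝ] ℝ :=
      (LinearMap.trace ℝ (E d)).comp (ContinuousLinearMap.coeLM ℝ)
    exact (LinearMap.continuous_of_finiteDimensional φ).comp S.continuous_P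
  have hc' : Continuous fun x => Module.finrank ℝ (S.fst x) :=
    Nat.isClosedEmbedding_coe_real.isInducing.continuous_iff.2 hc
  exact PreconnectedSpace.constant inferInstance hc'

end Splitting

section Cones
variable (h : TorusMetric d) (S : Splitting d)

lemma coneS_compl (α : ℝ) (x : T d) : coneS h S.compl α x = coneU h S α x := by
  ext v; simp [coneS, coneU, Splitting.compl_P]

lemma coneU_compl (α : ℝ) (x : T d) : coneU h S.compl α x = coneS h S α x := by
  ext v; simp [coneS, coneU, Splitting.compl_P]

lemma zero_mem_coneS (α : ℝ) (x : T d) : (0 : E d) ∈ coneS h S α x := by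
  simp [coneS, h.norm_zero]

lemma zero_mem_coneU (α : ℝ) (x : T d) : (0 : E d) ∈ coneU h S α x := by
  simp [coneU, h.norm_zero]

variable {h S} in
lemma smul_mem_coneS {α : ℝ} {x : T d} {v : E d} (hv : v ∈ coneS h S α x) (t : ℝ) :
    t • v ∈ coneS h S α x := by
  simp only [coneS, Set.mem_ofPred_eq, map_smul, ← smul_sub, h.norm_smul] at hv ⊢
  calc _ ≤ |t| * (α * h.norm x (S.P x v)) := mul_le_mul_of_nonneg_left hv (abs_nonneg t)
    _ = _ := by ring

variable {h S} in
lemma smul_mem_coneU {α : ℝ} {x : T d} {v : E d} (hv : v ∈ coneU h S α x) (t : ℝ) :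
    t • v ∈ coneU h S α x := by
  rw [← coneS_compl] at *; exact smul_mem_coneS hv t

lemma continuous_fstNorm : Continuous fun p : T d × E d => h.fstNorm S p.1 p.2 :=
  h.continuous_norm.comp
    (continuous_fst.prodMk ((S.continuous_P.comp continuous_fst).clm_apply continuous_snd))

variable {S} in
lemma tendsto_fstNorm {X : Type*} {l : Filter X} {x : X → T d} {v : X → E d} {x₀ : T d}
    {v₀ : E d} (hx : Filter.Tendsto x l (𝓝 x₀)) (hv : Filter.Tendsto v l (𝓝 v₀)) :
    Filter.Tendsto (fun n => h.fstNorm S (x n) (v n)) l (𝓝 (h.fstNorm S x₀ v₀)) := by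
  have h1 := (continuous_fstNorm h S).tendsto (x₀, v₀)
  have h2 : Filter.Tendsto (fun n => (x n, v n)) l (𝓝 (x₀, v₀)) := hx.prodMk_nhds hv
  simpa only [Function.comp_def] using h1.comp h2

variable {h S} in
lemma mem_coneS_of_tendsto {α : ℝ} {X : Type*} {l : Filter X} [l.NeBot] {x : X → T d}
    {v : X → E d} {x₀ : T d} {v₀ : E d} (hx : Filter.Tendsto x l (𝓝 x₀))
    (hv : Filter.Tendsto v l (𝓝 v₀)) (hm : ∀ᶠ n in l, v n ∈ coneS h S α (x n)) :
    v₀ ∈ coneS h S α x₀ :=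
  le_of_tendsto_of_tendsto (tendsto_fstNorm (S := S.compl) h hx hv)
    ((tendsto_fstNorm (S := S) h hx hv).const_mul α) (hm.mono fun _ hn => hn)

variable {h S} in
lemma mem_coneU_of_tendsto {α : ℝ} {X : Type*} {l : Filter X} [l.NeBot] {x : X → T d}
    {v : X → E d} {x₀ : T d} {v₀ : E d} (hx : Filter.Tendsto x l (𝓝 x₀))
    (hv : Filter.Tendsto v l (𝓝 v₀)) (hm : ∀ᶠ n in l, v n ∈ coneU h S α (x n)) :
    v₀ ∈ coneU h S α x₀ := by
  simp only [← coneS_compl] at *; exact mem_coneS_of_tendsto hx hv hm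

lemma fstNorm_nonneg (x : T d) (v : E d) : 0 ≤ h.fstNorm S x v := h.norm_nonneg _ _

lemma fstNorm_add_le (x : T d) (v w : E d) :
    h.fstNorm S x (v + w) ≤ h.fstNorm S x v + h.fstNorm S x w := by
  simp only [TorusMetric.fstNorm, map_add]; exact h.norm_add_le _ _ _

lemma fstNorm_smul (x : T d) (t : ℝ) (v : E d) :
    h.fstNorm S x (t • v) = |t| * h.fstNorm S x v := by
  simp only [TorusMetric.fstNorm, map_smul, h.norm_smul]

lemma norm_le_fstNorm_add (x : T d) (v : E d) :
    h.norm x v ≤ h.fstNorm S x v + h.fstNorm S.compl x v := by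
  have := h.norm_add_le x (S.P x v) (v - S.P x v)
  simpa [TorusMetric.fstNorm, Splitting.compl_P] using this

lemma exists_fstNorm_le : ∃ C > 0, ∀ x v, h.fstNorm S x v ≤ C * ‖v‖ := by
  obtain ⟨c, hc, C, hC, h1⟩ := h.exists_norm_equiv
  obtain ⟨B, hB⟩ := isCompact_univ.exists_bound_of_continuousOn S.continuous_P.continuousOn
  refine ⟨C * max B 1, by positivity, fun x v => ?_⟩
  have h2 : ‖S.P x v‖ ≤ max B 1 * ‖v‖ := ((S.P x).le_opNorm v).trans
    (mul_le_mul_of_nonneg_right ((hB x trivial).trans (le_max_left _ _)) (norm_nonneg _))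
  calc h.fstNorm S x v ≤ C * ‖S.P x v‖ := (h1 x _).2
    _ ≤ C * (max B 1 * ‖v‖) := mul_le_mul_of_nonneg_left h2 hC.le
    _ = _ := by ring

/-- The component norms vary little with the base point. -/
lemma exists_fstNorm_sub_le {η : ℝ} (hη : 0 < η) :
    ∃ r > 0, ∀ x x', tdist x x' < r → ∀ v, h.fstNorm S x v ≤ h.fstNorm S x' v + η * ‖v‖ := by
  have hK : IsCompact (Set.univ ×ˢ Metric.closedBall (0 : E d) 1 : Set (T d × E d)) :=
    isCompact_univ.prod (isCompact_closedBall 0 1)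
  obtain ⟨r, hr, h1⟩ := Metric.uniformContinuousOn_iff.1
    (hK.uniformContinuousOn_of_continuous (continuous_fstNorm h S).continuousOn) η hη
  refine ⟨r, hr, fun x x' hx v => ?_⟩
  rcases eq_or_ne v 0 with rfl | hv
  · simp [TorusMetric.fstNorm, h.norm_zero]
  have hv' : 0 < ‖v‖ := norm_pos_iff.2 hv
  set w := ‖v‖⁻¹ • v with hw
  have hwn : ‖w‖ = 1 := by rw [hw, norm_smul, norm_inv, norm_norm, inv_mul_cancel₀ hv'.ne']
  have hmem : ∀ y : T d, (y, w) ∈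
      (Set.univ ×ˢ Metric.closedBall (0 : E d) 1 : Set (T d × E d)) := fun y =>
    ⟨trivial, by simp [hwn]⟩
  have h2 := h1 (x, w) (hmem x) (x', w) (hmem x') (by
    simpa [Prod.dist_eq, hr] using (dist_le_tdist x x').trans_lt hx)
  have h3 : h.fstNorm S x w ≤ h.fstNorm S x' w + η := by
    have := (le_abs_self _).trans h2.le
    simp only at this; linarith
  have e : ‖v‖ • w = v := by rw [hw, smul_smul, mul_inv_cancel₀ hv'.ne', one_smul]
  have e' : ∀ y, h.fstNorm S y v = ‖v‖ * h.fstNorm S y w := fun y => by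
    conv_lhs => rw [← e]
    rw [fstNorm_smul, abs_of_pos hv']
  rw [e', e']
  nlinarith

/-- On a small scale, a stable cone contains no vector close to an unstable direction, and the
unstable directions lie in the unstable cones. -/
lemma exists_cone_scale {α : ℝ} (hα : 0 < α) :
    ∃ R > 0, ∃ C > 0, ∀ x x', tdist x x' < R → ∀ v,
      (S.P x' v = 0 → v ∈ coneU h S α x) ∧
      (v ∈ coneS h S α x → ‖v‖ ≤ C * h.fstNorm S x' v) := by
  obtain ⟨c, hc, _, _, h1⟩ := h.exists_norm_equiv
  have hη : 0 < min (c * α / (1 + α)) (c / (2 * (1 + α))) := by positivity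
  obtain ⟨r, hr, h2⟩ := exists_fstNorm_sub_le h S hη
  refine ⟨r, hr, 2 * (1 + α) / c, by positivity, fun x x' hx v => ⟨fun hv => ?_, fun hv => ?_⟩⟩
  · have h3 := h2 x x' hx v
    have h4 : h.fstNorm S x' v = 0 := by simp [TorusMetric.fstNorm, hv, h.norm_zero]
    have h5 : h.fstNorm S x v ≤ c * α / (1 + α) * ‖v‖ := by
      have := mul_le_mul_of_nonneg_right
        (min_le_left (c * α / (1 + α)) (c / (2 * (1 + α)))) (norm_nonneg v)
      linarith
    have h6 := (h1 x v).1.trans (norm_le_fstNorm_add h S x v)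
    change h.fstNorm S x v ≤ α * h.fstNorm S.compl x v
    rw [div_mul_eq_mul_div, le_div_iff₀ (by positivity)] at h5
    nlinarith
  · have h3 := h2 x x' hx v
    have hv' : h.fstNorm S.compl x v ≤ α * h.fstNorm S x v := hv
    have h5 : h.fstNorm S x v ≤ h.fstNorm S x' v + c / (2 * (1 + α)) * ‖v‖ := by
      have := mul_le_mul_of_nonneg_right
        (min_le_right (c * α / (1 + α)) (c / (2 * (1 + α)))) (norm_nonneg v)
      linarith
    have h6 := (h1 x v).1.trans (norm_le_fstNorm_add h S x v)
    have h7 : c * ‖v‖ ≤ (1 + α) * (h.fstNorm S x' v + c / (2 * (1 + α)) * ‖v‖) := by nlinarith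
    have h8 : (1 + α) * (c / (2 * (1 + α)) * ‖v‖) = c * ‖v‖ / 2 := by field_simp
    rw [div_mul_eq_mul_div, le_div_iff₀ hc]
    nlinarith

end Cones

/-! ### Cone systems -/

/-- A diffeomorphism `g` whose increments respect, at the Euclidean scale `R`, the cones of
aperture `α` around a reference splitting `S` and the domination with ratio `Λ`, and which on the
much smaller scale `δ` maps displacements of stable size `≤ δ` in the stable cones to
displacements of stable size `< δ`. The constant `C` bounds a vector of a cone by its component in
the core of a nearby cone. The conditions other than `norm_le` and `contract` are symmetric under
the exchange of `g` and its inverse and of the two bundles. -/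
structure ConeSystem (h : TorusMetric d) (S : Splitting d) (g : TorusDiffeo d)
    (α Λ R δ C : ℝ) : Prop where
  one_lt : 1 < Λ
  R_le : R ≤ 1 / 8
  δ_pos : 0 < δ
  C_pos : 0 < C
  δ_lt : 4 * (C * δ) < R
  mem_coneU : ∀ x x' v, tdist x x' < R → S.P x' v = 0 → v ∈ coneU h S α x
  mem_coneS : ∀ x x' v, tdist x x' < R → S.P x' v = v → v ∈ coneS h S α x
  norm_le : ∀ x x' v, tdist x x' < R → v ∈ coneS h S α x → ‖v‖ ≤ C * h.fstNorm S x' v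
  dom : ∀ x y z, tdist y x < R → tdist z x < R → tdist (g y) (g x) < R →
    tdist (g z) (g x) < R → diffVec y x ∈ coneU h S α x →
    diffVec (g z) (g x) ∈ coneS h S α (g x) →
      (y ≠ x → z ≠ x →
        Λ * (h.norm (g x) (diffVec (g z) (g x)) * h.norm x (diffVec y x)) <
          h.norm (g x) (diffVec (g y) (g x)) * h.norm x (diffVec z x)) ∧
      diffVec (g y) (g x) ∈ coneU h S α (g x) ∧ diffVec z x ∈ coneS h S α x
  contract : ∀ q y, diffVec q y ∈ coneS h S α y → h.fstNorm S y (diffVec q y) ≤ δ →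
    h.fstNorm S (g y) (diffVec (g q) (g y)) < δ
  close : ∀ q y, tdist q y ≤ 4 * (C * δ) → tdist (g q) (g y) < R
  close_symm : ∀ q y, tdist q y ≤ 4 * (C * δ) → tdist (g.symm q) (g.symm y) < R

/-- The difference quotients of a diffeomorphism along a vector converge to the derivative. -/
lemma TorusDiffeo.tendsto_slope (g : TorusDiffeo d) (x : T d) (v : E d) :
    Filter.Tendsto (fun t : ℝ => t⁻¹ • diffVec (g (x + proj (t • v))) (g x)) (𝓝[>] 0)
      (𝓝 (g.D x v)) := by
  have h1 : HasFDerivAt (fun w : E d => diffVec (g (x + proj w)) (g x))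
      (g.D x : E d →L[ℝ] E d) ((0 : ℝ) • v) := by
    simpa [HasTorusFDerivAt, proj_zero] using g.hasDeriv x
  have h2 : HasDerivAt (fun t : ℝ => t • v) ((1 : ℝ) • v) 0 := (hasDerivAt_id 0).smul_const v
  have h3 := h1.comp_hasDerivAt (0 : ℝ) h2
  have h4 := h3.tendsto_slope_zero_right
  simpa [Function.comp_def, proj_zero, diffVec_self] using h4

lemma tendsto_add_proj_smul (x : T d) (v : E d) :
    Filter.Tendsto (fun t : ℝ => x + proj (t • v)) (𝓝[>] 0) (𝓝 x) := by
  have : Continuous fun t : ℝ => x + proj (t • v) :=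
    continuous_const.add (continuous_proj.comp (continuous_id.smul continuous_const))
  have h := this.tendsto 0
  simp only [zero_smul, proj_zero, add_zero] at h
  exact h.mono_left nhdsWithin_le_nhds

lemma eventually_diffVec_add_proj_smul (x : T d) (v : E d) :
    ∀ᶠ t : ℝ in 𝓝[>] 0, diffVec (x + proj (t • v)) x = t • v := by
  have : Filter.Tendsto (fun t : ℝ => ‖t • v‖) (𝓝[>] 0) (𝓝 0) := by
    have h : Continuous fun t : ℝ => ‖t • v‖ := by fun_prop
    have h' := h.tendsto 0
    simp only [zero_smul, norm_zero] at h'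
    exact h'.mono_left nhdsWithin_le_nhds
  filter_upwards [this.eventually (gt_mem_nhds (by norm_num : (0 : ℝ) < 1 / 2))] with t ht
  exact diffVec_add_proj x ht

namespace ConeSystem
variable {h : TorusMetric d} {S : Splitting d} {g : TorusDiffeo d} {α Λ R δ C : ℝ}
  (H : ConeSystem h S g α Λ R δ C)
include H

lemma Cδ_pos : 0 < C * δ := mul_pos H.C_pos H.δ_pos

lemma R_pos : 0 < R := by linarith [H.δ_lt, H.Cδ_pos]

lemma mem_coneS_of_image {z x : T d} (hzx : tdist z x < R) (hg : tdist (g z) (g x) < R)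
    (hm : diffVec (g z) (g x) ∈ coneS h S α (g x)) : diffVec z x ∈ coneS h S α x :=
  (H.dom x x z (by rw [tdist_self]; exact H.R_pos) hzx (by rw [tdist_self]; exact H.R_pos) hg
    (by rw [diffVec_self]; exact zero_mem_coneU _ _ _ _) hm).2.2

lemma mem_coneU_image {y x : T d} (hyx : tdist y x < R) (hg : tdist (g y) (g x) < R)
    (hm : diffVec y x ∈ coneU h S α x) : diffVec (g y) (g x) ∈ coneU h S α (g x) :=
  (H.dom x y x hyx (by rw [tdist_self]; exact H.R_pos) hg (by rw [tdist_self]; exact H.R_pos) hm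
    (by rw [diffVec_self]; exact zero_mem_coneS _ _ _ _)).2.1

/-- Domination and cone invariance for the derivative. -/
lemma deriv_dom (x : T d) {u s : E d} (hu : u ∈ coneU h S α x)
    (hs : g.D x s ∈ coneS h S α (g x)) :
    Λ * (h.norm (g x) (g.D x s) * h.norm x u) ≤ h.norm (g x) (g.D x u) * h.norm x s ∧
      g.D x u ∈ coneU h S α (g x) ∧ s ∈ coneS h S α x := by
  let y : ℝ → T d := fun t => x + proj (t • u)
  let w : ℝ → T d := fun t => g x + proj (t • g.D x s)
  let z : ℝ → T d := fun t => g.symm (w t)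
  have hy : Filter.Tendsto y (𝓝[>] 0) (𝓝 x) := tendsto_add_proj_smul x u
  have hw : Filter.Tendsto w (𝓝[>] 0) (𝓝 (g x)) := tendsto_add_proj_smul _ _
  have hz : Filter.Tendsto z (𝓝[>] 0) (𝓝 x) := by
    have := (g.symm.continuous.tendsto (g x)).comp hw
    rwa [g.symm_apply_apply] at this
  have hgy : Filter.Tendsto (fun t => g (y t)) (𝓝[>] 0) (𝓝 (g x)) :=
    (g.continuous.tendsto x).comp hy
  have slope_y := g.tendsto_slope x u
  have slope_z : Filter.Tendsto (fun t : ℝ => t⁻¹ • diffVec (z t) x) (𝓝[>] 0) (𝓝 s) := by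
    have := g.symm.tendsto_slope (g x) (g.D x s)
    simpa [TorusDiffeo.symm_D] using this
  have hR := H.R_pos
  have small : ∀ᶠ t : ℝ in 𝓝[>] 0, 0 < t ∧ diffVec (y t) x = t • u ∧
      diffVec (w t) (g x) = t • g.D x s ∧ tdist (y t) x < R ∧ tdist (z t) x < R ∧
      tdist (g (y t)) (g x) < R ∧ tdist (w t) (g x) < R := by
    filter_upwards [self_mem_nhdsWithin, eventually_diffVec_add_proj_smul x u,
      eventually_diffVec_add_proj_smul (g x) (g.D x s), hy.eventually (eventually_tdist_lt x hR),
      hz.eventually (eventually_tdist_lt x hR), hgy.eventually (eventually_tdist_lt _ hR),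
      hw.eventually (eventually_tdist_lt _ hR)] with t h1 h2 h3 h4 h5 h6 h7
    exact ⟨h1, h2, h3, h4, h5, h6, h7⟩
  have main : ∀ᶠ t : ℝ in 𝓝[>] 0, 0 < t ∧ diffVec (y t) x = t • u ∧
      diffVec (w t) (g x) = t • g.D x s ∧ ((y t ≠ x → z t ≠ x →
        Λ * (h.norm (g x) (diffVec (w t) (g x)) * h.norm x (diffVec (y t) x)) <
          h.norm (g x) (diffVec (g (y t)) (g x)) * h.norm x (diffVec (z t) x)) ∧
      diffVec (g (y t)) (g x) ∈ coneU h S α (g x) ∧ diffVec (z t) x ∈ coneS h S α x) := by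
    filter_upwards [small] with t ⟨h1, h2, h3, h4, h5, h6, h7⟩
    have h8 : g (z t) = w t := g.apply_symm_apply _
    have := H.dom x (y t) (z t) h4 h5 h6 (by rwa [h8]) (by rw [h2]; exact smul_mem_coneU hu t)
      (by rw [h8, h3]; exact smul_mem_coneS hs t)
    rw [h8] at this
    exact ⟨h1, h2, h3, this⟩
  refine ⟨?_, ?_, ?_⟩
  · rcases eq_or_ne u 0 with rfl | hu0
    · simp [h.norm_zero]
    rcases eq_or_ne s 0 with rfl | hs0
    · simp [h.norm_zero]
    have t1 : Filter.Tendsto (fun t : ℝ => h.norm (g x) (t⁻¹ • diffVec (g (y t)) (g x)) *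
        h.norm x (t⁻¹ • diffVec (z t) x)) (𝓝[>] 0)
        (𝓝 (h.norm (g x) (g.D x u) * h.norm x s)) := by
      have c : ∀ x : T d, Continuous fun v => h.norm x v := fun x =>
        h.continuous_norm.comp (Continuous.prodMk_right x)
      exact (((c (g x)).tendsto _).comp slope_y).mul (((c x).tendsto _).comp slope_z)
    refine ge_of_tendsto t1 ?_
    filter_upwards [main] with t ⟨ht, h2, h3, h4, _⟩
    have hti : 0 < t⁻¹ := inv_pos.2 ht
    have hyx : y t ≠ x := fun e => by
      rw [e, diffVec_self] at h2
      exact (smul_ne_zero ht.ne' hu0) h2.symm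
    have hDs : g.D x s ≠ 0 := (g.D x).map_ne_zero_iff.2 hs0
    have hzx : z t ≠ x := fun e => by
      have : w t = g x := by rw [← e]; exact (g.apply_symm_apply _).symm
      rw [this, diffVec_self] at h3
      exact (smul_ne_zero ht.ne' hDs) h3.symm
    have h5 := h4 hyx hzx
    rw [h2, h3] at h5
    simp only [h.norm_smul, abs_of_pos ht, abs_of_pos hti] at h5 ⊢
    have h6 : t⁻¹ * t = 1 := inv_mul_cancel₀ ht.ne'
    calc _ = (t⁻¹ * t) * (t⁻¹ * t) * (Λ * (h.norm (g x) (g.D x s) * h.norm x u)) := by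
          rw [h6]; ring
      _ = t⁻¹ * t⁻¹ * (Λ * (t * h.norm (g x) (g.D x s) * (t * h.norm x u))) := by ring
      _ ≤ t⁻¹ * t⁻¹ * _ := mul_le_mul_of_nonneg_left h5.le (by positivity)
      _ = _ := by ring
  · refine mem_coneU_of_tendsto (tendsto_const_nhds (x := g x)) slope_y ?_
    filter_upwards [main] with t ht
    exact smul_mem_coneU ht.2.2.2.2.1 _
  · refine mem_coneS_of_tendsto (tendsto_const_nhds (x := x)) slope_z ?_
    filter_upwards [main] with t ht
    exact smul_mem_coneS ht.2.2.2.2.2 _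

end ConeSystem

/-! ### The stable relation and its uniqueness property -/

lemma exists_tendsto_of_norm_le {X : Type*} (U : Ultrafilter X) {v : X → E d} {r : ℝ}
    (hv : ∀ᶠ x in (U : Filter X), ‖v x‖ ≤ r) : ∃ a, Filter.Tendsto v U (𝓝 a) := by
  obtain ⟨a, -, ha⟩ := (isCompact_closedBall (0 : E d) r).ultrafilter_le_nhds (U.map v) (by
    rw [Filter.le_principal_iff, Ultrafilter.coe_map, Filter.mem_map]
    filter_upwards [hv] with x hx
    exact mem_closedBall_zero_iff.2 hx)
  exact ⟨a, ha⟩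

lemma exists_tendsto_torus {X : Type*} (U : Ultrafilter X) (y : X → T d) :
    ∃ a, Filter.Tendsto y U (𝓝 a) := by
  obtain ⟨a, -, ha⟩ := isCompact_univ.ultrafilter_le_nhds (U.map y) (by simp)
  exact ⟨a, ha⟩

/-- If at each step the ratio `A n / B n` grows at least by the factor `Λ`, then after `n` steps
it has grown by `Λ ^ n`. -/
lemma pow_mul_le_of_step {Λ : ℝ} (hΛ : 0 < Λ) {A B : ℕ → ℝ} (hA : ∀ n, 0 < A n)
    (hstep : ∀ n, Λ * (B (n + 1) * A n) ≤ A (n + 1) * B n) (n : ℕ) :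
    Λ ^ n * (B n * A 0) ≤ A n * B 0 := by
  induction n with
  | zero => simp [mul_comm]
  | succ n ih =>
    have h1 := mul_le_mul_of_nonneg_left (hstep n) (mul_nonneg (pow_pos hΛ n).le (hA 0).le)
    have h2 := mul_le_mul_of_nonneg_left ih (hA (n + 1)).le
    refine le_of_mul_le_mul_left ?_ (hA n)
    calc A n * (Λ ^ (n + 1) * (B (n + 1) * A 0)) =
          Λ ^ n * A 0 * (Λ * (B (n + 1) * A n)) := by ring
      _ ≤ Λ ^ n * A 0 * (A (n + 1) * B n) := h1
      _ = A (n + 1) * (Λ ^ n * (B n * A 0)) := by ring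
      _ ≤ A (n + 1) * (A n * B 0) := h2
      _ = _ := by ring

lemma false_of_pow_mul_le {Λ c K : ℝ} (hΛ : 1 < Λ) (hc : 0 < c) (hle : ∀ n : ℕ, Λ ^ n * c ≤ K) :
    False := by
  obtain ⟨n, hn⟩ := pow_unbounded_of_one_lt (K / c) hΛ
  have := hle n
  rw [← le_div_iff₀ hc] at this
  linarith

/-- The points `y` and `z` stay forever at distance at most `r`, and their difference stays in the
stable cones. -/
def StableRel (h : TorusMetric d) (S : Splitting d) (g : TorusDiffeo d) (α r : ℝ)
    (y z : T d) : Prop :=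
  ∀ n : ℕ, tdist (g^[n] z) (g^[n] y) ≤ r ∧
    diffVec (g^[n] z) (g^[n] y) ∈ coneS h S α (g^[n] y) ∧
    diffVec (g^[n] y) (g^[n] z) ∈ coneS h S α (g^[n] z)

section StableRel
variable {h : TorusMetric d} {S : Splitting d} {g : TorusDiffeo d} {α r : ℝ}

lemma StableRel.symm {y z : T d} (hr : StableRel h S g α r y z) : StableRel h S g α r z y :=
  fun n => ⟨by rw [tdist_comm]; exact (hr n).1, (hr n).2.2, (hr n).2.1⟩

lemma StableRel.image {y z : T d} (hr : StableRel h S g α r y z) :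
    StableRel h S g α r (g y) (g z) := fun n => by
  simpa only [Function.iterate_succ_apply] using hr (n + 1)

lemma stableRel_of_tendsto (hr : r < 1 / 2) {X : Type*} {l : Filter X} [l.NeBot]
    {y z : X → T d} {y₀ z₀ : T d} (hy : Filter.Tendsto y l (𝓝 y₀))
    (hz : Filter.Tendsto z l (𝓝 z₀))
    (hrel : ∀ n : ℕ, ∀ᶠ k in l, tdist (g^[n] (z k)) (g^[n] (y k)) ≤ r ∧
      diffVec (g^[n] (z k)) (g^[n] (y k)) ∈ coneS h S α (g^[n] (y k)) ∧
      diffVec (g^[n] (y k)) (g^[n] (z k)) ∈ coneS h S α (g^[n] (z k))) :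
    StableRel h S g α r y₀ z₀ := by
  intro n
  have hy' := ((g.continuous_iterate n).tendsto y₀).comp hy
  have hz' := ((g.continuous_iterate n).tendsto z₀).comp hz
  have h1 : tdist (g^[n] z₀) (g^[n] y₀) ≤ r :=
    le_of_tendsto (tendsto_tdist hz' hy') ((hrel n).mono fun _ hk => hk.1)
  exact ⟨h1,
    mem_coneS_of_tendsto hy' (tendsto_diffVec hz' hy' (h1.trans_lt hr))
      ((hrel n).mono fun _ hk => hk.2.1),
    mem_coneS_of_tendsto hz' (tendsto_diffVec hy' hz' (by rw [tdist_comm]; exact h1.trans_lt hr))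
      ((hrel n).mono fun _ hk => hk.2.2)⟩

end StableRel

namespace ConeSystem
variable {h : TorusMetric d} {S : Splitting d} {g : TorusDiffeo d} {α Λ R δ C : ℝ}
  (H : ConeSystem h S g α Λ R δ C)
include H

lemma Λ_pos : 0 < Λ := by linarith [H.one_lt]

/-- The iterated domination: as long as `z` stays close to `y`, its distance from `y` in the
unstable cone outgrows the distances in the stable cones by the factor `Λⁿ`. -/
lemma pow_mul_norm_le {x y z : T d} (hzy : z ≠ y)
    (hz : ∀ n : ℕ, tdist (g^[n] z) (g^[n] y) < R) (hU : diffVec z y ∈ coneU h S α y)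
    (hx : ∀ n : ℕ, tdist (g^[n] x) (g^[n] y) < R)
    (hS : ∀ n : ℕ, diffVec (g^[n] x) (g^[n] y) ∈ coneS h S α (g^[n] y)) (n : ℕ) :
    Λ ^ n * (h.norm (g^[n] y) (diffVec (g^[n] x) (g^[n] y)) * h.norm y (diffVec z y)) ≤
      h.norm (g^[n] y) (diffVec (g^[n] z) (g^[n] y)) * h.norm y (diffVec x y) := by
  rcases eq_or_ne x y with rfl | hxy
  · simp [diffVec_self, h.norm_zero]
  have hinj : ∀ n : ℕ, Function.Injective (g^[n]) := fun n => g.toHomeo.injective.iterate n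
  have hU' : ∀ n : ℕ, diffVec (g^[n] z) (g^[n] y) ∈ coneU h S α (g^[n] y) := by
    intro n
    induction n with
    | zero => exact hU
    | succ n ih =>
      have := hz (n + 1)
      simp only [Function.iterate_succ_apply'] at this ⊢
      exact H.mem_coneU_image (hz n) this ih
  refine pow_mul_le_of_step (A := fun n => h.norm (g^[n] y) (diffVec (g^[n] z) (g^[n] y)))
    (B := fun n => h.norm (g^[n] y) (diffVec (g^[n] x) (g^[n] y))) H.Λ_pos
    (fun n => h.norm_pos _ (mt diffVec_eq_zero.1 ((hinj n).ne hzy))) (fun n => ?_) n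
  have h1 := hz (n + 1)
  have h2 := hx (n + 1)
  have h3 := hS (n + 1)
  simp only [Function.iterate_succ_apply'] at h1 h2 h3 ⊢
  exact ((H.dom _ _ _ (hz n) (hx n) h1 h2 (hU' n) h3).1 ((hinj n).ne hzy) ((hinj n).ne hxy)).le

/-- Two points that are stably related to a common point and have the same stable coordinate
coincide: otherwise their distance would outgrow their distances from the common point. -/
lemma eq_of_stableRel {x₀ x y z : T d} (hy : tdist y x₀ < R) (hz : tdist z x₀ < R)
    (hyx : StableRel h S g α (2 * (C * δ)) y x) (hxz : StableRel h S g α (2 * (C * δ)) x z)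
    (hP : S.P x₀ (diffVec z y) = 0) : z = y := by
  by_contra hzy
  have hδ := H.δ_lt
  have hCδ := H.Cδ_pos
  have hR := H.R_le
  have hzyn : ∀ n : ℕ, tdist (g^[n] z) (g^[n] y) < R := fun n => by
    have := tdist_triangle (g^[n] z) (g^[n] x) (g^[n] y)
    linarith [(hyx n).1, (hxz n).1]
  have hUy : diffVec z y ∈ coneU h S α y := H.mem_coneU _ _ _ hy hP
  have hUz : diffVec y z ∈ coneU h S α z := H.mem_coneU _ _ _ hz (by
    rw [diffVec_comm (by have := hzyn 0; simp only [Function.iterate_zero_apply] at this; linarith),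
      map_neg, hP, neg_zero])
  have k1 := H.pow_mul_norm_le hzy hzyn hUy (fun n => by linarith [(hyx n).1])
    (fun n => (hyx n).2.1)
  have k2 := H.pow_mul_norm_le (x := x) (Ne.symm hzy)
    (fun n => by rw [tdist_comm]; exact hzyn n) hUz
    (fun n => by rw [tdist_comm]; linarith [(hxz n).1]) (fun n => (hxz n).2.2)
  obtain ⟨c, hc, M, hM, hcM⟩ := h.exists_norm_equiv
  have hpos : ∀ n : ℕ, 0 < tdist (g^[n] z) (g^[n] y) := fun n =>
    tdist_pos ((g.toHomeo.injective.iterate n).ne hzy)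
  refine false_of_pow_mul_le (c := c * c * tdist z y)
    (K := M * (h.norm y (diffVec x y) + h.norm z (diffVec x z))) H.one_lt
    (by have := hpos 0; simp only [Function.iterate_zero_apply] at this; positivity) (fun n => ?_)
  have hΛn : 0 < Λ ^ n := pow_pos H.Λ_pos n
  set a := tdist (g^[n] z) (g^[n] y) with ha
  have e1 := (hcM (g^[n] y) (diffVec (g^[n] x) (g^[n] y))).1
  have e2 := (hcM (g^[n] z) (diffVec (g^[n] x) (g^[n] z))).1
  have e3 := (hcM y (diffVec z y)).1
  have e4 := (hcM z (diffVec y z)).1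
  have e5 := (hcM (g^[n] y) (diffVec (g^[n] z) (g^[n] y))).2
  have e6 := (hcM (g^[n] z) (diffVec (g^[n] y) (g^[n] z))).2
  change c * tdist _ _ ≤ _ at e1 e2 e3 e4
  change _ ≤ M * tdist _ _ at e5 e6
  rw [tdist_comm (g^[n] y)] at e6
  rw [tdist_comm y] at e4
  rw [← ha] at e5 e6
  have tri := tdist_triangle (g^[n] z) (g^[n] x) (g^[n] y)
  rw [tdist_comm (g^[n] z) (g^[n] x), ← ha] at tri
  have n1 := tdist_nonneg (g^[n] x) (g^[n] y)
  have n2 := tdist_nonneg (g^[n] x) (g^[n] z)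
  have n3 := tdist_nonneg z y
  have m1 := (mul_le_mul_of_nonneg_left (mul_le_mul e1 e3 (by positivity) (h.norm_nonneg _ _))
    hΛn.le).trans ((k1 n).trans (mul_le_mul_of_nonneg_right e5 (h.norm_nonneg _ _)))
  have m2 := (mul_le_mul_of_nonneg_left (mul_le_mul e2 e4 (by positivity) (h.norm_nonneg _ _))
    hΛn.le).trans ((k2 n).trans (mul_le_mul_of_nonneg_right e6 (h.norm_nonneg _ _)))
  refine le_of_mul_le_mul_left ?_ (hpos n)
  rw [← ha]
  calc a * (Λ ^ n * (c * c * tdist z y)) ≤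
        (tdist (g^[n] x) (g^[n] z) + tdist (g^[n] x) (g^[n] y)) *
          (Λ ^ n * (c * c * tdist z y)) := mul_le_mul_of_nonneg_right tri (by positivity)
    _ = Λ ^ n * (c * tdist (g^[n] x) (g^[n] y) * (c * tdist z y)) +
          Λ ^ n * (c * tdist (g^[n] x) (g^[n] z) * (c * tdist z y)) := by ring
    _ ≤ M * a * h.norm y (diffVec x y) + M * a * h.norm z (diffVec x z) := add_le_add m1 m2
    _ = _ := by ring

lemma stableRel_self (x : T d) : StableRel h S g α (2 * (C * δ)) x x := fun n => by
  have := H.Cδ_pos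
  refine ⟨by rw [tdist_self]; linarith, ?_, ?_⟩ <;>
  · rw [diffVec_self]; exact zero_mem_coneS _ _ _ _

lemma stableRel_preimage {y z : T d} (hr : StableRel h S g α (2 * (C * δ)) y z)
    (hd : tdist (g.symm z) (g.symm y) ≤ 2 * (C * δ)) :
    StableRel h S g α (2 * (C * δ)) (g.symm y) (g.symm z) := by
  have hδ := H.δ_lt
  have hCδ := H.Cδ_pos
  intro n
  cases n with
  | zero =>
    have h0 := hr 0
    simp only [Function.iterate_zero_apply] at h0 ⊢
    refine ⟨hd, H.mem_coneS_of_image (by linarith) ?_ ?_, H.mem_coneS_of_image ?_ ?_ ?_⟩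
    · simp only [TorusDiffeo.apply_symm_apply]; linarith [h0.1]
    · simpa only [TorusDiffeo.apply_symm_apply] using h0.2.1
    · rw [tdist_comm]; linarith
    · simp only [TorusDiffeo.apply_symm_apply]; rw [tdist_comm]; linarith [h0.1]
    · simpa only [TorusDiffeo.apply_symm_apply] using h0.2.2
  | succ n =>
    simpa only [Function.iterate_succ_apply, TorusDiffeo.apply_symm_apply] using hr n

/-! ### The stable bundle -/

lemma deriv_mem_coneU {x : T d} {u : E d} (hu : u ∈ coneU h S α x) :
    g.D x u ∈ coneU h S α (g x) :=
  (H.deriv_dom x (s := 0) hu (by rw [map_zero]; exact zero_mem_coneS _ _ _ _)).2.1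

lemma mem_coneS_of_deriv {x : T d} {s : E d} (hs : g.D x s ∈ coneS h S α (g x)) :
    s ∈ coneS h S α x :=
  (H.deriv_dom x (u := 0) (zero_mem_coneU _ _ _ _) hs).2.2

lemma Diter_mem_coneS_of_le {x : T d} {s : E d} {m n : ℕ} (hmn : m ≤ n)
    (hs : g.Diter n x s ∈ coneS h S α (g^[n] x)) : g.Diter m x s ∈ coneS h S α (g^[m] x) := by
  induction hmn using Nat.decreasingInduction with
  | self => exact hs
  | of_succ k _ ih =>
    rw [TorusDiffeo.Diter_succ_apply, Function.iterate_succ_apply'] at ih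
    exact H.mem_coneS_of_deriv ih

lemma symm_Diter_mem_coneS {p : T d} {v : E d} (n : ℕ) (hv : v ∈ coneS h S α p) :
    g.symm.Diter n p v ∈ coneS h S α (g.symm^[n] p) := by
  induction n with
  | zero => exact hv
  | succ n ih =>
    rw [TorusDiffeo.Diter_succ_apply, Function.iterate_succ_apply']
    refine H.mem_coneS_of_deriv ?_
    rwa [TorusDiffeo.symm_D, TorusDiffeo.apply_symm_apply, ContinuousLinearEquiv.apply_symm_apply]

/-- The iterated domination for the derivative. -/
lemma pow_mul_norm_Diter_le {x : T d} {u s : E d} (hu : u ∈ coneU h S α x)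
    (hs : ∀ n, g.Diter n x s ∈ coneS h S α (g^[n] x)) (n : ℕ) :
    Λ ^ n * (h.norm (g^[n] x) (g.Diter n x s) * h.norm x u) ≤
      h.norm (g^[n] x) (g.Diter n x u) * h.norm x s := by
  rcases eq_or_ne u 0 with rfl | hu0
  · simp [h.norm_zero]
  have hU : ∀ n, g.Diter n x u ∈ coneU h S α (g^[n] x) := by
    intro n
    induction n with
    | zero => exact hu
    | succ n ih =>
      rw [TorusDiffeo.Diter_succ_apply, Function.iterate_succ_apply']
      exact H.deriv_mem_coneU ih
  refine pow_mul_le_of_step (A := fun n => h.norm (g^[n] x) (g.Diter n x u))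
    (B := fun n => h.norm (g^[n] x) (g.Diter n x s)) H.Λ_pos
    (fun n => h.norm_pos _ ?_) (fun n => ?_) n
  · rw [← map_zero (g.Diter n x)]; exact (g.Diter_injective n x).ne hu0
  · have h1 := hs (n + 1)
    simp only [TorusDiffeo.Diter_succ_apply, Function.iterate_succ_apply'] at h1 ⊢
    exact (H.deriv_dom _ (hU n) h1).1

/-- The linear uniqueness: vectors whose iterates stay in the stable cones are determined by their
stable components, since their difference would outgrow them. -/
lemma eq_of_forall_Diter_mem_coneS {x : T d} {a b : E d}
    (ha : ∀ n, g.Diter n x a ∈ coneS h S α (g^[n] x))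
    (hb : ∀ n, g.Diter n x b ∈ coneS h S α (g^[n] x)) (hP : S.P x a = S.P x b) : a = b := by
  by_contra hab
  have hU : a - b ∈ coneU h S α x :=
    H.mem_coneU x x _ (by rw [tdist_self]; exact H.R_pos) (by rw [map_sub, hP, sub_self])
  have hne : a - b ≠ 0 := sub_ne_zero.2 hab
  refine false_of_pow_mul_le (c := h.norm x (a - b)) (K := h.norm x a + h.norm x b) H.one_lt
    (h.norm_pos _ hne) (fun n => ?_)
  have hΛn : 0 < Λ ^ n := pow_pos H.Λ_pos n
  have k1 := H.pow_mul_norm_Diter_le hU ha n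
  have k2 := H.pow_mul_norm_Diter_le hU hb n
  have hp : 0 < h.norm (g^[n] x) (g.Diter n x (a - b)) := h.norm_pos _ (by
    rw [← map_zero (g.Diter n x)]; exact (g.Diter_injective n x).ne hne)
  have tri : h.norm (g^[n] x) (g.Diter n x (a - b)) ≤
      h.norm (g^[n] x) (g.Diter n x a) + h.norm (g^[n] x) (g.Diter n x b) := by
    have := h.norm_add_le (g^[n] x) (g.Diter n x a) (-g.Diter n x b)
    rwa [h.norm_neg, ← sub_eq_add_neg, ← map_sub] at this
  refine le_of_mul_le_mul_left ?_ hp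
  calc h.norm (g^[n] x) (g.Diter n x (a - b)) * (Λ ^ n * h.norm x (a - b)) ≤
        (h.norm (g^[n] x) (g.Diter n x a) + h.norm (g^[n] x) (g.Diter n x b)) *
          (Λ ^ n * h.norm x (a - b)) :=
        mul_le_mul_of_nonneg_right tri (mul_nonneg hΛn.le (h.norm_nonneg _ _))
    _ ≤ h.norm (g^[n] x) (g.Diter n x (a - b)) * h.norm x a +
        h.norm (g^[n] x) (g.Diter n x (a - b)) * h.norm x b := by linarith
    _ = _ := by ring

/-- The backward iterates carry nearby stable spaces to subspaces transverse to the unstable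
spaces. -/
lemma eq_zero_of_P_symm_Diter {x₀ p y : T d} {n : ℕ} (hp : tdist p y < R)
    (hq : tdist (g.symm^[n] p) x₀ < R) {v : E d} (hv : S.P y v = v)
    (h0 : S.P x₀ (g.symm.Diter n p v) = 0) : v = 0 := by
  have h1 := H.symm_Diter_mem_coneS n (H.mem_coneS _ _ _ hp hv)
  have h2 := H.norm_le _ _ _ hq h1
  rw [TorusMetric.fstNorm, h0, h.norm_zero, mul_zero] at h2
  have h3 := norm_le_zero_iff.1 h2
  exact g.symm.Diter_injective n p (by rw [h3, map_zero])

/-- Each vector of `E^s(x)` is the first component of a vector whose forward iterates remain in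
the stable cones; it depends linearly on it. -/
lemma exists_stable_graph (x : T d) : ∃ a : S.fst x → E d,
    (∀ w w', a (w + w') = a w + a w') ∧ (∀ w, S.P x (a w) = w) ∧
    ∀ w n, g.Diter n x (a w) ∈ coneS h S α (g^[n] x) := by
  have hx0 : tdist x x < R := by rw [tdist_self]; exact H.R_pos
  have hA : ∀ n : ℕ, ∃ A : S.fst x →ₗ[ℝ] E d, (∀ w, S.P x (A w) = w) ∧
      ∀ w, g.Diter n x (A w) ∈ coneS h S α (g^[n] x) := by
    intro n
    let M : S.fst (g^[n] x) →ₗ[ℝ] S.fst x :=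
      LinearMap.codRestrict (S.fst x)
        (((S.P x).comp (g.symm.Diter n (g^[n] x)) : E d →ₗ[ℝ] E d).comp
          (S.fst (g^[n] x)).subtype) (fun v => S.P_mem_fst x _)
    have hM : Function.Injective M := by
      rw [← LinearMap.ker_eq_bot, LinearMap.ker_eq_bot']
      intro v hv
      have h1 : S.P x (g.symm.Diter n (g^[n] x) (v : E d)) = 0 := congrArg Subtype.val hv
      refine Subtype.ext (H.eq_zero_of_P_symm_Diter (x₀ := x) (p := g^[n] x) (y := g^[n] x)
        (n := n) (by rw [tdist_self]; exact H.R_pos)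
        (by rw [g.iterate_symm_iterate]; exact hx0) (S.mem_fst.1 v.2) h1)
    let e := LinearEquiv.ofInjectiveOfFinrankEq M hM (S.finrank_fst_eq _ _)
    refine ⟨((g.symm.Diter n (g^[n] x) : E d →ₗ[ℝ] E d).comp
          (S.fst (g^[n] x)).subtype).comp e.symm.toLinearMap, fun w => ?_, fun w => ?_⟩
    · exact congrArg Subtype.val (e.apply_symm_apply w)
    · change g.Diter n x (g.symm.Diter n (g^[n] x) (e.symm w : E d)) ∈ _
      rw [g.Diter_symm_Diter]
      exact H.mem_coneS _ _ _ (by rw [tdist_self]; exact H.R_pos) (S.mem_fst.1 (e.symm w).2)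
  choose A hAP hAc using hA
  have hb : ∀ w : S.fst x, ∃ a, Filter.Tendsto (fun n => A n w)
      (Filter.hyperfilter ℕ : Filter ℕ) (𝓝 a) := by
    intro w
    refine exists_tendsto_of_norm_le _ (r := C * h.fstNorm S x w) (Filter.Eventually.of_forall
      fun n => ?_)
    have := H.norm_le x x (A n w) hx0 (H.Diter_mem_coneS_of_le (Nat.zero_le n) (hAc n w))
    rw [TorusMetric.fstNorm, hAP] at this
    rwa [TorusMetric.fstNorm, S.mem_fst.1 w.2]
  choose a ha using hb
  refine ⟨a, fun w w' => ?_, fun w => ?_, fun w n => ?_⟩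
  · refine tendsto_nhds_unique (ha (w + w')) ?_
    simpa only [map_add] using (ha w).add (ha w')
  · refine tendsto_nhds_unique (((S.P x).continuous.tendsto _).comp (ha w)) ?_
    simp only [Function.comp_def, hAP]
    exact tendsto_const_nhds
  · refine mem_coneS_of_tendsto (tendsto_const_nhds (x := g^[n] x))
      (((g.Diter n x).continuous.tendsto _).comp (ha w)) ?_
    have : ∀ᶠ k in (Filter.hyperfilter ℕ : Filter ℕ), n ≤ k :=
      Nat.hyperfilter_le_atTop (Filter.eventually_ge_atTop n)
    filter_upwards [this] with k hk
    exact H.Diter_mem_coneS_of_le hk (hAc k w)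

end ConeSystem

/-! ### Continuity of projections -/

/-- A family of subspaces with closed total space, formulated with ultrafilters. -/
def ClosedFamily {X : Type*} [TopologicalSpace X] (A : X → Submodule ℝ (E d)) : Prop :=
  ∀ (x : X) (U : Ultrafilter X), (U : Filter X) ≤ 𝓝 x → ∀ (v : X → E d) (v₀ : E d),
    (∀ᶠ y in (U : Filter X), v y ∈ A y) → Filter.Tendsto v U (𝓝 v₀) → v₀ ∈ A x

/-- The projections given by two complementary families of subspaces with closed total spaces
depend continuously on the point. -/
lemma continuous_projection {X : Type*} [TopologicalSpace X] {A B : X → Submodule ℝ (E d)}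
    (hAB : ∀ x, IsCompl (A x) (B x)) (hA : ClosedFamily A) (hB : ClosedFamily B) :
    Continuous fun x => LinearMap.toContinuousLinearMap ((A x).projection (B x) (hAB x)) := by
  rw [continuous_clm_apply]
  intro v
  rw [continuous_iff_continuousAt]
  intro x
  rw [continuousAt_iff_ultrafilter]
  intro U hU
  simp only [LinearMap.coe_toContinuousLinearMap']
  set a : X → E d := fun y => (A y).projection (B y) (hAB y) v with ha
  have haA : ∀ y, a y ∈ A y := fun y => Submodule.projection_apply_mem (hAB y) v
  have haB : ∀ y, v - a y ∈ B y := fun y => Submodule.sub_projection_mem (hAB y) v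
  -- Rescaling by `1 + ‖a‖` gives convergence even if the projections were to blow up.
  set c : X → ℝ := fun y => (1 + ‖a y‖)⁻¹ with hc
  have hcpos : ∀ y, 0 < c y := fun y => by positivity
  have hc1 : ∀ y, c y * ‖a y‖ = 1 - c y := fun y => by
    simp only [hc]; field_simp; ring
  obtain ⟨t, ht01, ht⟩ := isCompact_Icc.ultrafilter_le_nhds (U.map c) (by
    rw [Filter.le_principal_iff, Ultrafilter.coe_map, Filter.mem_map]
    refine Filter.univ_mem' fun y => ⟨(hcpos y).le, ?_⟩
    have := mul_nonneg (hcpos y).le (norm_nonneg (a y))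
    rw [hc1] at this; linarith : _ ≤ Filter.principal (Set.Icc (0 : ℝ) 1))
  have ht' : Filter.Tendsto c U (𝓝 t) := ht
  obtain ⟨a', ha'⟩ := exists_tendsto_of_norm_le U (v := fun y => c y • a y) (r := 1)
    (Filter.Eventually.of_forall fun y => by
      rw [norm_smul, Real.norm_eq_abs, abs_of_pos (hcpos y), hc1]; linarith [hcpos y])
  have hb' : Filter.Tendsto (fun y => c y • (v - a y)) U (𝓝 (t • v - a')) := by
    simpa only [smul_sub] using (ht'.smul_const v).sub ha'
  have h1 : a' ∈ A x :=
    hA x U hU _ _ (Filter.Eventually.of_forall fun y => (A y).smul_mem _ (haA y)) ha'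
  have h2 : t • v - a' ∈ B x :=
    hB x U hU _ _ (Filter.Eventually.of_forall fun y => (B y).smul_mem _ (haB y)) hb'
  have h3 : (A x).projection (B x) (hAB x) (t • v) = a' := by
    have e : t • v = a' + (t • v - a') := by abel
    rw [e, map_add, Submodule.projection_apply_of_mem_left (hAB x) h1,
      (Submodule.projection_apply_eq_zero_iff (hAB x)).2 h2, add_zero]
  have ht0 : t ≠ 0 := by
    rintro rfl
    rw [zero_smul, map_zero] at h3
    have h4 : Filter.Tendsto (fun y => ‖c y • a y‖) U (𝓝 (1 - 0)) := by
      simp only [norm_smul, Real.norm_eq_abs, abs_of_pos (hcpos _), hc1]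
      exact tendsto_const_nhds.sub ht'
    have h5 := tendsto_nhds_unique h4 ha'.norm
    rw [← h3, norm_zero] at h5
    norm_num at h5
  have h6 : Filter.Tendsto (fun y => (c y)⁻¹ • (c y • a y)) U (𝓝 (t⁻¹ • a')) :=
    (ht'.inv₀ ht0).smul ha'
  rw [← h3, map_smul, inv_smul_smul₀ ht0] at h6
  exact h6.congr fun y => inv_smul_smul₀ (hcpos y).ne' _

/-- Stable vectors of the diffeomorphism `g`: their forward iterates remain in the stable cones.
Under `ConeSystem` they form a subspace, so that the span in this definition adds nothing. -/
def csBundle (h : TorusMetric d) (S : Splitting d) (g : TorusDiffeo d) (α : ℝ) (x : T d) :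
    Submodule ℝ (E d) :=
  Submodule.span ℝ {v | ∀ n, g.Diter n x v ∈ coneS h S α (g^[n] x)}

namespace ConeSystem
variable {h : TorusMetric d} {S : Splitting d} {g : TorusDiffeo d} {α Λ R δ C : ℝ}
  (H : ConeSystem h S g α Λ R δ C)
include H

lemma mem_csBundle {x : T d} {v : E d} :
    v ∈ csBundle h S g α x ↔ ∀ n, g.Diter n x v ∈ coneS h S α (g^[n] x) := by
  refine ⟨fun hv => ?_, fun hv => Submodule.subset_span hv⟩
  obtain ⟨a, hadd, hP, hc⟩ := H.exists_stable_graph x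
  have hself : ∀ v : E d, (∀ n, g.Diter n x v ∈ coneS h S α (g^[n] x)) →
      v = a ⟨S.P x v, S.P_mem_fst x v⟩ := fun v hv =>
    H.eq_of_forall_Diter_mem_coneS hv (hc _) (hP ⟨S.P x v, S.P_mem_fst x v⟩).symm
  refine Submodule.span_induction (p := fun v _ => ∀ n, g.Diter n x v ∈ coneS h S α (g^[n] x))
    (fun v hv => hv) (fun n => ?_) (fun v w _ _ hv hw => ?_) (fun t v _ hv n => ?_) hv
  · rw [map_zero]; exact zero_mem_coneS _ _ _ _
  · rw [hself v hv, hself w hw, ← hadd]; exact hc _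
  · rw [map_smul]; exact smul_mem_coneS (hv n) t

lemma csBundle_subset_coneS {x : T d} {v : E d} (hv : v ∈ csBundle h S g α x) :
    v ∈ coneS h S α x := H.mem_csBundle.1 hv 0

lemma eq_zero_of_mem_csBundle {x x₀ : T d} (hx : tdist x x₀ < R) {v : E d}
    (hv : v ∈ csBundle h S g α x) (h0 : S.P x₀ v = 0) : v = 0 := by
  have := H.norm_le _ _ _ hx (H.csBundle_subset_coneS hv)
  rw [TorusMetric.fstNorm, h0, h.norm_zero, mul_zero] at this
  exact norm_le_zero_iff.1 this

lemma finrank_csBundle (x : T d) :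
    Module.finrank ℝ (csBundle h S g α x) = Module.finrank ℝ (S.fst x) := by
  obtain ⟨a, hadd, hP, hc⟩ := H.exists_stable_graph x
  let M : csBundle h S g α x →ₗ[ℝ] S.fst x :=
    LinearMap.codRestrict (S.fst x) ((S.P x : E d →ₗ[ℝ] E d).comp
      (csBundle h S g α x).subtype) (fun v => S.P_mem_fst x _)
  refine (LinearEquiv.ofBijective M ⟨?_, fun w => ?_⟩).finrank_eq
  · rw [← LinearMap.ker_eq_bot, LinearMap.ker_eq_bot']
    intro v hv
    exact Subtype.ext (H.eq_zero_of_mem_csBundle (x₀ := x) (by rw [tdist_self]; exact H.R_pos)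
      v.2 (congrArg Subtype.val hv))
  · exact ⟨⟨a w, H.mem_csBundle.2 (hc w)⟩, Subtype.ext (hP w)⟩

lemma isCompl_csBundle {x x₀ : T d} (hx : tdist x x₀ < R) :
    IsCompl (csBundle h S g α x) (S.snd x₀) := by
  have hd : Disjoint (csBundle h S g α x) (S.snd x₀) := by
    rw [Submodule.disjoint_def]
    exact fun v hv h0 => H.eq_zero_of_mem_csBundle hx hv (S.mem_snd.1 h0)
  refine ⟨hd, codisjoint_iff.2 (Submodule.eq_top_of_disjoint _ _ ?_ hd)⟩
  rw [H.finrank_csBundle, S.finrank_fst_eq x x₀, S.finrank_add]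
  simp

lemma map_csBundle (x : T d) :
    (csBundle h S g α x).map (g.D x : E d →ₗ[ℝ] E d) = csBundle h S g α (g x) := by
  ext v
  rw [Submodule.mem_map]
  constructor
  · rintro ⟨w, hw, rfl⟩
    rw [H.mem_csBundle] at hw ⊢
    intro n
    have := hw (n + 1)
    rwa [TorusDiffeo.Diter_succ_apply', Function.iterate_succ_apply] at this
  · intro hv
    refine ⟨(g.D x).symm v, ?_, (g.D x).apply_symm_apply v⟩
    rw [H.mem_csBundle] at hv ⊢
    intro n
    cases n with
    | zero =>
      refine H.mem_coneS_of_deriv ?_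
      change g.D x ((g.D x).symm v) ∈ _
      rw [ContinuousLinearEquiv.apply_symm_apply]
      exact hv 0
    | succ n =>
      rw [TorusDiffeo.Diter_succ_apply', Function.iterate_succ_apply]
      simpa using hv n

lemma mem_csBundle_of_tendsto {X : Type*} {l : Filter X} [l.NeBot] {x : X → T d} {v : X → E d}
    {x₀ : T d} {v₀ : E d} (hx : Filter.Tendsto x l (𝓝 x₀)) (hv : Filter.Tendsto v l (𝓝 v₀))
    (hm : ∀ᶠ n in l, v n ∈ csBundle h S g α (x n)) : v₀ ∈ csBundle h S g α x₀ := by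
  rw [H.mem_csBundle]
  intro n
  have h1 : Filter.Tendsto (fun k => g.Diter n (x k) (v k)) l (𝓝 (g.Diter n x₀ v₀)) :=
    ((isBoundedBilinearMap_apply (𝕜 := ℝ)).continuous.tendsto (g.Diter n x₀, v₀)).comp
      ((((g.continuous_Diter n).tendsto x₀).comp hx).prodMk_nhds hv)
  exact mem_coneS_of_tendsto (((g.continuous_iterate n).tendsto x₀).comp hx) h1
    (hm.mono fun k hk => H.mem_csBundle.1 hk n)

lemma closedFamily_csBundle : ClosedFamily (csBundle h S g α) := fun _ _ hU _ _ hv hv₀ =>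
  H.mem_csBundle_of_tendsto (Filter.tendsto_id.mono_left hU) hv₀ hv

/-! ### Tangency of the stable relation to the stable bundle -/

/-- The projection onto the stable bundle at `x` along the unstable direction at `x₀`. -/
def csProj {x₀ x : T d} (hx : tdist x x₀ < R) : E d →L[ℝ] E d :=
  LinearMap.toContinuousLinearMap
    ((csBundle h S g α x).projection (S.snd x₀) (H.isCompl_csBundle hx))

lemma csProj_mem {x₀ x : T d} (hx : tdist x x₀ < R) (v : E d) :
    H.csProj hx v ∈ csBundle h S g α x :=
  Submodule.projection_apply_mem (H.isCompl_csBundle hx) v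

lemma csProj_eq_self {x₀ x : T d} (hx : tdist x x₀ < R) {v : E d}
    (hv : v ∈ csBundle h S g α x) : H.csProj hx v = v :=
  Submodule.projection_apply_of_mem_left (H.isCompl_csBundle hx) hv

lemma csProj_eq_zero {x₀ x : T d} (hx : tdist x x₀ < R) {v : E d} :
    H.csProj hx v = 0 ↔ S.P x₀ v = 0 := by
  rw [← S.mem_snd]
  exact Submodule.projection_apply_eq_zero_iff (H.isCompl_csBundle hx)

lemma csProj_P {x₀ x : T d} (hx : tdist x x₀ < R) (v : E d) :
    H.csProj hx (S.P x₀ v) = H.csProj hx v := by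
  have : H.csProj hx (v - S.P x₀ v) = 0 := by
    rw [csProj_eq_zero, map_sub, S.idem, sub_self]
  rw [map_sub, sub_eq_zero] at this
  exact this.symm

lemma continuous_csProj (x₀ : T d) :
    Continuous fun x : {x : T d // tdist x x₀ < R} => H.csProj x.2 := by
  refine continuous_projection (A := fun x : {x : T d // tdist x x₀ < R} => csBundle h S g α x)
    (B := fun _ => S.snd x₀) (fun x => H.isCompl_csBundle x.2) ?_ ?_
  · intro x U hU v v₀ hv hv₀
    exact H.mem_csBundle_of_tendsto ((continuous_subtype_val.tendsto x).mono_left hU) hv₀ hv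
  · intro x U _ v v₀ hv hv₀
    rw [S.mem_snd]
    refine tendsto_nhds_unique (((S.P x₀).continuous.tendsto _).comp hv₀) ?_
    exact tendsto_const_nhds.congr' (hv.mono fun y hy => (S.mem_snd.1 hy).symm)

/-- A limit direction of stably related points lies in the stable bundle. -/
lemma mem_csBundle_of_direction {X : Type*} {l : Filter X} [l.NeBot] {z : X → T d} {x : T d}
    (hz : Filter.Tendsto z l (𝓝 x)) (hrel : ∀ᶠ k in l, StableRel h S g α (2 * (C * δ)) x (z k))
    {t : X → ℝ} {e : E d} (he : Filter.Tendsto (fun k => t k • diffVec (z k) x) l (𝓝 e)) :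
    e ∈ csBundle h S g α x := by
  rw [H.mem_csBundle]
  intro n
  have hd := g.hasDeriv_iterate n x
  have h1 : HasFDerivAt (fun v : E d => diffVec (g^[n] (x + proj v)) (g^[n] x))
      (g.Diter n x) 0 := by
    simpa [HasTorusFDerivAt, proj_zero] using hd
  have hv : Filter.Tendsto (fun k => diffVec (z k) x) l (𝓝 0) := by
    have := tendsto_diffVec hz (tendsto_const_nhds (x := x)) (by rw [tdist_self]; norm_num)
    rwa [diffVec_self] at this
  have h2 : (fun k => diffVec (g^[n] (z k)) (g^[n] x) - g.Diter n x (diffVec (z k) x))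
      =o[l] fun k => diffVec (z k) x := by
    have := (hasFDerivAt_iff_isLittleO_nhds_zero.1 h1).comp_tendsto hv
    simpa [Function.comp_def, add_proj_diffVec, proj_zero, diffVec_self] using this
  have h3 : Filter.Tendsto (fun k => t k • diffVec (g^[n] (z k)) (g^[n] x)) l
      (𝓝 (g.Diter n x e)) := by
    have h4 : (fun k => t k • (diffVec (g^[n] (z k)) (g^[n] x) -
        g.Diter n x (diffVec (z k) x))) =o[l] fun k => t k • diffVec (z k) x :=
      (Asymptotics.isBigO_refl t l).smul_isLittleO h2
    have h5 := (h4.trans_isBigO (he.isBigO_one ℝ)).tendsto_zero_of_tendsto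
      (tendsto_const_nhds (x := (1 : ℝ)))
    have h6 := h5.add (((g.Diter n x).continuous.tendsto e).comp he)
    simpa [Function.comp_def, smul_sub] using h6
  refine mem_coneS_of_tendsto (tendsto_const_nhds (x := g^[n] x)) h3 ?_
  filter_upwards [hrel] with k hk
  exact smul_mem_coneS (hk n).2.1 _

/-- Stably related points differ, to first order, by vectors of the stable bundle. -/
lemma isLittleO_sub_csProj {x₀ x : T d} (hx : tdist x x₀ < R) {X : Type*} {l : Filter X}
    {z : X → T d} (hz : Filter.Tendsto z l (𝓝 x))
    (hrel : ∀ᶠ k in l, StableRel h S g α (2 * (C * δ)) x (z k)) :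
    (fun k => diffVec (z k) x - H.csProj hx (diffVec (z k) x)) =o[l]
      fun k => diffVec (z k) x := by
  rw [Asymptotics.isLittleO_iff]
  intro c hc
  by_contra hcon
  rw [Filter.not_eventually] at hcon
  obtain ⟨U, hUle⟩ := @Ultrafilter.exists_le _ _ (Filter.frequently_iff_neBot.1 hcon)
  obtain ⟨hUl, hU'⟩ := le_inf_iff.1 hUle
  have hU := Filter.le_principal_iff.1 hU'
  have hne : ∀ᶠ k in (U : Filter X), 0 < ‖diffVec (z k) x‖ := by
    filter_upwards [hU] with k hk
    rw [norm_pos_iff]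
    intro h0
    simp [h0] at hk
  obtain ⟨e, he⟩ := exists_tendsto_of_norm_le U
    (v := fun k => ‖diffVec (z k) x‖⁻¹ • diffVec (z k) x) (r := 1) (by
      filter_upwards [hne] with k hk
      rw [norm_smul, norm_inv, norm_norm, inv_mul_cancel₀ hk.ne'])
  have hmem := H.mem_csBundle_of_direction (hz.mono_left hUl) (hUl hrel) he
  have h1 : Filter.Tendsto (fun k => ‖diffVec (z k) x‖⁻¹ • diffVec (z k) x -
      H.csProj hx (‖diffVec (z k) x‖⁻¹ • diffVec (z k) x)) U (𝓝 (e - H.csProj hx e)) :=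
    he.sub (((H.csProj hx).continuous.tendsto e).comp he)
  rw [H.csProj_eq_self hx hmem, sub_self] at h1
  have h2 := h1.norm
  rw [norm_zero] at h2
  have h3 : c ≤ 0 := by
    refine ge_of_tendsto h2 ?_
    filter_upwards [hU, hne] with k hk hk'
    rw [map_smul, ← smul_sub, norm_smul, norm_inv, norm_norm, inv_mul_eq_div, le_div_iff₀ hk']
    exact (not_le.1 hk).le
  exact absurd h3 (not_le.2 hc)

end ConeSystem

/-! ### Existence of the plaques -/

namespace ConeSystem
variable {h : TorusMetric d} {S : Splitting d} {g : TorusDiffeo d} {α Λ R δ C : ℝ}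
  (H : ConeSystem h S g α Λ R δ C)

/-- The point whose `n`-th iterate is displaced by `w` from the `n`-th iterate of `y`. -/
def pullPoint (S : Splitting d) (g : TorusDiffeo d) (n : ℕ) (y : T d) (w : S.fst (g^[n] y)) : T d :=
  g.symm^[n] (g^[n] y + proj (w : E d))

/-- The displacements from `gⁿ(y)`, in the stable space, whose backward iterates have stable size
at most `δ` with respect to the backward iterates of `gⁿ(y)`, up to time `n`. -/
def pullSet (h : TorusMetric d) (S : Splitting d) (g : TorusDiffeo d) (δ C : ℝ) (n : ℕ)
    (y : T d) : Set (S.fst (g^[n] y)) :=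
  {w | ‖w‖ ≤ C * δ ∧ ∀ j ≤ n, h.fstNorm S (g^[j] y)
    (diffVec (g^[j] (pullPoint S g n y w)) (g^[j] y)) ≤ δ}

lemma iterate_pullPoint (n : ℕ) (y : T d) (w : S.fst (g^[n] y)) :
    g^[n] (pullPoint S g n y w) = g^[n] y + proj (w : E d) :=
  g.iterate_iterate_symm n _

lemma pullPoint_zero (n : ℕ) (y : T d) : pullPoint S g n y 0 = y := by
  simp [pullPoint, proj_zero, g.iterate_symm_iterate]

lemma continuous_pullPoint (n : ℕ) (y : T d) : Continuous (pullPoint S g n y) :=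
  (g.symm.continuous_iterate n).comp
    (continuous_const.add (continuous_proj.comp continuous_subtype_val))

include H

/-- One step back in time for a pair of points in the stable cones. -/
lemma backward_step {z x : T d} (hd : tdist (g z) (g x) ≤ 4 * (C * δ))
    (hm : diffVec (g z) (g x) ∈ coneS h S α (g x)) :
    tdist z x < R ∧ diffVec z x ∈ coneS h S α x := by
  have h1 := H.close_symm _ _ hd
  simp only [TorusDiffeo.symm_apply_apply] at h1
  exact ⟨h1, H.mem_coneS_of_image h1 (hd.trans_lt H.δ_lt) hm⟩

/-- A bound `δ` for the stable size suffices to follow the orbit of a pulled back point: backwards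
from time `n`, its displacement from the orbit of `y` stays in the stable cones, where the stable
size controls the norm. -/
lemma pullSet_base {n : ℕ} {y : T d} {w : S.fst (g^[n] y)} (hw : w ∈ pullSet h S g δ C n y)
    {j : ℕ} (hj : j ≤ n) :
    tdist (g^[j] (pullPoint S g n y w)) (g^[j] y) ≤ C * δ ∧
      diffVec (g^[j] (pullPoint S g n y w)) (g^[j] y) ∈ coneS h S α (g^[j] y) := by
  have hself : ∀ x : T d, tdist x x < R := fun x => by rw [tdist_self]; exact H.R_pos
  have hsize : ∀ j ≤ n, diffVec (g^[j] (pullPoint S g n y w)) (g^[j] y) ∈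
      coneS h S α (g^[j] y) → tdist (g^[j] (pullPoint S g n y w)) (g^[j] y) ≤ C * δ :=
    fun j hj hm => (H.norm_le _ _ _ (hself _) hm).trans
      (mul_le_mul_of_nonneg_left (hw.2 j hj) H.C_pos.le)
  have hcone : diffVec (g^[j] (pullPoint S g n y w)) (g^[j] y) ∈ coneS h S α (g^[j] y) := by
    induction hj using Nat.decreasingInduction with
    | self =>
      rw [iterate_pullPoint, diffVec_add_proj]
      · exact H.mem_coneS _ _ _ (hself _) (S.mem_fst.1 w.2)
      · have h1 : ‖(w : E d)‖ ≤ C * δ := hw.1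
        linarith [H.δ_lt, H.R_le, H.Cδ_pos]
    | of_succ k hk ih =>
      have h1 := hsize (k + 1) hk ih
      simp only [Function.iterate_succ_apply'] at ih h1
      exact (H.backward_step (by linarith [H.Cδ_pos]) ih).2
  exact ⟨hsize j hj hcone, hcone⟩

/-- Two pulled back points remain close, and their difference stays in the stable cones, up to
time `n`: this holds at time `n`, where both lie on a flat disk, and goes backwards in time. -/
lemma pullSet_pair {n : ℕ} {y : T d} {w w' : S.fst (g^[n] y)}
    (hw : w ∈ pullSet h S g δ C n y) (hw' : w' ∈ pullSet h S g δ C n y) {j : ℕ} (hj : j ≤ n) :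
    tdist (g^[j] (pullPoint S g n y w)) (g^[j] (pullPoint S g n y w')) ≤ 2 * (C * δ) ∧
      diffVec (g^[j] (pullPoint S g n y w)) (g^[j] (pullPoint S g n y w')) ∈
        coneS h S α (g^[j] (pullPoint S g n y w')) := by
  have hCδ := H.Cδ_pos
  have hsize : ∀ j ≤ n, tdist (g^[j] (pullPoint S g n y w)) (g^[j] (pullPoint S g n y w')) ≤
      2 * (C * δ) := fun j hj => by
    have h1 := tdist_triangle (g^[j] (pullPoint S g n y w)) (g^[j] y)
      (g^[j] (pullPoint S g n y w'))
    rw [tdist_comm (g^[j] y)] at h1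
    linarith [(H.pullSet_base hw hj).1, (H.pullSet_base hw' hj).1]
  refine ⟨hsize j hj, ?_⟩
  induction hj using Nat.decreasingInduction with
  | self =>
    have h1 : ‖(w : E d)‖ ≤ C * δ := hw.1
    have h2 : ‖(w' : E d)‖ ≤ C * δ := hw'.1
    have h3 := (H.pullSet_base hw' le_rfl).1
    rw [iterate_pullPoint] at h3
    have e : g^[n] y + proj (w : E d) = g^[n] y + proj (w' : E d) + proj ((w : E d) - (w' : E d)) := by
      rw [proj_sub]; abel
    rw [iterate_pullPoint, iterate_pullPoint, e, diffVec_add_proj]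
    · refine H.mem_coneS _ (g^[n] y) _ (by linarith [H.δ_lt]) ?_
      rw [map_sub, S.mem_fst.1 w.2, S.mem_fst.1 w'.2]
    · have := norm_sub_le (w : E d) w'
      linarith [H.δ_lt, H.R_le]
  | of_succ k hk ih =>
    have h1 := hsize (k + 1) hk
    simp only [Function.iterate_succ_apply'] at ih h1
    exact (H.backward_step (by linarith) ih).2

lemma zero_mem_pullSet (n : ℕ) (y : T d) : (0 : S.fst (g^[n] y)) ∈ pullSet h S g δ C n y := by
  refine ⟨by rw [norm_zero]; exact H.Cδ_pos.le, fun j _ => ?_⟩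
  rw [pullPoint_zero, diffVec_self]
  simp [TorusMetric.fstNorm, h.norm_zero, H.δ_pos.le]

lemma isCompact_pullSet (n : ℕ) (y : T d) : IsCompact (pullSet h S g δ C n y) := by
  refine (isCompact_closedBall (0 : S.fst (g^[n] y)) (C * δ)).of_isClosed_subset ?_
    (fun w hw => mem_closedBall_zero_iff.2 hw.1)
  rw [isClosed_iff_ultrafilter]
  intro w U hU hmem
  refine ⟨?_, fun j hj => ?_⟩
  · exact le_of_tendsto ((continuous_norm.tendsto w).mono_left hU)
      (Filter.mem_of_superset hmem fun w hw => hw.1)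
  · have hq : Filter.Tendsto (fun w => g^[j] (pullPoint S g n y w)) U
        (𝓝 (g^[j] (pullPoint S g n y w))) :=
      (((g.continuous_iterate j).comp (continuous_pullPoint n y)).tendsto w).mono_left hU
    have h1 : tdist (g^[j] (pullPoint S g n y w)) (g^[j] y) ≤ C * δ :=
      le_of_tendsto (tendsto_tdist hq tendsto_const_nhds)
        (Filter.mem_of_superset hmem fun w hw => (H.pullSet_base hw hj).1)
    have h2 := tendsto_diffVec hq (tendsto_const_nhds (x := g^[j] y))
      (by linarith [H.δ_lt, H.R_le, H.Cδ_pos])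
    exact le_of_tendsto (tendsto_fstNorm h tendsto_const_nhds h2)
      (Filter.mem_of_superset hmem fun w hw => hw.2 j hj)

omit H in
/-- The stable coordinate at `x₀` of the point `pullPoint S g n y w`. -/
def pullCoord (S : Splitting d) (g : TorusDiffeo d) (n : ℕ) (y x₀ : T d) (w : S.fst (g^[n] y)) :
    S.fst x₀ :=
  ⟨S.P x₀ (diffVec (pullPoint S g n y w) x₀), S.P_mem_fst _ _⟩

/-- The stable coordinate is an open map near `w`: its derivative is invertible by the
transversality of the cones. -/
lemma map_nhds_pullCoord {n : ℕ} {y x₀ : T d} {w : S.fst (g^[n] y)} (hw : ‖w‖ < R)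
    (hq : tdist (pullPoint S g n y w) x₀ < R) :
    Filter.map (pullCoord S g n y x₀) (𝓝 w) = 𝓝 (pullCoord S g n y x₀ w) := by
  have hR := H.R_le
  let PR : E d →L[ℝ] S.fst x₀ := (S.P x₀).codRestrict (S.fst x₀) (S.P_mem_fst x₀)
  let A : S.fst (g^[n] y) → (S.fst (g^[n] y) →L[ℝ] S.fst x₀) := fun w' =>
    PR.comp ((g.symm.Diter n (g^[n] y + proj (w' : E d))).comp (S.fst (g^[n] y)).subtypeL)
  have hder : ∀ᶠ w' in 𝓝 w, HasFDerivAt (pullCoord S g n y x₀) (A w') w' := by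
    have h1 := tendsto_tdist ((continuous_pullPoint (S := S) (g := g) n y).tendsto w)
      (tendsto_const_nhds (x := x₀))
    filter_upwards [h1.eventually (gt_mem_nhds hq)] with w' hw'
    have h2 : HasTorusFDerivAt (pullPoint S g n y)
        ((g.symm.Diter n (g^[n] y + proj (w' : E d))).comp (S.fst (g^[n] y)).subtypeL) w' :=
      HasTorusFDerivAt.comp (p := g.symm^[n])
        (q := fun w : S.fst (g^[n] y) => g^[n] y + proj (w : E d)) (u := w')
        (g.symm.hasDeriv_iterate n _) (hasTorusFDerivAt_add_proj _ (S.fst (g^[n] y)).subtypeL w')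
    have h3 := h2.hasFDerivAt_diffVec (x := x₀) (by linarith)
    exact (PR.hasFDerivAt (x := diffVec (pullPoint S g n y w') x₀)).comp w' h3
  have hcont : Continuous A := by
    refine continuous_const.clm_comp (Continuous.clm_comp ?_ continuous_const)
    exact (g.symm.continuous_Diter n).comp
      (continuous_const.add (continuous_proj.comp continuous_subtype_val))
  have hstrict := hasStrictFDerivAt_of_hasFDerivAt_of_continuousAt hder hcont.continuousAt
  refine hstrict.map_nhds_eq_of_surj (LinearMap.range_eq_top.2 ?_)
  have hinj : Function.Injective (A w : S.fst (g^[n] y) →ₗ[ℝ] S.fst x₀) := by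
    rw [← LinearMap.ker_eq_bot, LinearMap.ker_eq_bot']
    intro v hv
    have h1 : S.P x₀ (g.symm.Diter n (g^[n] y + proj (w : E d)) (v : E d)) = 0 :=
      congrArg Subtype.val hv
    refine Subtype.ext (H.eq_zero_of_P_symm_Diter (y := g^[n] y) ?_ hq (S.mem_fst.1 v.2) h1)
    exact (tdist_add_proj_le _ _).trans_lt hw
  exact (LinearMap.injective_iff_surjective_of_finrank_eq_finrank
    (S.finrank_fst_eq _ _)).1 hinj

/-- The stable coordinates of the pulled back points fill a ball of uniform size: their set is
closed and open in it. -/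
lemma exists_pullSet_coord_eq : ∃ a > 0, ∃ b > 0, b ≤ R / 4 ∧ ∀ x₀ y : T d, tdist y x₀ < b →
    ∀ n, ∀ u : S.fst x₀, ‖u‖ < a → ∃ w ∈ pullSet h S g δ C n y, pullCoord S g n y x₀ w = u := by
  obtain ⟨M, hM, hFM⟩ := exists_fstNorm_le h S
  obtain ⟨B₀, hB₀⟩ := isCompact_univ.exists_bound_of_continuousOn S.continuous_P.continuousOn
  set B := max B₀ 1 with hB
  have hBpos : 0 < B := by positivity
  have hPB : ∀ x v, ‖S.P x v‖ ≤ B * ‖v‖ := fun x v => ((S.P x).le_opNorm v).trans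
    (mul_le_mul_of_nonneg_right ((hB₀ x trivial).trans (le_max_left _ _)) (norm_nonneg _))
  have hC := H.C_pos
  have hδ := H.δ_pos
  have hCδ := H.Cδ_pos
  have hδR := H.δ_lt
  have hR := H.R_le
  set a := δ / (4 * (M * M * C)) with ha
  have hapos : 0 < a := by positivity
  have hRpos := H.R_pos
  refine ⟨a, hapos, min (a / B) (R / 4), by positivity, min_le_right _ _, ?_⟩
  intro x₀ y hy n u hu
  have hyb : B * tdist y x₀ < a := by
    have := hy.trans_le (min_le_left _ _)
    rwa [lt_div_iff₀ hBpos, mul_comm] at this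
  have hyR : tdist y x₀ < R / 4 := hy.trans_le (min_le_right _ _)
  set K := pullSet h S g δ C n y with hK
  have hnear : ∀ w ∈ K, tdist (pullPoint S g n y w) x₀ < R := fun w hw => by
    have h1 := (H.pullSet_base hw (Nat.zero_le n)).1
    simp only [Function.iterate_zero_apply] at h1
    linarith [tdist_triangle (pullPoint S g n y w) y x₀]
  have hcontOn : ContinuousOn (pullCoord S g n y x₀) K := by
    intro w hw
    refine ContinuousAt.continuousWithinAt ?_
    refine tendsto_subtype_rng.2 (((S.P x₀).continuous.tendsto _).comp ?_)
    exact tendsto_diffVec ((continuous_pullPoint n y).tendsto w) tendsto_const_nhds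
      (by linarith [hnear w hw])
  have hcl : IsClosed (pullCoord S g n y x₀ '' K) :=
    ((H.isCompact_pullSet n y).image_of_continuousOn hcontOn).isClosed
  -- Over the ball of radius `a` the constraints defining `K` hold strictly.
  have hopen : ∀ u ∈ Metric.ball (0 : S.fst x₀) a, u ∈ pullCoord S g n y x₀ '' K →
      u ∈ interior (pullCoord S g n y x₀ '' K) := by
    rintro u hu ⟨w, hw, rfl⟩
    rw [mem_ball_zero_iff] at hu
    have hq := hnear w hw
    have hbase := fun j (hj : j ≤ n) => H.pullSet_base hw hj
    have hb0 := hbase 0 (Nat.zero_le n)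
    simp only [Function.iterate_zero_apply] at hb0
    have hstrict0 : h.fstNorm S y (diffVec (pullPoint S g n y w) y) < δ := by
      have e : diffVec (pullPoint S g n y w) x₀ =
          diffVec (pullPoint S g n y w) y + diffVec y x₀ := diffVec_add (by linarith)
      have h1 : ‖S.P x₀ (diffVec (pullPoint S g n y w) y)‖ ≤ 2 * a := by
        have e2 : S.P x₀ (diffVec (pullPoint S g n y w) y) =
            S.P x₀ (diffVec (pullPoint S g n y w) x₀) - S.P x₀ (diffVec y x₀) := by
          rw [e, map_add]; abel
        have h2 : ‖S.P x₀ (diffVec (pullPoint S g n y w) x₀)‖ < a := hu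
        have h3 := hPB x₀ (diffVec y x₀)
        change _ ≤ B * tdist y x₀ at h3
        rw [e2]
        linarith [norm_sub_le (S.P x₀ (diffVec (pullPoint S g n y w) x₀)) (S.P x₀ (diffVec y x₀))]
      have h2 : h.fstNorm S x₀ (diffVec (pullPoint S g n y w) y) ≤ M * (2 * a) := by
        have h3 := hFM x₀ (S.P x₀ (diffVec (pullPoint S g n y w) y))
        rw [TorusMetric.fstNorm, S.idem] at h3
        exact h3.trans (mul_le_mul_of_nonneg_left h1 hM.le)
      have h3 := H.norm_le y x₀ _ (by linarith) hb0.2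
      have h4 : ‖diffVec (pullPoint S g n y w) y‖ ≤ C * (M * (2 * a)) :=
        h3.trans (mul_le_mul_of_nonneg_left h2 hC.le)
      have h5 := (hFM y _).trans (mul_le_mul_of_nonneg_left h4 hM.le)
      have h6 : M * (C * (M * (2 * a))) = δ / 2 := by rw [ha]; field_simp; norm_num
      rw [h6] at h5
      linarith
    have hstrict : ∀ j ≤ n, h.fstNorm S (g^[j] y)
        (diffVec (g^[j] (pullPoint S g n y w)) (g^[j] y)) < δ := by
      intro j
      induction j with
      | zero => intro _; simpa using hstrict0
      | succ j ih =>
        intro hj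
        have h1 := ih (by omega)
        simp only [Function.iterate_succ_apply']
        exact H.contract _ _ (hbase j (by omega)).2 h1.le
    have hwlt : ‖(w : E d)‖ < C * δ := by
      have h1 := hstrict n le_rfl
      have h2 := (hbase n le_rfl).2
      have h3 : ‖(w : E d)‖ ≤ C * δ := hw.1
      rw [iterate_pullPoint, diffVec_add_proj _ (by linarith)] at h1 h2
      exact (H.norm_le _ (g^[n] y) _ (by rw [tdist_self]; exact hRpos) h2).trans_lt
        (mul_lt_mul_of_pos_left h1 hC)
    have hKn : K ∈ 𝓝 w := by
      have h1 : ∀ᶠ w' in 𝓝 w, ‖w'‖ < C * δ :=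
        (continuous_norm.tendsto w).eventually (gt_mem_nhds hwlt)
      have h2 : ∀ᶠ w' in 𝓝 w, ∀ j ∈ Finset.range (n + 1), h.fstNorm S (g^[j] y)
          (diffVec (g^[j] (pullPoint S g n y w')) (g^[j] y)) < δ := by
        rw [Filter.eventually_all_finset]
        intro j hj
        have hj' : j ≤ n := by simpa [Nat.lt_succ_iff] using hj
        have t1 := tendsto_diffVec
          (((g.continuous_iterate j).comp (continuous_pullPoint (S := S) n y)).tendsto w)
          (tendsto_const_nhds (x := g^[j] y)) (by
            have := (hbase j hj').1
            simp only [Function.comp_apply]; linarith)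
        exact (tendsto_fstNorm h tendsto_const_nhds t1).eventually
          (gt_mem_nhds (hstrict j hj'))
      filter_upwards [h1, h2] with w' h1' h2'
      exact ⟨h1'.le, fun j hj => (h2' j (by simpa [Nat.lt_succ_iff] using hj)).le⟩
    rw [mem_interior_iff_mem_nhds, ← H.map_nhds_pullCoord (lt_trans hwlt (by linarith)) hq]
    exact Filter.image_mem_map hKn
  have hsub : Metric.ball (0 : S.fst x₀) a ⊆ interior (pullCoord S g n y x₀ '' K) := by
    refine (convex_ball (0 : S.fst x₀) a).isPreconnected.subset_of_closure_inter_subset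
      isOpen_interior ?_ ?_
    · have h1 : ‖pullCoord S g n y x₀ 0‖ < a := by
        change ‖S.P x₀ (diffVec (pullPoint S g n y 0) x₀)‖ < a
        rw [pullPoint_zero]
        exact (hPB _ _).trans_lt hyb
      refine ⟨pullCoord S g n y x₀ 0, mem_ball_zero_iff.2 h1, hopen _ (mem_ball_zero_iff.2 h1) ?_⟩
      exact ⟨0, H.zero_mem_pullSet n y, rfl⟩
    · rintro v ⟨hv1, hv2⟩
      exact hopen v hv2 (hcl.closure_subset_iff.2 interior_subset hv1)
  have hmem : u ∈ pullCoord S g n y x₀ '' K := interior_subset (hsub (mem_ball_zero_iff.2 hu))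
  exact hmem

/-- Through each point `y` near `x₀` passes a plaque: a set of mutually stably related points
parametrized by the stable coordinate at `x₀`, obtained as a limit of pulled back disks. -/
lemma exists_plaque : ∃ a > 0, ∃ b > 0, b ≤ R / 4 ∧ ∀ x₀ y : T d, tdist y x₀ < b →
    ∃ Z : S.fst x₀ → T d, ∀ u, ‖u‖ < a →
      S.P x₀ (diffVec (Z u) x₀) = u ∧ tdist (Z u) x₀ < R / 2 ∧
      StableRel h S g α (2 * (C * δ)) y (Z u) ∧
      ∀ u', ‖u'‖ < a → StableRel h S g α (2 * (C * δ)) (Z u) (Z u') := by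
  obtain ⟨a, ha, b, hb, hbR, hex⟩ := H.exists_pullSet_coord_eq
  refine ⟨a, ha, b, hb, hbR, fun x₀ y hy => ?_⟩
  have hδR := H.δ_lt
  have hR := H.R_le
  have hCδ := H.Cδ_pos
  have hchoice : ∀ (u : S.fst x₀) (n : ℕ), ∃ w : S.fst (g^[n] y), ‖u‖ < a →
      w ∈ pullSet h S g δ C n y ∧ pullCoord S g n y x₀ w = u := fun u n => by
    by_cases hu : ‖u‖ < a
    · obtain ⟨w, hw⟩ := hex x₀ y hy n u hu
      exact ⟨w, fun _ => hw⟩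
    · exact ⟨0, fun h => absurd h hu⟩
  choose w hw using hchoice
  choose Z hZ using fun u => exists_tendsto_torus (Filter.hyperfilter ℕ)
    (fun n => pullPoint S g n y (w u n))
  have hge : ∀ n : ℕ, ∀ᶠ k in (Filter.hyperfilter ℕ : Filter ℕ), n ≤ k := fun n =>
    Nat.hyperfilter_le_atTop (Filter.eventually_ge_atTop n)
  have hZx : ∀ u, ‖u‖ < a → tdist (Z u) x₀ < R / 2 := fun u hu => by
    have h1 : tdist (Z u) y ≤ C * δ := le_of_tendsto (tendsto_tdist (hZ u) tendsto_const_nhds)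
      (Filter.Eventually.of_forall fun n => by
        simpa using (H.pullSet_base (hw u n hu).1 (Nat.zero_le n)).1)
    linarith [tdist_triangle (Z u) y x₀]
  refine ⟨Z, fun u hu => ⟨?_, hZx u hu, ?_, fun u' hu' => ?_⟩⟩
  · have h1 := tendsto_diffVec (hZ u) (tendsto_const_nhds (x := x₀)) (by linarith [hZx u hu])
    refine tendsto_nhds_unique (((S.P x₀).continuous.tendsto _).comp h1) ?_
    refine tendsto_const_nhds.congr fun n => ?_
    exact (congrArg Subtype.val (hw u n hu).2).symm
  · refine stableRel_of_tendsto (by linarith) (tendsto_const_nhds (x := y)) (hZ u) fun n => ?_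
    filter_upwards [hge n] with k hk
    have h0 := H.zero_mem_pullSet k y
    have h1 := H.pullSet_pair (hw u k hu).1 h0 hk
    have h2 := H.pullSet_pair h0 (hw u k hu).1 hk
    rw [pullPoint_zero] at h1 h2
    exact ⟨h1.1, h1.2, h2.2⟩
  · refine stableRel_of_tendsto (by linarith) (hZ u) (hZ u') fun n => ?_
    filter_upwards [hge n] with k hk
    have h1 := H.pullSet_pair (hw u' k hu').1 (hw u k hu).1 hk
    have h2 := H.pullSet_pair (hw u k hu).1 (hw u' k hu').1 hk
    exact ⟨h1.1, h1.2, h2.2⟩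

end ConeSystem

/-! ### Foliated charts -/

/-- A ball of a Euclidean space is diffeomorphic to the standard model. -/
lemma exists_ball_chart {V : Type*} [NormedAddCommGroup V] [InnerProductSpace ℝ V]
    [FiniteDimensional ℝ V] {k : ℕ} (hk : Module.finrank ℝ V = k) {r : ℝ} (hr : 0 < r) :
    ∃ χ : OpenPartialHomeomorph V (E k), χ.source = Metric.ball 0 r ∧ χ.target = Set.univ ∧
      ∃ A : E k → (E k →L[ℝ] V), Continuous A ∧
        ∀ u, Function.Injective (A u) ∧ HasFDerivAt χ.symm (A u) u := by
  let e : V ≃L[ℝ] E k := ContinuousLinearEquiv.ofFinrankEq (by simpa using hk)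
  let β : OpenPartialHomeomorph V V := OpenPartialHomeomorph.univBall (0 : V) r
  have hβ : ContDiff ℝ 1 β := OpenPartialHomeomorph.contDiff_univBall
  have hβs : ContDiffOn ℝ 1 β.symm (Metric.ball 0 r) :=
    OpenPartialHomeomorph.contDiffOn_univBall_symm
  have hsrc : β.source = Set.univ := OpenPartialHomeomorph.univBall_source _ _
  have htgt : β.target = Metric.ball 0 r := OpenPartialHomeomorph.univBall_target _ hr
  have hβd : ∀ v, HasFDerivAt β (fderiv ℝ β v) v := fun v =>
    (hβ.differentiable one_ne_zero v).hasFDerivAt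
  refine ⟨β.symm.trans e.toHomeomorph.toOpenPartialHomeomorph, ?_, ?_,
    fun u => (fderiv ℝ β (e.symm u)).comp (e.symm : E k →L[ℝ] V), ?_, fun u => ⟨?_, ?_⟩⟩
  · simp [htgt]
  · simp [hsrc]
  · exact ((hβ.continuous_fderiv one_ne_zero).comp e.symm.continuous).clm_comp continuous_const
  · have hinj : Function.Injective (fderiv ℝ β (e.symm u)) := by
      have hm : β (e.symm u) ∈ Metric.ball (0 : V) r := by
        rw [← htgt]; exact β.map_source (by rw [hsrc]; trivial)
      have h1 : HasFDerivAt β.symm (fderiv ℝ β.symm (β (e.symm u))) (β (e.symm u)) :=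
        ((hβs.differentiableOn one_ne_zero).differentiableAt
          (Metric.isOpen_ball.mem_nhds hm)).hasFDerivAt
      have h2 := h1.comp (e.symm u) (hβd (e.symm u))
      have h3 : HasFDerivAt (β.symm ∘ β) (ContinuousLinearMap.id ℝ V) (e.symm u) := by
        have : (β.symm ∘ β) = id := funext fun v => β.left_inv (by rw [hsrc]; trivial)
        rw [this]; exact hasFDerivAt_id _
      have h4 := h2.unique h3
      exact Function.LeftInverse.injective (g := fderiv ℝ β.symm (β (e.symm u)))
        fun v => by simpa using DFunLike.congr_fun h4 v
    exact hinj.comp e.symm.injective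
  · exact (hβd (e.symm u)).comp u (e.symm : E k →L[ℝ] V).hasFDerivAt

/-- A chart whose plaques are the local classes of the stable relation, and are `C¹` and tangent
to the stable bundle. -/
structure IsStableChart (h : TorusMetric d) (S : Splitting d) (g : TorusDiffeo d) (α r : ℝ)
    {k : ℕ} (φ : OpenPartialHomeomorph (T d) (E k × E (d - k))) : Prop where
  target_eq : φ.target = Set.univ
  rel_iff : ∀ y ∈ φ.source, ∀ z ∈ φ.source, (φ y).2 = (φ z).2 ↔ StableRel h S g α r y z
  c1 : ∀ s : E (d - k), ∃ L : E k → (E k →L[ℝ] E d), Continuous L ∧ ∀ u,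
    Function.Injective (L u) ∧ HasTorusFDerivAt (fun u' => φ.symm (u', s)) (L u) u ∧
    ∀ v, L u v ∈ csBundle h S g α (φ.symm (u, s))

namespace ConeSystem
variable {h : TorusMetric d} {S : Splitting d} {g : TorusDiffeo d} {α Λ R δ C : ℝ}
  (H : ConeSystem h S g α Λ R δ C)

/-- The stable coordinate of `y` with respect to the base point `x₀`. -/
def coord (S : Splitting d) (x₀ y : T d) : S.fst x₀ := ⟨S.P x₀ (diffVec y x₀), S.P_mem_fst _ _⟩

/-- The plaques through the points near `x₀`, as graphs over a ball of `E^s(x₀)`. -/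
structure PlaqueFamily (H : ConeSystem h S g α Λ R δ C) (x₀ : T d) (a b : ℝ)
    (Z : T d → S.fst x₀ → T d) : Prop where
  a_pos : 0 < a
  b_pos : 0 < b
  b_le : b ≤ R / 4
  coord_eq : ∀ y, tdist y x₀ < b → ∀ u, ‖u‖ < a → coord S x₀ (Z y u) = u
  near : ∀ y, tdist y x₀ < b → ∀ u, ‖u‖ < a → tdist (Z y u) x₀ < R / 2
  rel : ∀ y, tdist y x₀ < b → ∀ u, ‖u‖ < a → StableRel h S g α (2 * (C * δ)) y (Z y u)
  rel_pair : ∀ y, tdist y x₀ < b → ∀ u, ‖u‖ < a → ∀ u', ‖u'‖ < a →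
    StableRel h S g α (2 * (C * δ)) (Z y u) (Z y u')

lemma exists_plaqueFamily (x₀ : T d) : ∃ a b, ∃ Z, H.PlaqueFamily x₀ a b Z := by
  obtain ⟨a, ha, b, hb, hbR, hex⟩ := H.exists_plaque
  have hchoice : ∀ y : T d, ∃ Z : S.fst x₀ → T d, tdist y x₀ < b → ∀ u, ‖u‖ < a →
      S.P x₀ (diffVec (Z u) x₀) = u ∧ tdist (Z u) x₀ < R / 2 ∧
      StableRel h S g α (2 * (C * δ)) y (Z u) ∧
      ∀ u', ‖u'‖ < a → StableRel h S g α (2 * (C * δ)) (Z u) (Z u') := fun y => by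
    by_cases hy : tdist y x₀ < b
    · obtain ⟨Z, hZ⟩ := hex x₀ y hy
      exact ⟨Z, fun _ => hZ⟩
    · exact ⟨fun _ => y, fun h' => absurd h' hy⟩
  choose Z hZ using hchoice
  exact ⟨a, b, Z, ha, hb, hbR, fun y hy u hu => Subtype.ext (hZ y hy u hu).1,
    fun y hy u hu => (hZ y hy u hu).2.1, fun y hy u hu => (hZ y hy u hu).2.2.1,
    fun y hy u hu u' hu' => (hZ y hy u hu).2.2.2 u' hu'⟩

lemma coord_self (x₀ : T d) : coord S x₀ x₀ = 0 :=
  Subtype.ext (by simp [coord, diffVec_self])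

lemma continuousAt_coord {x₀ y : T d} (hy : tdist y x₀ < 1 / 2) :
    ContinuousAt (coord S x₀) y :=
  tendsto_subtype_rng.2 (((S.P x₀).continuous.tendsto _).comp
    (tendsto_diffVec Filter.tendsto_id tendsto_const_nhds hy))

namespace PlaqueFamily
variable {H} {x₀ : T d} {a b : ℝ} {Z : T d → S.fst x₀ → T d} (F : H.PlaqueFamily x₀ a b Z)
include F

/-- The point of the plaque through `y` with the stable coordinate `u` is the only point with this
coordinate near `x₀` that is joined to it by two steps of the stable relation. -/
lemma eq_of_rel {y z p : T d} {u : S.fst x₀} (hy : tdist y x₀ < b) (hu : ‖u‖ < a)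
    (hz : tdist z x₀ < R) (hzp : StableRel h S g α (2 * (C * δ)) z p)
    (hp : StableRel h S g α (2 * (C * δ)) p (Z y u)) (hc : coord S x₀ z = u) : Z y u = z := by
  have hR := H.R_le
  have h1 := F.near y hy u hu
  have hR0 := H.R_pos
  refine H.eq_of_stableRel (x₀ := x₀) hz (by linarith) hzp hp ?_
  rw [diffVec_sub (x := x₀) (by linarith), map_sub]
  have h2 : S.P x₀ (diffVec (Z y u) x₀) = u := congrArg Subtype.val (F.coord_eq y hy u hu)
  have h3 : S.P x₀ (diffVec z x₀) = u := congrArg Subtype.val hc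
  rw [h2, h3, sub_self]

lemma lt_R {y : T d} (hy : tdist y x₀ < b) : tdist y x₀ < R := by
  linarith [F.b_le, H.R_pos]

lemma apply_coord {y : T d} (hy : tdist y x₀ < b) (hc : ‖coord S x₀ y‖ < a) :
    Z y (coord S x₀ y) = y :=
  F.eq_of_rel hy hc (F.lt_R hy) (H.stableRel_self y) (F.rel y hy _ hc) rfl

lemma eq_of_stableRel {y z : T d} (hy : tdist y x₀ < b) (hz : tdist z x₀ < b)
    (hcz : ‖coord S x₀ z‖ < a) (hyz : StableRel h S g α (2 * (C * δ)) y z) {u : S.fst x₀}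
    (hu : ‖u‖ < a) : Z y u = Z z u := by
  have h1 : Z y (coord S x₀ z) = z :=
    F.eq_of_rel hy hcz (F.lt_R hz) hyz.symm (F.rel y hy _ hcz) rfl
  have h2 := F.rel_pair y hy _ hcz u hu
  rw [h1] at h2
  exact F.eq_of_rel hy hu (by linarith [F.near z hz u hu, H.R_pos]) (F.rel z hz u hu).symm h2
    (F.coord_eq z hz u hu)

lemma continuousAt {y : T d} {u : S.fst x₀} (hy : tdist y x₀ < b) (hu : ‖u‖ < a) :
    ContinuousAt (fun p : T d × S.fst x₀ => Z p.1 p.2) (y, u) := by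
  have hR := H.R_le
  have hR0 := H.R_pos
  rw [continuousAt_iff_ultrafilter]
  intro U hU
  obtain ⟨z, hz⟩ := exists_tendsto_torus U fun p : T d × S.fst x₀ => Z p.1 p.2
  have h1 : Filter.Tendsto (fun p : T d × S.fst x₀ => p.1) U (𝓝 y) :=
    (continuous_fst.tendsto (y, u)).mono_left hU
  have h2 : Filter.Tendsto (fun p : T d × S.fst x₀ => p.2) U (𝓝 u) :=
    (continuous_snd.tendsto (y, u)).mono_left hU
  have hev : ∀ᶠ p in (U : Filter (T d × S.fst x₀)), tdist p.1 x₀ < b ∧ ‖p.2‖ < a :=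
    ((tendsto_tdist h1 tendsto_const_nhds).eventually (gt_mem_nhds hy)).and
      (h2.norm.eventually (gt_mem_nhds hu))
  have hzx : tdist z x₀ ≤ R / 2 := le_of_tendsto (tendsto_tdist hz tendsto_const_nhds)
    (hev.mono fun p hp => (F.near _ hp.1 _ hp.2).le)
  have hrel : StableRel h S g α (2 * (C * δ)) y z :=
    stableRel_of_tendsto (by linarith [H.δ_lt, H.Cδ_pos]) h1 hz fun n =>
      hev.mono fun p hp => F.rel _ hp.1 _ hp.2 n
  have hc : coord S x₀ z = u := by
    have h3 := (continuousAt_coord (S := S) (x₀ := x₀) (y := z) (by linarith)).tendsto.comp hz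
    exact tendsto_nhds_unique h3 (h2.congr' (hev.mono fun p hp =>
      (F.coord_eq _ hp.1 _ hp.2).symm))
  rwa [F.eq_of_rel hy hu (by linarith) hrel.symm (F.rel y hy u hu) hc]

/-- The plaques are differentiable, with derivative given by the stable bundle. -/
lemma hasTorusFDerivAt {y : T d} {u : S.fst x₀} (hy : tdist y x₀ < b) (hu : ‖u‖ < a)
    (hz : tdist (Z y u) x₀ < R) :
    HasTorusFDerivAt (Z y) ((H.csProj hz).comp (S.fst x₀).subtypeL) u := by
  have hR := H.R_le
  have hR0 := H.R_pos
  obtain ⟨M, hM, hFM⟩ := exists_fstNorm_le h S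
  have hcont : Filter.Tendsto (Z y) (𝓝 u) (𝓝 (Z y u)) :=
    (F.continuousAt hy hu).tendsto.comp (Filter.Tendsto.prodMk_nhds
      (tendsto_const_nhds (x := y)) Filter.tendsto_id)
  have hev : ∀ᶠ u' in 𝓝 u, ‖u'‖ < a :=
    (continuous_norm.tendsto u).eventually (gt_mem_nhds hu)
  have hrel : ∀ᶠ u' in 𝓝 u, StableRel h S g α (2 * (C * δ)) (Z y u) (Z y u') :=
    hev.mono fun u' hu' => F.rel_pair y hy u hu u' hu'
  have hP : ∀ᶠ u' in 𝓝 u, S.P x₀ (diffVec (Z y u') (Z y u)) = ((u' - u : S.fst x₀) : E d) :=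
    hev.mono fun u' hu' => by
      have n1 := F.near y hy u hu
      have n2 := F.near y hy u' hu'
      rw [diffVec_sub (x := x₀) (by linarith), map_sub]
      have h2 : S.P x₀ (diffVec (Z y u) x₀) = u := congrArg Subtype.val (F.coord_eq y hy u hu)
      have h3 : S.P x₀ (diffVec (Z y u') x₀) = u' :=
        congrArg Subtype.val (F.coord_eq y hy u' hu')
      rw [h2, h3]; rfl
  have hO : (fun u' => diffVec (Z y u') (Z y u)) =O[𝓝 u] fun u' => u' - u := by
    refine Asymptotics.IsBigO.of_bound (C * M) ?_
    filter_upwards [hP, hrel] with u' h1 h2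
    have h3 := H.norm_le _ _ _ hz (h2 0).2.1
    simp only [Function.iterate_zero_apply] at h3
    have h4 : h.fstNorm S x₀ (diffVec (Z y u') (Z y u)) ≤ M * ‖u' - u‖ := by
      have := hFM x₀ (S.P x₀ (diffVec (Z y u') (Z y u)))
      rw [TorusMetric.fstNorm, S.idem, h1] at this
      rw [TorusMetric.fstNorm, h1]
      exact this
    rw [mul_assoc]
    exact h3.trans (mul_le_mul_of_nonneg_left h4 H.C_pos.le)
  have hlo := (H.isLittleO_sub_csProj hz hcont hrel).trans_isBigO hO
  rw [HasTorusFDerivAt, hasFDerivAt_iff_isLittleO]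
  refine hlo.congr' ?_ Filter.EventuallyEq.rfl
  filter_upwards [hP] with u' h1
  rw [diffVec_self, sub_zero, ← H.csProj_P hz (diffVec (Z y u') (Z y u)), h1]
  rfl

/-- A `C¹` parametrization of the ball of stable coordinates gives one of the plaque. -/
lemma exists_deriv_comp {V : Type*} [NormedAddCommGroup V] [NormedSpace ℝ V] {y : T d}
    (hy : tdist y x₀ < b) {χ : V → S.fst x₀} (hχ : Continuous χ) {A : V → (V →L[ℝ] S.fst x₀)}
    (hA : Continuous A) (hinj : ∀ u, Function.Injective (A u))
    (hAd : ∀ u, HasFDerivAt χ (A u) u) (hu : ∀ u, ‖χ u‖ < a) :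
    ∃ L : V → (V →L[ℝ] E d), Continuous L ∧ ∀ u, Function.Injective (L u) ∧
      HasTorusFDerivAt (fun u' => Z y (χ u')) (L u) u ∧
      ∀ v, L u v ∈ csBundle h S g α (Z y (χ u)) := by
  have hR := H.R_pos
  have hzR : ∀ u, tdist (Z y (χ u)) x₀ < R := fun u => by linarith [F.near y hy _ (hu u)]
  have hZc : Continuous fun u => Z y (χ u) := by
    rw [continuous_iff_continuousAt]
    intro u
    exact (F.continuousAt hy (hu u)).tendsto.comp (Filter.Tendsto.prodMk_nhds
      (tendsto_const_nhds (x := y)) (hχ.tendsto u))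
  refine ⟨fun u => ((H.csProj (hzR u)).comp (S.fst x₀).subtypeL).comp (A u), ?_, fun u =>
    ⟨?_, ?_, fun v => H.csProj_mem (hzR u) _⟩⟩
  · have hQ : Continuous fun u => H.csProj (hzR u) := by
      have h1 := (H.continuous_csProj x₀).comp (hZc.subtype_mk hzR)
      simpa only [Function.comp_def] using h1
    exact (hQ.clm_comp continuous_const).clm_comp hA
  · rw [injective_iff_map_eq_zero]
    intro v hv
    have h3 : S.P x₀ ((A u v : S.fst x₀) : E d) = 0 := (H.csProj_eq_zero (hzR u)).1 hv
    rw [S.mem_fst.1 (A u v).2] at h3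
    exact hinj u (by rw [map_zero]; exact Subtype.ext h3)
  · have h3 : HasFDerivAt (fun w => diffVec (Z y w) (Z y (χ u)))
        ((H.csProj (hzR u)).comp (S.fst x₀).subtypeL) (χ u) :=
      F.hasTorusFDerivAt hy (hu u) (hzR u)
    exact h3.comp u (hAd u)

end PlaqueFamily

include H

/-- The chart near `x₀` given by the stable coordinate and by the point where the plaque meets
the affine unstable space through `x₀`. -/
lemma exists_local_product (x₀ : T d) : ∃ a > 0, ∃ b > 0, ∃ a₁ b₁, ∃ Z,
    H.PlaqueFamily x₀ a₁ b₁ Z ∧ a ≤ a₁ ∧ b ≤ b₁ ∧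
    ∃ φ : OpenPartialHomeomorph (T d) (S.fst x₀ × S.snd x₀),
      x₀ ∈ φ.source ∧ φ.target = Metric.ball 0 a ×ˢ Metric.ball 0 b ∧
      (∀ p, φ.symm p = Z (x₀ + proj (p.2 : E d)) p.1) ∧
      ∀ y ∈ φ.source, ∀ z ∈ φ.source, (φ y).2 = (φ z).2 ↔
        StableRel h S g α (2 * (C * δ)) y z := by
  obtain ⟨a₁, b₁, Z, F⟩ := H.exists_plaqueFamily x₀
  have hR := H.R_le
  have hR0 := H.R_pos
  have hb₁R := F.b_le
  have hx₀ : tdist x₀ x₀ < b₁ := by rw [tdist_self]; exact F.b_pos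
  have hc₀ : ‖coord S x₀ x₀‖ < a₁ := by rw [coord_self, norm_zero]; exact F.a_pos
  have hZ₀ : Z x₀ 0 = x₀ := by
    have := F.apply_coord hx₀ hc₀
    rwa [coord_self] at this
  have h0a : ‖(0 : S.fst x₀)‖ < a₁ := by rw [norm_zero]; exact F.a_pos
  -- The local product map stays near `x₀` on a small product of balls.
  have hcont0 : ContinuousAt (fun p : S.fst x₀ × S.snd x₀ => Z (x₀ + proj (p.2 : E d)) p.1) 0 := by
    have h1 : ContinuousAt (fun p : S.fst x₀ × S.snd x₀ => (x₀ + proj (p.2 : E d), p.1)) 0 := by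
      refine Continuous.continuousAt ?_
      exact (continuous_const.add (continuous_proj.comp
        (continuous_subtype_val.comp continuous_snd))).prodMk continuous_fst
    have h2 := F.continuousAt hx₀ h0a
    refine ContinuousAt.comp (g := fun p : T d × S.fst x₀ => Z p.1 p.2)
      (f := fun p : S.fst x₀ × S.snd x₀ => (x₀ + proj (p.2 : E d), p.1)) ?_ h1
    simpa [proj_zero] using h2
  have hnear : ∀ᶠ p : S.fst x₀ × S.snd x₀ in 𝓝 0, tdist (Z (x₀ + proj (p.2 : E d)) p.1) x₀ < b₁ := by
    have h1 := tendsto_tdist hcont0.tendsto (tendsto_const_nhds (x := x₀))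
    refine h1.eventually (gt_mem_nhds ?_)
    simpa [proj_zero, hZ₀, tdist_self] using F.b_pos
  obtain ⟨c, hc, hball⟩ := Metric.eventually_nhds_iff.1 hnear
  set a := min c a₁ with ha
  set b := min c b₁ with hb
  have hapos : 0 < a := lt_min hc F.a_pos
  have hbpos : 0 < b := lt_min hc F.b_pos
  have haa : a ≤ a₁ := min_le_right _ _
  have hbb : b ≤ b₁ := min_le_right _ _
  have hprod : ∀ (u : S.fst x₀) (t : S.snd x₀), ‖u‖ < a → ‖t‖ < b →
      tdist (Z (x₀ + proj (t : E d)) u) x₀ < b₁ := fun u t hu ht => by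
    refine hball (y := (u, t)) ?_
    rw [dist_zero_right, Prod.norm_def]
    exact max_lt (hu.trans_le (min_le_left _ _)) (ht.trans_le (min_le_left _ _))
  -- Points of the transversal.
  have hdt : ∀ t : S.snd x₀, ‖t‖ < b → diffVec (x₀ + proj (t : E d)) x₀ = t := fun t ht =>
    diffVec_add_proj x₀ (by
      have : ‖(t : E d)‖ < b := ht
      linarith)
  have htb : ∀ t : S.snd x₀, ‖t‖ < b → tdist (x₀ + proj (t : E d)) x₀ < b := fun t ht => by
    rw [tdist, hdt t ht]; exact ht
  have htc : ∀ t : S.snd x₀, ‖t‖ < b → coord S x₀ (x₀ + proj (t : E d)) = 0 := fun t ht =>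
    Subtype.ext (by simpa [coord, hdt t ht] using S.mem_snd.1 t.2)
  have hZt : ∀ (u : S.fst x₀) (t : S.snd x₀), ‖u‖ < a → ‖t‖ < b →
      Z (Z (x₀ + proj (t : E d)) u) 0 = x₀ + proj (t : E d) := fun u t hu ht => by
    have hp := (htb t ht).trans_le hbb
    have h1 := F.eq_of_stableRel (hprod u t hu ht) hp (by rw [htc t ht]; exact h0a)
      (F.rel _ hp u (hu.trans_le haa)).symm h0a
    rw [h1]
    have h2 := F.apply_coord hp (by rw [htc t ht]; exact h0a)
    rwa [htc t ht] at h2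
  let τ : T d → S.snd x₀ := fun y => ⟨diffVec (Z y 0) x₀ - S.P x₀ (diffVec (Z y 0) x₀), by
    rw [S.mem_snd, map_sub, S.idem, sub_self]⟩
  have hτ : ∀ y, tdist y x₀ < b₁ → (τ y : E d) = diffVec (Z y 0) x₀ := fun y hy => by
    have h1 : S.P x₀ (diffVec (Z y 0) x₀) = 0 := congrArg Subtype.val (F.coord_eq y hy 0 h0a)
    change diffVec (Z y 0) x₀ - S.P x₀ (diffVec (Z y 0) x₀) = _
    rw [h1, sub_zero]
  have hτZ : ∀ y, tdist y x₀ < b₁ → x₀ + proj (τ y : E d) = Z y 0 := fun y hy => by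
    rw [hτ y hy, add_proj_diffVec]
  have hτcont : ∀ y, tdist y x₀ < b₁ → ContinuousAt τ y := fun y hy => by
    have h1 : ContinuousAt (fun y => Z y 0) y :=
      (F.continuousAt hy h0a).tendsto.comp (Filter.Tendsto.prodMk_nhds
        Filter.tendsto_id (tendsto_const_nhds (x := (0 : S.fst x₀))))
    have h2 := tendsto_diffVec h1.tendsto (tendsto_const_nhds (x := x₀))
      (by linarith [F.near y hy 0 h0a])
    exact tendsto_subtype_rng.2 (h2.sub (((S.P x₀).continuous.tendsto _).comp h2))
  let src : Set (T d) := {y | tdist y x₀ < b₁ ∧ ‖coord S x₀ y‖ < a ∧ ‖τ y‖ < b}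
  have hback : ∀ y ∈ src, Z (x₀ + proj (τ y : E d)) (coord S x₀ y) = y := fun y hy => by
    have hca := hy.2.1.trans_le haa
    have hp := (htb _ hy.2.2).trans_le hbb
    have hrel := F.rel y hy.1 0 h0a
    rw [← hτZ y hy.1] at hrel
    rw [F.eq_of_stableRel hp hy.1 hca hrel.symm hca, F.apply_coord hy.1 hca]
  let φ : OpenPartialHomeomorph (T d) (S.fst x₀ × S.snd x₀) :=
    { toFun := fun y => (coord S x₀ y, τ y)
      invFun := fun p => Z (x₀ + proj (p.2 : E d)) p.1
      source := src
      target := Metric.ball 0 a ×ˢ Metric.ball 0 b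
      map_source' := fun y hy =>
        ⟨mem_ball_zero_iff.2 hy.2.1, mem_ball_zero_iff.2 hy.2.2⟩
      map_target' := by
        rintro ⟨u, t⟩ ⟨hu, ht⟩
        rw [mem_ball_zero_iff] at hu ht
        have h1 := hprod u t hu ht
        refine ⟨h1, ?_, ?_⟩
        · rw [F.coord_eq _ ((htb t ht).trans_le hbb) u (hu.trans_le haa)]; exact hu
        · have h2 : ‖(τ (Z (x₀ + proj (t : E d)) u) : E d)‖ < b := by
            rw [hτ _ h1, hZt u t hu ht, hdt t ht]; exact ht
          exact h2
      left_inv' := hback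
      right_inv' := by
        rintro ⟨u, t⟩ ⟨hu, ht⟩
        rw [mem_ball_zero_iff] at hu ht
        have h1 := hprod u t hu ht
        refine Prod.ext (F.coord_eq _ ((htb t ht).trans_le hbb) u (hu.trans_le haa)) ?_
        refine Subtype.ext ?_
        change (τ (Z (x₀ + proj (t : E d)) u) : E d) = t
        rw [hτ _ h1, hZt u t hu ht, hdt t ht]
      open_source := by
        rw [isOpen_iff_mem_nhds]
        rintro y ⟨h1, h2, h3⟩
        have e1 := (tendsto_tdist (Filter.tendsto_id (x := 𝓝 y))
          (tendsto_const_nhds (x := x₀))).eventually (gt_mem_nhds h1)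
        have e2 := (continuousAt_coord (S := S) (x₀ := x₀) (y := y)
          (by linarith)).norm.tendsto.eventually (gt_mem_nhds h2)
        have e3 := (hτcont y h1).norm.tendsto.eventually (gt_mem_nhds h3)
        filter_upwards [e1, e2, e3] with z k1 k2 k3
        exact ⟨k1, k2, k3⟩
      open_target := Metric.isOpen_ball.prod Metric.isOpen_ball
      continuousOn_toFun := fun y hy =>
        ((continuousAt_coord (by linarith [hy.1])).prodMk (hτcont y hy.1)).continuousWithinAt
      continuousOn_invFun := by
        rintro ⟨u, t⟩ ⟨hu, ht⟩
        rw [mem_ball_zero_iff] at hu ht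
        refine ContinuousAt.continuousWithinAt ?_
        have h1 : ContinuousAt (fun p : S.fst x₀ × S.snd x₀ => (x₀ + proj (p.2 : E d), p.1))
            (u, t) :=
          ((continuous_const.add (continuous_proj.comp
            (continuous_subtype_val.comp continuous_snd))).prodMk continuous_fst).continuousAt
        refine ContinuousAt.comp (g := fun p : T d × S.fst x₀ => Z p.1 p.2)
          (f := fun p : S.fst x₀ × S.snd x₀ => (x₀ + proj (p.2 : E d), p.1)) ?_ h1
        exact F.continuousAt ((htb t ht).trans_le hbb) (hu.trans_le haa) }
  refine ⟨a, hapos, b, hbpos, a₁, b₁, Z, F, haa, hbb, φ, ?_, rfl, fun _ => rfl, ?_⟩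
  · refine ⟨hx₀, ?_, ?_⟩
    · rw [coord_self, norm_zero]; exact hapos
    · have : ‖(τ x₀ : E d)‖ < b := by
        rw [hτ _ hx₀, hZ₀, diffVec_self, norm_zero]; exact hbpos
      exact this
  · intro y hy z hz
    have hy' : y ∈ src := hy
    have hz' : z ∈ src := hz
    change τ y = τ z ↔ _
    constructor
    · intro e
      have h1 := hback y hy'
      have h2 := hback z hz'
      rw [← e] at h2
      have := F.rel_pair _ ((htb _ hy'.2.2).trans_le hbb) _ (hy'.2.1.trans_le haa) _
        (hz'.2.1.trans_le haa)
      rwa [h1, h2] at this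
    · intro hrel
      have h1 := F.eq_of_stableRel hy'.1 hz'.1 (hz'.2.1.trans_le haa) hrel h0a
      exact Subtype.ext (by rw [hτ y hy'.1, hτ z hz'.1, h1])

lemma exists_isStableChart {k : ℕ} (hk : ∀ x, Module.finrank ℝ (S.fst x) = k) (x₀ : T d) :
    ∃ φ : OpenPartialHomeomorph (T d) (E k × E (d - k)), x₀ ∈ φ.source ∧
      IsStableChart h S g α (2 * (C * δ)) φ := by
  obtain ⟨a, ha, b, hb, a₁, b₁, Z, F, haa, hbb, φ, hx, htgt, hsymm, hrel⟩ :=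
    H.exists_local_product x₀
  have hk' : Module.finrank ℝ (S.snd x₀) = d - k := by
    have := S.finrank_add x₀
    rw [hk] at this; omega
  obtain ⟨χ₁, hs₁, ht₁, A, hA, hAd⟩ := exists_ball_chart (hk x₀) ha
  obtain ⟨χ₂, hs₂, ht₂, -⟩ := exists_ball_chart hk' hb
  have hR := H.R_pos
  have hb₁R := F.b_le
  have hR' := H.R_le
  refine ⟨φ.trans (χ₁.prod χ₂), ?_, ?_, ?_, ?_⟩
  · rw [OpenPartialHomeomorph.trans_source]
    refine ⟨hx, ?_⟩
    have := φ.map_source hx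
    rw [htgt] at this
    simpa [hs₁, hs₂] using this
  · rw [OpenPartialHomeomorph.trans_target]
    refine Set.eq_univ_of_forall fun p => ⟨by simp [ht₁, ht₂], ?_⟩
    have h1 : χ₁.symm p.1 ∈ χ₁.source := χ₁.map_target (by rw [ht₁]; trivial)
    have h2 : χ₂.symm p.2 ∈ χ₂.source := χ₂.map_target (by rw [ht₂]; trivial)
    rw [hs₁] at h1
    rw [hs₂] at h2
    change ((χ₁.prod χ₂).symm p) ∈ φ.target
    rw [htgt]
    exact ⟨h1, h2⟩
  · intro y hy z hz
    rw [OpenPartialHomeomorph.trans_source] at hy hz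
    rw [← hrel y hy.1 z hz.1]
    have h1 : (φ y).2 ∈ χ₂.source := hy.2.2
    have h2 : (φ z).2 ∈ χ₂.source := hz.2.2
    exact χ₂.injOn.eq_iff h1 h2
  · intro s
    have h2 : χ₂.symm s ∈ χ₂.source := χ₂.map_target (by rw [ht₂]; trivial)
    rw [hs₂, mem_ball_zero_iff] at h2
    set y := x₀ + proj ((χ₂.symm s : S.snd x₀) : E d) with hy
    have hyb : tdist y x₀ < b₁ :=
      (tdist_add_proj_le _ _).trans_lt (lt_of_lt_of_le h2 hbb)
    have hu : ∀ u, ‖χ₁.symm u‖ < a₁ := fun u => by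
      have h1 : χ₁.symm u ∈ χ₁.source := χ₁.map_target (by rw [ht₁]; trivial)
      rw [hs₁, mem_ball_zero_iff] at h1
      exact h1.trans_le haa
    have heq : ∀ u, (φ.trans (χ₁.prod χ₂)).symm (u, s) = Z y (χ₁.symm u) := fun u => hsymm _
    have hχ : Continuous χ₁.symm := by
      rw [← continuousOn_univ, ← ht₁]; exact χ₁.continuousOn_symm
    obtain ⟨L, hL, hLd⟩ := F.exists_deriv_comp hyb hχ hA (fun u => (hAd u).1)
      (fun u => (hAd u).2) hu
    refine ⟨L, hL, fun u => ?_⟩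
    simp only [heq]
    exact hLd u

end ConeSystem

/-! ### The invariant foliation of a cone system -/

namespace ConeSystem
variable {h : TorusMetric d} {S : Splitting d} {g : TorusDiffeo d} {α Λ R δ C : ℝ}
  (H : ConeSystem h S g α Λ R δ C)

/-- The foliation by the plaques of the stable relation. -/
def foliation (H : ConeSystem h S g α Λ R δ C) {k : ℕ}
    (hk : ∀ x, Module.finrank ℝ (S.fst x) = k) : C1Foliation d k where
  atlas := {φ | IsStableChart h S g α (2 * (C * δ)) φ}
  cover x := by
    obtain ⟨φ, hx, hφ⟩ := H.exists_isStableChart hk x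
    exact ⟨φ, hφ, hx⟩
  target_eq φ hφ := hφ.target_eq
  compatible φ hφ ψ hψ x hx hx' := by
    refine ⟨φ.source ∩ ψ.source, (φ.open_source.inter ψ.open_source).mem_nhds ⟨hx, hx'⟩, ?_⟩
    intro y hy z hz
    rw [hφ.rel_iff y hy.1 z hz.1, hψ.rel_iff y hy.2 z hz.2]
  c1_plaques φ hφ s := by
    obtain ⟨L, hL, hLd⟩ := hφ.c1 s
    exact ⟨L, hL, fun u => ⟨(hLd u).1, (hLd u).2.1⟩⟩

lemma foliation_isTangentTo {k : ℕ} (hk : ∀ x, Module.finrank ℝ (S.fst x) = k) :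
    (H.foliation hk).IsTangentTo (csBundle h S g α) := by
  intro φ hφ u s L hL
  obtain ⟨L', -, hL'⟩ := IsStableChart.c1 hφ s
  obtain ⟨hinj, hd, hmem⟩ := hL' u
  rw [hL.unique hd]
  refine Submodule.eq_of_le_of_finrank_eq ?_ ?_
  · rintro _ ⟨v, rfl⟩
    exact hmem v
  · rw [LinearMap.finrank_range_of_inj hinj, H.finrank_csBundle, hk]
    simp

section Leaves
variable {k : ℕ} (hk : ∀ x, Module.finrank ℝ (S.fst x) = k)

lemma eventually_samePlaque (p : T d) : ∀ᶠ z in 𝓝 p, StableRel h S g α (2 * (C * δ)) p z →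
    (H.foliation hk).SamePlaque p z := by
  obtain ⟨φ, hp, hφ⟩ := H.exists_isStableChart hk p
  filter_upwards [φ.open_source.mem_nhds hp] with z hz hrel
  exact ⟨φ, hφ, hp, hz, (hφ.rel_iff p hp z hz).2 hrel⟩

/-- Plaques being connected, an equivalence relation that contains the stable relation locally
contains the plaque relation. -/
lemma of_samePlaque {Q : T d → T d → Prop} (hQ : Equivalence Q)
    (hloc : ∀ p, ∀ᶠ z in 𝓝 p, StableRel h S g α (2 * (C * δ)) p z → Q p z) {y z : T d}
    (hyz : (H.foliation hk).SamePlaque y z) : Q y z := by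
  obtain ⟨φ, hφ, hy, hz, hs⟩ := hyz
  have hφ' : IsStableChart h S g α (2 * (C * δ)) φ := hφ
  let γ : E k → T d := fun u => φ.symm (u, (φ y).2)
  have htgt : ∀ p, p ∈ φ.target := fun p => by rw [hφ'.target_eq]; trivial
  have hγ : Continuous γ := by
    have h1 : Continuous φ.symm := by
      rw [← continuousOn_univ, ← hφ'.target_eq]; exact φ.continuousOn_symm
    exact h1.comp (Continuous.prodMk_left _)
  have hγs : ∀ u, γ u ∈ φ.source := fun u => φ.map_target (htgt _)
  have hrel : ∀ u u', StableRel h S g α (2 * (C * δ)) (γ u) (γ u') := fun u u' => by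
    rw [← hφ'.rel_iff _ (hγs u) _ (hγs u')]
    simp only [γ, φ.right_inv (htgt _)]
  have hnear : ∀ u, ∀ᶠ u' in 𝓝 u, Q (γ u) (γ u') := fun u => by
    filter_upwards [(hγ.tendsto u).eventually (hloc (γ u))] with u' hu'
    exact hu' (hrel u u')
  have hclopen : IsClopen {u | Q y (γ u)} := by
    constructor
    · rw [← isOpen_compl_iff, isOpen_iff_mem_nhds]
      intro u hu
      filter_upwards [hnear u] with u' hu' hcon
      exact hu (hQ.trans hcon (hQ.symm hu'))
    · rw [isOpen_iff_mem_nhds]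
      intro u hu
      filter_upwards [hnear u] with u' hu'
      exact hQ.trans hu hu'
  have hy0 : γ (φ y).1 = y := φ.left_inv hy
  have hz0 : γ (φ z).1 = z := by
    simp only [γ, hs]
    exact φ.left_inv hz
  have huniv := hclopen.eq_univ ⟨(φ y).1, by
    change Q y (γ (φ y).1)
    rw [hy0]; exact hQ.refl y⟩
  have : (φ z).1 ∈ {u | Q y (γ u)} := by rw [huniv]; trivial
  rw [← hz0]
  exact this

/-- Lying in a common leaf is an equivalence relation. -/
lemma _root_.TorusDyn.C1Foliation.equivalence_leaf (F : C1Foliation d k) :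
    Equivalence (Relation.ReflTransGen F.SamePlaque) where
  refl _ := Relation.ReflTransGen.refl
  symm h := by
    have : Std.Symm F.SamePlaque := ⟨fun x y ⟨φ, hφ, hx, hy, e⟩ => ⟨φ, hφ, hy, hx, e.symm⟩⟩
    exact Relation.ReflTransGen.stdSymm.symm _ _ h
  trans h h' := h.trans h'

include H in
lemma eventually_samePlaque_image (p : T d) :
    ∀ᶠ z in 𝓝 p, StableRel h S g α (2 * (C * δ)) p z →
      Relation.ReflTransGen (H.foliation hk).SamePlaque (g p) (g z) := by
  filter_upwards [(g.continuous.tendsto p).eventually (H.eventually_samePlaque hk (g p))]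
    with z hz hrel
  exact Relation.ReflTransGen.single (hz hrel.image)

include H in
lemma eventually_samePlaque_preimage (p : T d) :
    ∀ᶠ z in 𝓝 p, StableRel h S g α (2 * (C * δ)) p z →
      Relation.ReflTransGen (H.foliation hk).SamePlaque (g.symm p) (g.symm z) := by
  have h1 := (g.symm.continuous.tendsto p).eventually
    (H.eventually_samePlaque hk (g.symm p))
  have h2 := (g.symm.continuous.tendsto p).eventually
    (eventually_tdist_lt (g.symm p) (r := 2 * (C * δ)) (by linarith [H.Cδ_pos]))
  filter_upwards [h1, h2] with z hz hz' hrel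
  exact Relation.ReflTransGen.single (hz (H.stableRel_preimage hrel hz'.le))

lemma foliation_isInvariant : (H.foliation hk).IsInvariant g := by
  have hQ := (H.foliation hk).equivalence_leaf
  have hpull : ∀ F : T d → T d, Equivalence fun y z =>
      Relation.ReflTransGen (H.foliation hk).SamePlaque (F y) (F z) := fun F =>
    ⟨fun _ => hQ.refl _, fun h => hQ.symm h, fun h h' => hQ.trans h h'⟩
  have hlift : ∀ F : T d → T d, (∀ y z, (H.foliation hk).SamePlaque y z →
      Relation.ReflTransGen (H.foliation hk).SamePlaque (F y) (F z)) → ∀ y z,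
      Relation.ReflTransGen (H.foliation hk).SamePlaque y z →
      Relation.ReflTransGen (H.foliation hk).SamePlaque (F y) (F z) := by
    intro F hF y z hyz
    induction hyz with
    | refl => exact Relation.ReflTransGen.refl
    | tail _ h1 ih => exact ih.trans (hF _ _ h1)
  have himage := hlift g fun y z hyz =>
    H.of_samePlaque hk (hpull g) (H.eventually_samePlaque_image hk) hyz
  have hpre := hlift g.symm fun y z hyz =>
    H.of_samePlaque hk (hpull g.symm) (H.eventually_samePlaque_preimage hk) hyz
  intro x
  ext w
  constructor
  · rintro ⟨y, hy, rfl⟩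
    exact himage _ _ hy
  · intro hw
    refine ⟨g.symm w, ?_, g.apply_symm_apply w⟩
    have := hpre _ _ hw
    rwa [g.symm_apply_apply] at this

end Leaves

/-! ### The dominated splitting -/

section Dominated
variable (H' : ConeSystem h S.compl g.symm α Λ R δ C)
include H'

lemma map_csBundle_symm (x : T d) : (csBundle h S.compl g.symm α x).map
    (g.D x : E d →ₗ[ℝ] E d) = csBundle h S.compl g.symm α (g x) := by
  have h1 := H'.map_csBundle (g x)
  rw [g.symm_apply_apply, g.symm_D, g.symm_apply_apply] at h1
  rw [← h1, ← Submodule.map_comp]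
  convert Submodule.map_id _
  ext v
  simp

lemma mem_coneU_of_mem_csBundle_symm {x : T d} {v : E d}
    (hv : v ∈ csBundle h S.compl g.symm α x) : v ∈ coneU h S α x := by
  rw [← coneS_compl]; exact H'.csBundle_subset_coneS hv

include H

lemma isCompl_csBundle_symm (x : T d) :
    IsCompl (csBundle h S g α x) (csBundle h S.compl g.symm α x) := by
  have hd : Disjoint (csBundle h S g α x) (csBundle h S.compl g.symm α x) := by
    rw [Submodule.disjoint_def]
    intro v hv hv'
    obtain ⟨y, rfl⟩ : ∃ y, g y = x := ⟨g.symm x, g.apply_symm_apply x⟩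
    rw [← H'.map_csBundle_symm] at hv'
    obtain ⟨w, hw, rfl⟩ := hv'
    by_contra hne
    have hw0 : w ≠ 0 := fun h0 => hne (by rw [h0, map_zero])
    have := (H.deriv_dom y (u := w) (s := w) (H'.mem_coneU_of_mem_csBundle_symm hw)
      (H.csBundle_subset_coneS hv)).1
    have hp : 0 < h.norm (g y) (g.D y w) * h.norm y w :=
      mul_pos (h.norm_pos _ hne) (h.norm_pos _ hw0)
    nlinarith [H.one_lt]
  refine ⟨hd, codisjoint_iff.2 (Submodule.eq_top_of_disjoint _ _ ?_ hd)⟩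
  rw [H.finrank_csBundle, H'.finrank_csBundle, S.compl_fst, S.finrank_add]
  simp

/-- The splitting into the stable bundles of `g` and of its inverse. -/
def splitting : Splitting d where
  P x := LinearMap.toContinuousLinearMap
    ((csBundle h S g α x).projection _ (H.isCompl_csBundle_symm H' x))
  idem _ v := Submodule.projection_apply_of_mem_left _ (Submodule.projection_apply_mem _ v)
  continuous_P := continuous_projection (H.isCompl_csBundle_symm H') H.closedFamily_csBundle
    H'.closedFamily_csBundle

lemma splitting_fst (x : T d) : (H.splitting H').fst x = csBundle h S g α x :=
  Submodule.range_projection (H.isCompl_csBundle_symm H' x)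

lemma splitting_snd (x : T d) : (H.splitting H').snd x = csBundle h S.compl g.symm α x :=
  Submodule.ker_projection (H.isCompl_csBundle_symm H' x)

lemma splitting_isDominated (h₁ : ∀ x, S.fst x ≠ ⊥) (h₂ : ∀ x, S.snd x ≠ ⊥) :
    IsDominatedSplitting h g (H.splitting H') where
  invariant :=
    { fst_ne_bot := fun x => by
        rw [splitting_fst, ← Submodule.one_le_finrank_iff, H.finrank_csBundle,
          Submodule.one_le_finrank_iff]
        exact h₁ x
      snd_ne_bot := fun x => by
        rw [splitting_snd, ← Submodule.one_le_finrank_iff, H'.finrank_csBundle,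
          Submodule.one_le_finrank_iff, S.compl_fst]
        exact h₂ x
      map_fst := fun x => by rw [splitting_fst, splitting_fst, H.map_csBundle]
      map_snd := fun x => by rw [splitting_snd, splitting_snd, H'.map_csBundle_symm] }
  dominated := by
    obtain ⟨n, hn⟩ := pow_unbounded_of_one_lt 2 H.one_lt
    refine ⟨n + 1, by omega, fun x u hu v hv hu1 hv1 => ?_⟩
    rw [splitting_fst] at hu
    rw [splitting_snd] at hv
    have h1 := H.pow_mul_norm_Diter_le (H'.mem_coneU_of_mem_csBundle_symm hv)
      (H.mem_csBundle.1 hu) (n + 1)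
    rw [hu1, hv1, mul_one, mul_one] at h1
    have h2 : 2 ≤ Λ ^ (n + 1) :=
      hn.le.trans (pow_le_pow_right₀ H.one_lt.le (Nat.le_succ n))
    have h3 := h.norm_nonneg (g^[n + 1] x) (g.Diter (n + 1) x u)
    have hv0 : g.Diter (n + 1) x v ≠ 0 := by
      rw [← map_zero (g.Diter (n + 1) x)]
      refine (g.Diter_injective (n + 1) x).ne ?_
      rintro rfl
      rw [h.norm_zero] at hv1
      exact zero_ne_one hv1
    rw [div_le_iff₀ (h.norm_pos _ hv0)]
    nlinarith

/-- A pair of cone systems, for `g` and for its inverse, provides a dominated splitting with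
tangent invariant foliations. -/
theorem exists_dominated_foliations (h₁ : ∀ x, S.fst x ≠ ⊥) (h₂ : ∀ x, S.snd x ≠ ⊥) :
    ∃ (S' : Splitting d) (k : ℕ), IsDominatedSplitting h g S' ∧
      (∀ x, Module.finrank ℝ (S.fst x) = k) ∧ (∀ x, Module.finrank ℝ (S'.fst x) = k) ∧
      ∃ (Fcs : C1Foliation d k) (Fcu : C1Foliation d (d - k)),
        Fcs.IsTangentTo S'.fst ∧ Fcu.IsTangentTo S'.snd ∧
        Fcs.IsInvariant g ∧ Fcu.IsInvariant g := by
  have hk : ∀ x, Module.finrank ℝ (S.fst x) = Module.finrank ℝ (S.fst 0) := fun x =>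
    S.finrank_fst_eq x 0
  have hk' : ∀ x, Module.finrank ℝ (S.compl.fst x) = d - Module.finrank ℝ (S.fst 0) := fun x => by
    have := S.finrank_add x
    rw [S.compl_fst, ← hk x]; omega
  refine ⟨H.splitting H', _, H.splitting_isDominated H' h₁ h₂, hk, fun x => ?_,
    H.foliation hk, H'.foliation hk', ?_, ?_, H.foliation_isInvariant hk, ?_⟩
  · rw [splitting_fst, H.finrank_csBundle, hk]
  · have : (H.splitting H').fst = csBundle h S g α := funext (H.splitting_fst H')
    rw [this]; exact H.foliation_isTangentTo hk
  · have : (H.splitting H').snd = csBundle h S.compl g.symm α := funext (H.splitting_snd H')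
    rw [this]; exact H'.foliation_isTangentTo hk'
  · intro x
    have h3 := H'.foliation_isInvariant hk' (g x)
    rw [g.symm_apply_apply] at h3
    rw [← h3, ← Set.image_comp]
    convert Set.image_id _
    exact funext g.apply_symm_apply

end Dominated
end ConeSystem

/-! ### The Riemannian distance -/

/-- The Riemannian and the Euclidean distances are equivalent. -/
lemma TorusMetric.exists_dist_equiv (h : TorusMetric d) :
    ∃ C ≥ 1, ∀ x y, h.dist x y ≤ C * tdist y x ∧ tdist y x ≤ C * h.dist x y := by
  obtain ⟨c, hc, M, hM, hcM⟩ := h.exists_norm_equiv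
  set C := max 1 (max M c⁻¹) with hC
  have hMC : M ≤ C := (le_max_left _ _).trans (le_max_right _ _)
  have hcC : c⁻¹ ≤ C := (le_max_right _ _).trans (le_max_right _ _)
  refine ⟨C, le_max_left _ _, fun x y => ?_⟩
  set A := {l : ℝ | ∃ γ : ℝ → E d, ContDiff ℝ 1 γ ∧ proj (γ 0) = x ∧ proj (γ 1) = y ∧
    l = ∫ t in (0 : ℝ)..1, h.norm (proj (γ t)) (deriv γ t)} with hA
  have hbelow : BddBelow A := by
    refine ⟨0, ?_⟩
    rintro l ⟨γ, -, -, -, rfl⟩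
    exact intervalIntegral.integral_nonneg zero_le_one fun t _ => h.norm_nonneg _ _
  let γ₀ : ℝ → E d := fun t => diffVec x 0 + t • diffVec y x
  have hγ₀ : ContDiff ℝ 1 γ₀ := contDiff_const.add (contDiff_id.smul contDiff_const)
  have hdγ₀ : ∀ t, deriv γ₀ t = diffVec y x := fun t => by
    have h1 : HasDerivAt γ₀ ((1 : ℝ) • diffVec y x) t :=
      ((hasDerivAt_id t).smul_const (diffVec y x)).const_add (diffVec x 0)
    rw [h1.deriv, one_smul]
  have hmem : (∫ t in (0 : ℝ)..1, h.norm (proj (γ₀ t)) (deriv γ₀ t)) ∈ A := by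
    refine ⟨γ₀, hγ₀, ?_, ?_, rfl⟩
    · simp [γ₀, proj_diffVec]
    · simp [γ₀, proj_add, proj_diffVec]
  constructor
  · refine (csInf_le hbelow hmem).trans ((le_abs_self _).trans ?_)
    have h1 := intervalIntegral.norm_integral_le_of_norm_le_const (a := (0 : ℝ)) (b := 1)
      (f := fun t => h.norm (proj (γ₀ t)) (deriv γ₀ t)) (C := C * tdist y x) (fun t _ => by
        rw [Real.norm_eq_abs, abs_of_nonneg (h.norm_nonneg _ _), hdγ₀]
        exact (hcM _ _).2.trans (mul_le_mul_of_nonneg_right hMC (_root_.norm_nonneg _)))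
    simpa using h1
  · have hCpos : 0 < C := lt_max_of_lt_left one_pos
    rw [mul_comm, ← div_le_iff₀ hCpos]
    refine le_csInf ⟨_, hmem⟩ ?_
    rintro l ⟨γ, hγ, hx, hy, rfl⟩
    rw [div_le_iff₀ hCpos]
    have hdc : Continuous (deriv γ) := hγ.continuous_deriv le_rfl
    have hnc : Continuous fun t => h.norm (proj (γ t)) (deriv γ t) :=
      h.continuous_norm.comp ((continuous_proj.comp hγ.continuous).prodMk hdc)
    have h1 : ∫ t in (0 : ℝ)..1, deriv γ t = γ 1 - γ 0 :=
      intervalIntegral.integral_deriv_eq_sub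
        (fun t _ => hγ.differentiable one_ne_zero t) (hdc.intervalIntegrable _ _)
    have h2 : tdist y x ≤ ‖γ 1 - γ 0‖ := by
      have : y = x + proj (γ 1 - γ 0) := by rw [proj_sub, hx, hy]; abel
      rw [this]; exact tdist_add_proj_le _ _
    calc tdist y x ≤ ‖∫ t in (0 : ℝ)..1, deriv γ t‖ := by rw [h1]; exact h2
      _ ≤ ∫ t in (0 : ℝ)..1, ‖deriv γ t‖ :=
          intervalIntegral.norm_integral_le_integral_norm zero_le_one
      _ ≤ ∫ t in (0 : ℝ)..1, h.norm (proj (γ t)) (deriv γ t) * C := by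
          refine intervalIntegral.integral_mono_on zero_le_one
            (hdc.norm.intervalIntegrable _ _) ((hnc.mul continuous_const).intervalIntegrable _ _)
            fun t _ => ?_
          have h3 := (hcM (proj (γ t)) (deriv γ t)).1
          have h4 : ‖deriv γ t‖ ≤ h.norm (proj (γ t)) (deriv γ t) * c⁻¹ := by
            rw [← div_eq_mul_inv, le_div_iff₀ hc, mul_comm]; exact h3
          exact h4.trans (mul_le_mul_of_nonneg_left hcC (h.norm_nonneg _ _))
      _ = _ := intervalIntegral.integral_mul_const _ _

/-! ### Complements of small boxes -/

lemma UnitAddCircle.isPreconnected_setOf_lt_norm_sub (p : UnitAddCircle) (s : ℝ) :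
    IsPreconnected {a : UnitAddCircle | s < ‖a - p‖} := by
  rcases lt_or_ge s 0 with hs | hs
  · have : {a : UnitAddCircle | s < ‖a - p‖} = Set.univ :=
      Set.eq_univ_of_forall fun a => hs.trans_le (norm_nonneg _)
    rw [this]; exact isPreconnected_univ
  have : {a : UnitAddCircle | s < ‖a - p‖} =
      (fun t : ℝ => p + (t : UnitAddCircle)) '' Set.Ioo s (1 - s) := by
    ext a
    constructor
    · intro ha
      set t := AddCircle.equivIco (1 : ℝ) 0 (a - p) with ht
      have h1 : ((t : ℝ) : UnitAddCircle) = a - p := AddCircle.coe_equivIco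
      have ha' : s < ‖((t : ℝ) : UnitAddCircle)‖ := by rw [h1]; exact ha
      rw [UnitAddCircle.norm_eq] at ha'
      have h2 := t.2
      refine ⟨t, ⟨?_, ?_⟩, by change p + _ = a; rw [h1]; abel⟩
      · have := ha'.trans_le (round_le (t : ℝ) 0)
        rw [Int.cast_zero, sub_zero, abs_of_nonneg h2.1] at this
        exact this
      · have := ha'.trans_le (round_le (t : ℝ) 1)
        rw [Int.cast_one, abs_sub_comm, abs_of_nonneg (by linarith [h2.2])] at this
        linarith
    · rintro ⟨t, ⟨h1, h2⟩, rfl⟩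
      change s < ‖p + (t : UnitAddCircle) - p‖
      rw [add_sub_cancel_left, UnitAddCircle.norm_eq]
      rcases le_or_gt (round t) 0 with hm | hm
      · have : ((round t : ℤ) : ℝ) ≤ 0 := by exact_mod_cast hm
        exact lt_of_lt_of_le (by linarith) (le_abs_self _)
      · have : (1 : ℝ) ≤ ((round t : ℤ) : ℝ) := by exact_mod_cast hm
        exact lt_of_lt_of_le (by linarith) (neg_le_abs _)
  rw [this]
  refine isPreconnected_Ioo.image _ (Continuous.continuousOn ?_)
  exact continuous_const.add (AddCircle.continuous_mk' (1 : ℝ))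

/-- The complement of a small box of the torus is connected. -/
lemma isPreconnected_compl_closedBall (p : T d) {s : ℝ} (hs : 0 ≤ s) (hs' : s < 1 / 2) :
    IsPreconnected (Metric.closedBall p s)ᶜ := by
  have e : (Metric.closedBall p s)ᶜ = ⋃ i : Fin d, {q : T d | s < ‖q i - p i‖} := by
    ext q
    simp [dist_eq_norm, pi_norm_le_iff_of_nonneg hs]
  rw [e]
  have hhalf : ‖((1 / 2 : ℝ) : UnitAddCircle)‖ = 1 / 2 := by
    rw [(AddCircle.norm_coe_eq_abs_iff (1 : ℝ) one_ne_zero).2 (by norm_num [abs_of_pos])]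
    norm_num
  refine isPreconnected_iUnion ⟨fun i => p i + ((1 / 2 : ℝ) : UnitAddCircle), ?_⟩ fun i => ?_
  · rw [Set.mem_iInter]
    intro i
    change s < ‖p i + ((1 / 2 : ℝ) : UnitAddCircle) - p i‖
    rw [add_sub_cancel_left, hhalf]
    exact hs'
  · have e2 : {q : T d | s < ‖q i - p i‖} =
        Set.univ.pi fun j => if j = i then {a : UnitAddCircle | s < ‖a - p i‖} else Set.univ := by
      ext q
      simp only [Set.mem_univ_pi]
      constructor
      · intro hq j
        split_ifs with hj
        · subst hj; exact hq
        · trivial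
      · intro hq
        have := hq i
        rw [if_pos rfl] at this
        exact this
    rw [e2]
    refine isPreconnected_univ_pi fun j => ?_
    split_ifs
    · exact UnitAddCircle.isPreconnected_setOf_lt_norm_sub _ _
    · exact isPreconnected_univ

lemma tdist_le_sqrt_mul_dist (y x : T d) : tdist y x ≤ Real.sqrt d * dist y x := by
  rw [tdist_eq, EuclideanSpace.norm_eq, ← Real.sqrt_sq (dist_nonneg (x := y) (y := x)),
    ← Real.sqrt_mul (Nat.cast_nonneg d)]
  refine Real.sqrt_le_sqrt ?_
  calc ∑ i, ‖(WithLp.toLp 2 fun i => ‖y i - x i‖ : E d) i‖ ^ 2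
      ≤ ∑ _i : Fin d, dist y x ^ 2 := by
        refine Finset.sum_le_sum fun i _ => ?_
        simp only [norm_norm]
        rw [← dist_eq_norm]
        exact pow_le_pow_left₀ dist_nonneg (dist_le_pi_dist y x i) 2
    _ = _ := by simp

/-! ### Sparse deformations are uniformly close to the original map -/

/-- If a homeomorphism `g` maps the boundary of a small ball into a small box, then it maps the
ball into the box, provided that some point outside the ball is not mapped into the box: the image
of the ball is open and closed relative to the connected complement of the box. -/
lemma image_ball_subset_closedBall (g : T d ≃ₜ T d) (c p : T d) {a s : ℝ} (hs : 0 ≤ s)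
    (hs' : s < 1 / 2) (hbd : ∀ x, tdist x c = a → dist (g x) p ≤ s)
    (hout : ∃ x, a ≤ tdist x c ∧ s < dist (g x) p) {x : T d} (hx : tdist x c < a) :
    dist (g x) p ≤ s := by
  by_contra hcon
  have hct : Continuous fun x => tdist x c := continuous_iff_continuousAt.2 fun x =>
    tendsto_tdist Filter.tendsto_id tendsto_const_nhds
  have hopen : IsOpen (g '' {x | tdist x c < a}) :=
    g.isOpenMap _ (isOpen_lt hct continuous_const)
  have hclosed : IsClosed (g '' {x | tdist x c ≤ a}) :=
    g.isClosedMap _ (isClosed_le hct continuous_const)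
  have hsub : (Metric.closedBall p s)ᶜ ⊆ g '' {x | tdist x c < a} := by
    refine (isPreconnected_compl_closedBall p hs hs').subset_of_closure_inter_subset hopen
      ⟨g x, fun h => hcon h, x, hx, rfl⟩ ?_
    rintro q ⟨hq1, hq2⟩
    have hle : {x | tdist x c < a} ⊆ {x | tdist x c ≤ a} := fun x (hx : tdist x c < a) =>
      (le_of_lt hx : tdist x c ≤ a)
    have hq3 : q ∈ g '' {x | tdist x c ≤ a} :=
      closure_minimal (Set.image_mono hle) hclosed hq1
    obtain ⟨y, hy, rfl⟩ := hq3
    rcases (show tdist y c ≤ a from hy).lt_or_eq with h1 | h1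
    · exact ⟨y, h1, rfl⟩
    · exact absurd (hbd y h1) hq2
  obtain ⟨y, hy1, hy2⟩ := hout
  obtain ⟨z, hz, hzy⟩ := hsub (show g y ∈ (Metric.closedBall p s)ᶜ from not_le.2 hy2)
  have := g.injective hzy
  rw [this] at hz
  exact absurd (show tdist y c < a from hz) (not_lt.2 hy1)

/-- A sparse deformation is close to the original map on the whole torus, with an error
proportional to `ε`. -/
lemma exists_tdist_le_of_isSparseDeformation (h : TorusMetric d) (f : TorusDiffeo d)
    (hd : 0 < d) : ∃ K > 0, ∃ ε₀ > 0, ∀ ε, 0 < ε → ε < ε₀ → ∀ (N : ℕ) (g : TorusDiffeo d),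
      IsSparseDeformation h f g ε N → ∀ x, tdist (g x) (f x) ≤ K * ε := by
  obtain ⟨C, hC1, hC⟩ := h.exists_dist_equiv
  obtain ⟨L, hL, hLip⟩ := f.exists_lipschitz
  have hC0 : 0 < C := by linarith
  set κ := C + L * C with hκ
  have hκ0 : 0 < κ := by positivity
  set m := Real.sqrt d with hm
  have hm0 : 0 ≤ m := Real.sqrt_nonneg _
  set W := (m + 1) * κ + 2 * (L * C) + C + 1 with hW
  have hW0 : 0 < W := by positivity
  set e := min (1 / (8 * W)) (1 / (2 * C ^ 2) ^ 2) with he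
  have he0 : 0 < e := by positivity
  refine ⟨m * κ + L * C + C, by positivity, e, he0, ?_⟩
  intro ε hε hεe N g hg
  obtain ⟨c, r, hr, hrε, hoff, hsep⟩ := hg
  have hWε : W * ε < 1 / 8 := by
    have := hεe.trans_le (min_le_left _ _)
    rw [lt_div_iff₀ (by positivity)] at this
    linarith
  have hsq : 2 * C ^ 2 * ε ≤ Real.sqrt ε := by
    have h1 : ε < 1 / (2 * C ^ 2) ^ 2 := hεe.trans_le (min_le_right _ _)
    have h2 : Real.sqrt ε * (2 * C ^ 2) ≤ 1 := by
      rw [← Real.sqrt_sq (by positivity : 0 ≤ 2 * C ^ 2), ← Real.sqrt_mul hε.le]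
      refine Real.sqrt_le_one.2 ?_
      rw [lt_div_iff₀ (by positivity)] at h1
      exact h1.le
    calc 2 * C ^ 2 * ε = Real.sqrt ε * (2 * C ^ 2) * Real.sqrt ε := by
          linear_combination -(2 * C ^ 2) * Real.mul_self_sqrt hε.le
      _ ≤ 1 * Real.sqrt ε := mul_le_mul_of_nonneg_right h2 (Real.sqrt_nonneg _)
      _ = _ := one_mul _
  have hLC0 : 0 < L * C := mul_pos hL hC0
  have b1 : C * ε ≤ W * ε := mul_le_mul_of_nonneg_right (by rw [hW]; nlinarith) hε.le
  have hCr : C * r < C * ε := mul_lt_mul_of_pos_left hrε hC0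
  have hLCr : L * (C * r) ≤ L * C * ε := by
    rw [mul_assoc]; exact mul_le_mul_of_nonneg_left hCr.le hL.le
  -- The exceptional balls, in the Euclidean distance.
  have hball : ∀ x, (∀ i, C * r ≤ tdist x (c i)) → tdist (g x) (f x) ≤ C * ε := fun x hx => by
    have hxn : x ∉ ⋃ i, h.ball (c i) r := by
      rw [Set.mem_iUnion]
      rintro ⟨i, hi⟩
      have h1 : h.dist (c i) x < r := hi
      have h2 := (hC (c i) x).2.trans_lt (mul_lt_mul_of_pos_left h1 hC0)
      linarith [hx i]
    exact (hC _ _).2.trans (mul_le_mul_of_nonneg_left (hoff x hxn).1.le hC0.le)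
  have hdisj : ∀ x i j, tdist x (c i) ≤ C * r → tdist x (c j) < C * r → i = j := by
    intro x i j hi hj
    by_contra hij
    have h1 := hsep i j hij
    have h2 := (hC (c i) (c j)).1
    have h3 := tdist_triangle (c j) x (c i)
    rw [tdist_comm (c j) x] at h3
    have h4 : C * tdist (c j) (c i) ≤ C * (2 * (C * r)) :=
      mul_le_mul_of_nonneg_left (by linarith) hC0.le
    have h5 : C * (2 * (C * r)) ≤ 2 * C ^ 2 * ε := by
      have : C * (C * r) ≤ C * (C * ε) := mul_le_mul_of_nonneg_left hCr.le hC0.le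
      nlinarith
    linarith
  have hsphere : ∀ x i, tdist x (c i) = C * r → tdist (g x) (f x) ≤ C * ε := fun x i hx =>
    hball x fun j => by
      by_contra hj
      have hij := hdisj x i j hx.le (not_le.1 hj)
      subst hij
      exact hj hx.ge
  have hsphere' : ∀ x i, tdist x (c i) = C * r → tdist (g x) (f (c i)) ≤ κ * ε := by
    intro x i hx
    have h1 := hsphere x i hx
    have h2 := hLip (c i) x
    rw [hx] at h2
    have h3 := tdist_triangle (g x) (f x) (f (c i))
    rw [hκ, add_mul]
    linarith
  -- The unit vector used to pick points at a given distance.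
  have hvec : ∀ t : ℝ, 0 ≤ t → ‖(EuclideanSpace.single (⟨0, hd⟩ : Fin d) t : E d)‖ = t :=
    fun t ht => by simp [abs_of_nonneg ht]
  have hnearby : ∀ w : T d, ∃ w', tdist w' w ≤ 2 * (C * r) ∧ tdist (g w') (f w') ≤ C * ε := by
    intro w
    by_cases hw : ∀ i, C * r ≤ tdist w (c i)
    · exact ⟨w, by rw [tdist_self]; positivity, hball w hw⟩
    · push Not at hw
      obtain ⟨i, hi⟩ := hw
      have hCr0 : 0 ≤ C * r := by positivity
      have h1 : tdist (c i + proj (EuclideanSpace.single (⟨0, hd⟩ : Fin d) (C * r))) (c i) =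
          C * r := by
        rw [tdist_add_proj _ (by rw [hvec _ hCr0]; linarith), hvec _ hCr0]
      refine ⟨_, ?_, hsphere _ i h1⟩
      have := tdist_triangle (c i + proj (EuclideanSpace.single (⟨0, hd⟩ : Fin d) (C * r))) (c i) w
      rw [tdist_comm (c i) w] at this
      linarith
  have b2 : m * κ * ε + κ * ε + 2 * (L * C) * ε + C * ε + ε = W * ε := by rw [hW]; ring
  have hκε : 0 < κ * ε := by positivity
  have hmκε : 0 ≤ m * κ * ε := by positivity
  intro x
  by_cases hx : ∀ i, C * r ≤ tdist x (c i)
  · have h1 := hball x hx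
    have : 0 ≤ (m * κ + L * C) * ε := by positivity
    linarith
  · push Not at hx
    obtain ⟨i, hi⟩ := hx
    have hin : dist (g x) (f (c i)) ≤ κ * ε := by
      refine image_ball_subset_closedBall g.toHomeo (c i) (f (c i)) hκε.le (by nlinarith)
        (fun y hy => (dist_le_tdist _ _).trans (hsphere' y i hy)) ?_ hi
      -- A point whose image under `f` is far from `f (c i)`, moved off the exceptional balls.
      set q := f (c i) + proj (EuclideanSpace.single (⟨0, hd⟩ : Fin d) (1 / 4)) with hq
      have hqd : tdist q (f (c i)) = 1 / 4 := by
        rw [hq, tdist_add_proj _ (by rw [hvec _ (by norm_num)]; norm_num), hvec _ (by norm_num)]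
      obtain ⟨w, hw1, hw2⟩ := hnearby (f.symm q)
      have h1 := hLip (f.symm q) w
      rw [f.apply_symm_apply] at h1
      have h2 : L * tdist w (f.symm q) ≤ 2 * (L * C) * ε := by
        have := mul_le_mul_of_nonneg_left hw1 hL.le
        nlinarith
      have h3 := tdist_triangle q (f w) (f (c i))
      have h4 := tdist_triangle (f w) (g w) (f (c i))
      rw [tdist_comm q (f w)] at h3
      rw [tdist_comm (f w) (g w)] at h4
      have hfar : m * κ * ε + κ * ε < tdist (g w) (f (c i)) := by linarith
      refine ⟨w, ?_, ?_⟩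
      · by_contra hlt
        have h5 := hLip (c i) w
        have h6 := mul_le_mul_of_nonneg_left (not_le.1 hlt).le hL.le
        have h7 := tdist_triangle (g w) (f w) (f (c i))
        have h8 : κ * ε = C * ε + L * C * ε := by rw [hκ]; ring
        linarith
      · by_contra hle
        have h5 := tdist_le_sqrt_mul_dist (g w) (f (c i))
        have h6 := mul_le_mul_of_nonneg_left (not_lt.1 hle) hm0
        rw [← mul_assoc] at h6
        linarith
    have h1 := tdist_le_sqrt_mul_dist (g x) (f (c i))
    have h2 := mul_le_mul_of_nonneg_left hin hm0
    have h3 := hLip (c i) x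
    have h4 := mul_le_mul_of_nonneg_left hi.le hL.le
    have h5 := tdist_triangle (g x) (f (c i)) (f x)
    rw [tdist_comm (f (c i)) (f x)] at h5
    have : 0 < C * ε := by positivity
    rw [add_mul, add_mul, mul_assoc m κ ε]
    linarith

/-! ### Hyperbolicity and contraction at a small scale -/

section Hyperbolicity
variable {h : TorusMetric d} {f : TorusDiffeo d} {S : Splitting d}

/-- The derivative commutes with the projections of an invariant splitting. -/
lemma Splitting.IsInvariant.P_D (hS : S.IsInvariant f) (x : T d) (v : E d) :
    S.P (f x) (f.D x v) = f.D x (S.P x v) := by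
  have h1 : f.D x (S.P x v) ∈ S.fst (f x) := by
    rw [← hS.map_fst]; exact ⟨_, S.P_mem_fst x v, rfl⟩
  have h2 : f.D x (v - S.P x v) ∈ S.snd (f x) := by
    rw [← hS.map_snd]
    exact ⟨_, S.mem_snd.2 (by rw [map_sub, S.idem, sub_self]), rfl⟩
  have h3 : f.D x v = f.D x (S.P x v) + f.D x (v - S.P x v) := by rw [← map_add]; congr 1; abel
  rw [h3, map_add, S.mem_fst.1 h1, S.mem_snd.1 h2, add_zero]

/-- The complementary splitting is invariant under the inverse. -/
lemma Splitting.IsInvariant.P_D_symm (hS : S.IsInvariant f) (x : T d) (v : E d) :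
    S.compl.P (f.symm x) (f.symm.D x v) = f.symm.D x (S.compl.P x v) := by
  have h1 := hS.P_D (f.symm x) (f.symm.D x v)
  rw [TorusDiffeo.symm_D, TorusDiffeo.apply_symm_apply,
    ContinuousLinearEquiv.apply_symm_apply] at h1
  rw [S.compl_P, S.compl_P, map_sub, TorusDiffeo.symm_D, h1,
    ContinuousLinearEquiv.symm_apply_apply]

lemma IsAnosov.exists_norm_D_le (hf : IsAnosov h f S) : ∃ μ, 0 ≤ μ ∧ μ < 1 ∧
    ∀ x, ∀ v ∈ S.fst x, h.norm (f x) (f.D x v) ≤ μ * h.norm x v := by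
  refine ⟨maxContraction h f S, ?_, hf.contraction, fun x v hv => ?_⟩
  · refine Real.sSup_nonneg ?_
    rintro _ ⟨x, v, -, -, rfl⟩
    exact div_nonneg (h.norm_nonneg _ _) (h.norm_nonneg _ _)
  · rcases eq_or_ne v 0 with rfl | hv0
    · simp [h.norm_zero]
    rw [← div_le_iff₀ (h.norm_pos x hv0)]
    refine le_csSup ?_ ⟨x, v, hv, hv0, rfl⟩
    obtain ⟨c, hc, C, hC, hcC⟩ := h.exists_norm_equiv
    obtain ⟨L, hL, hLD⟩ := f.exists_norm_D_le
    refine ⟨C * L / c, ?_⟩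
    rintro _ ⟨y, w, -, hw0, rfl⟩
    rw [div_le_div_iff₀ (h.norm_pos y hw0) hc]
    have h1 : ‖f.D y w‖ ≤ L * ‖w‖ := ((f.D y : E d →L[ℝ] E d).le_opNorm w).trans
      (mul_le_mul_of_nonneg_right (hLD y) (norm_nonneg w))
    calc h.norm (f y) (f.D y w) * c ≤ C * (L * ‖w‖) * c := mul_le_mul_of_nonneg_right
          ((hcC _ _).2.trans (mul_le_mul_of_nonneg_left h1 hC.le)) hc.le
      _ = C * L * (c * ‖w‖) := by ring
      _ ≤ _ := mul_le_mul_of_nonneg_left (hcC y w).1 (by positivity)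

lemma IsAnosov.exists_norm_D_symm_le (hf : IsAnosov h f S) : ∃ μ, 0 ≤ μ ∧ μ < 1 ∧
    ∀ x, ∀ v ∈ S.compl.fst x, h.norm (f.symm x) (f.symm.D x v) ≤ μ * h.norm x v := by
  have hpos : 0 < minExpansion h f S := one_pos.trans hf.expansion
  refine ⟨(minExpansion h f S)⁻¹, (inv_pos.2 hpos).le, inv_lt_one_of_one_lt₀ hf.expansion,
    fun x v hv => ?_⟩
  rcases eq_or_ne v 0 with rfl | hv0
  · simp [h.norm_zero]
  set w := f.symm.D x v with hw
  have hw0 : w ≠ 0 := by rw [hw, Ne, map_eq_zero_iff _ (f.symm.D x).injective]; exact hv0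
  have hDw : f.D (f.symm x) w = v := by
    rw [hw, TorusDiffeo.symm_D, ContinuousLinearEquiv.apply_symm_apply]
  have hws : w ∈ S.snd (f.symm x) := by
    rw [← S.compl_fst, Splitting.mem_fst, hw, hf.invariant.P_D_symm, S.compl.mem_fst.1 hv]
  have h1 : minExpansion h f S ≤
      h.norm (f (f.symm x)) (f.D (f.symm x) w) / h.norm (f.symm x) w := by
    refine csInf_le ⟨0, ?_⟩ ⟨f.symm x, w, hws, hw0, rfl⟩
    rintro _ ⟨y, u, -, -, rfl⟩
    exact div_nonneg (h.norm_nonneg _ _) (h.norm_nonneg _ _)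
  rw [hDw, TorusDiffeo.apply_symm_apply, le_div_iff₀ (h.norm_pos _ hw0)] at h1
  rwa [inv_mul_eq_div, le_div_iff₀' hpos]

end Hyperbolicity

/-- If `F` contracts the first bundle of an invariant splitting, then a map `G` whose distance to
`F` is small compared with `δ` still contracts the first component of displacements of size
comparable to `δ`, whether or not `G` is `C¹`-close to `F`. -/
lemma exists_contract_of_tdist_le (h : TorusMetric d) (S : Splitting d) (F : TorusDiffeo d)
    {μ C : ℝ} (hμ0 : 0 ≤ μ) (hμ1 : μ < 1) (hC : 0 < C)
    (hP : ∀ x v, S.P (F x) (F.D x v) = F.D x (S.P x v))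
    (hμ : ∀ x, ∀ v ∈ S.fst x, h.norm (F x) (F.D x v) ≤ μ * h.norm x v) :
    ∃ κ > 0, ∃ δ₀ > 0, ∀ δ, 0 < δ → δ < δ₀ → ∀ G : T d → T d,
      (∀ x, tdist (G x) (F x) ≤ κ * δ) → ∀ q y, tdist q y ≤ C * δ →
        h.fstNorm S y (diffVec q y) ≤ δ →
          h.fstNorm S (G y) (diffVec (G q) (G y)) < δ := by
  obtain ⟨M, hM, hMle⟩ := exists_fstNorm_le h S
  obtain ⟨L, hL, hLip⟩ := F.exists_lipschitz
  have hμ' : 0 < 1 - μ := by linarith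
  set D := M * C + 2 + L * C with hD
  have hD0 : 0 < D := by positivity
  set η := (1 - μ) / (4 * D) with hη
  have hη0 : 0 < η := by positivity
  have hηD : η * D = (1 - μ) / 4 := by rw [hη]; field_simp
  set κ := min 1 ((1 - μ) / (8 * M)) with hκ
  have hκ0 : 0 < κ := by positivity
  have hκ1 : κ ≤ 1 := min_le_left _ _
  have hκM : M * κ ≤ (1 - μ) / 8 := by
    have : κ ≤ (1 - μ) / (8 * M) := min_le_right _ _
    rw [le_div_iff₀ (by positivity)] at this
    linarith
  obtain ⟨r₁, hr₁, h₁⟩ := exists_fstNorm_sub_le h S hη0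
  obtain ⟨r₂, hr₂, h₂⟩ := F.exists_uniform_deriv hη0
  refine ⟨κ, hκ0, min r₁ (min (r₂ / C) (1 / (2 * D))), by positivity, ?_⟩
  intro δ hδ hδ₀ G hG q y hqy hfst
  have hδ1 : δ < r₁ := hδ₀.trans_le (min_le_left _ _)
  have hδ2 : C * δ < r₂ := by
    have := hδ₀.trans_le ((min_le_right _ _).trans (min_le_left _ _))
    rw [lt_div_iff₀ hC] at this
    linarith
  have hδ3 : D * δ < 1 / 2 := by
    have := hδ₀.trans_le ((min_le_right _ _).trans (min_le_right _ _))
    rw [lt_div_iff₀ (by positivity)] at this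
    linarith
  have hκδ : κ * δ ≤ δ := by nlinarith
  have ha := hG q
  have hc : tdist (F y) (G y) ≤ κ * δ := by rw [tdist_comm]; exact hG y
  have hb : tdist (F q) (F y) ≤ L * C * δ := (hLip y q).trans (by
    rw [mul_assoc]; exact mul_le_mul_of_nonneg_left hqy hL.le)
  have hMCδ : 0 ≤ M * C * δ := by positivity
  have hsize : δ + L * C * δ + δ ≤ D * δ := by rw [hD]; linarith
  have hw : diffVec (G q) (G y) =
      diffVec (G q) (F q) + (diffVec (F q) (F y) + diffVec (F y) (G y)) := by
    have h3 := tdist_triangle (F q) (F y) (G y)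
    rw [diffVec_add (y := F q) (by linarith), diffVec_add (z := F q) (y := F y) (by linarith)]
  have hwn : ‖diffVec (G q) (G y)‖ ≤ 2 * δ + L * C * δ := by
    have h3 := tdist_triangle (F q) (F y) (G y)
    have h4 := tdist_triangle (G q) (F q) (G y)
    change tdist _ _ ≤ _
    linarith
  set e := diffVec (F q) (F y) - F.D y (diffVec q y) with he
  have hen : ‖e‖ ≤ η * (C * δ) := (h₂ y q (hqy.trans_lt hδ2)).trans
    (mul_le_mul_of_nonneg_left hqy hη0.le)
  have hmain : h.fstNorm S (F y) (F.D y (diffVec q y)) ≤ μ * δ := by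
    rw [TorusMetric.fstNorm, hP]
    exact (hμ y _ (S.P_mem_fst _ _)).trans (mul_le_mul_of_nonneg_left hfst hμ0)
  have h5 := h₁ (G y) (F y) (((hG y).trans hκδ).trans_lt hδ1) (diffVec (G q) (G y))
  have h6 : η * ‖diffVec (G q) (G y)‖ ≤ η * (2 * δ + L * C * δ) :=
    mul_le_mul_of_nonneg_left hwn hη0.le
  have h7 : h.fstNorm S (F y) (diffVec (G q) (G y)) ≤
      M * (κ * δ) + (μ * δ + M * (η * (C * δ)) + M * (κ * δ)) := by
    rw [hw]
    refine (fstNorm_add_le h S _ _ _).trans (add_le_add ?_ ((fstNorm_add_le h S _ _ _).trans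
      (add_le_add ?_ ?_)))
    · exact (hMle _ _).trans (mul_le_mul_of_nonneg_left ha hM.le)
    · rw [show diffVec (F q) (F y) = F.D y (diffVec q y) + e by rw [he]; abel]
      exact (fstNorm_add_le h S _ _ _).trans (add_le_add hmain
        ((hMle _ _).trans (mul_le_mul_of_nonneg_left hen hM.le)))
    · exact (hMle _ _).trans (mul_le_mul_of_nonneg_left hc hM.le)
  have h8 : M * κ * δ ≤ (1 - μ) / 8 * δ := mul_le_mul_of_nonneg_right hκM hδ.le
  have h9 : η * D * δ = (1 - μ) / 4 * δ := by rw [hηD]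
  have h10 : 0 < (1 - μ) * δ := mul_pos hμ' hδ
  rw [hD] at h9
  linarith

/-! ### The cone systems of a sparse deformation -/

/-- The cone system of the inverse: the conditions on the domination at the scale `R` are those
of the original system, with the roles of the two cones exchanged. -/
lemma ConeSystem.symm_compl {h : TorusMetric d} {S : Splitting d} {g : TorusDiffeo d}
    {α Λ R δ C : ℝ} (H : ConeSystem h S g α Λ R δ C)
    (hnorm : ∀ x x' v, tdist x x' < R → v ∈ coneS h S.compl α x →
      ‖v‖ ≤ C * h.fstNorm S.compl x' v)
    (hcontract : ∀ q y, diffVec q y ∈ coneS h S.compl α y →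
      h.fstNorm S.compl y (diffVec q y) ≤ δ →
        h.fstNorm S.compl (g.symm y) (diffVec (g.symm q) (g.symm y)) < δ) :
    ConeSystem h S.compl g.symm α Λ R δ C where
  one_lt := H.one_lt
  R_le := H.R_le
  δ_pos := H.δ_pos
  C_pos := H.C_pos
  δ_lt := H.δ_lt
  mem_coneU x x' v hx hv := by
    rw [coneU_compl]
    exact H.mem_coneS x x' v hx (sub_eq_zero.1 hv).symm
  mem_coneS x x' v hx hv := by
    rw [coneS_compl]
    exact H.mem_coneU x x' v hx (sub_eq_self.1 hv)
  norm_le := hnorm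
  dom x y z hy hz hgy hgz hU hS := by
    rw [coneU_compl] at hU
    rw [coneS_compl] at hS
    have key := H.dom (g.symm x) (g.symm z) (g.symm y) hgz hgy (by simpa using hz)
      (by simpa using hy) hS (by simpa using hU)
    simp only [TorusDiffeo.apply_symm_apply] at key
    obtain ⟨h1, h2, h3⟩ := key
    rw [coneU_compl, coneS_compl]
    refine ⟨fun hyx hzx => ?_, h3, h2⟩
    have := h1 (fun hzx' => hzx (g.symm.toHomeo.injective hzx'))
      (fun hyx' => hyx (g.symm.toHomeo.injective hyx'))
    rwa [mul_comm (h.norm x (diffVec y x)), mul_comm (h.norm x (diffVec z x))] at this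
  contract := hcontract
  close := H.close_symm
  close_symm := H.close

/-- A map which is uniformly close to a Lipschitz map is Lipschitz up to an additive constant. -/
lemma tdist_le_of_tdist_le {F G : T d → T d} {L b : ℝ}
    (hF : ∀ x y, tdist (F y) (F x) ≤ L * tdist y x) (hG : ∀ x, tdist (G x) (F x) ≤ b) (q y : T d) :
    tdist (G q) (G y) ≤ L * tdist q y + 2 * b := by
  have h1 := tdist_triangle (G q) (F q) (G y)
  have h2 := tdist_triangle (F q) (F y) (G y)
  have h3 := hG y
  rw [tdist_comm] at h3
  linarith [hG q, hF y q]

/-- Cones at nearby points, for the two bundles at once. -/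
lemma exists_cone_scale_both (h : TorusMetric d) (S : Splitting d) {α : ℝ} (hα : 0 < α) :
    ∃ R > 0, ∃ C > 0, ∀ x x', tdist x x' < R → ∀ v,
      (S.P x' v = 0 → v ∈ coneU h S α x) ∧ (S.P x' v = v → v ∈ coneS h S α x) ∧
      (v ∈ coneS h S α x → ‖v‖ ≤ C * h.fstNorm S x' v) ∧
      (v ∈ coneS h S.compl α x → ‖v‖ ≤ C * h.fstNorm S.compl x' v) := by
  obtain ⟨R₁, hR₁, C₁, hC₁, h₁⟩ := exists_cone_scale h S hα
  obtain ⟨R₂, hR₂, C₂, hC₂, h₂⟩ := exists_cone_scale h S.compl hα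
  refine ⟨min R₁ R₂, lt_min hR₁ hR₂, max C₁ C₂, lt_max_of_lt_left hC₁, fun x x' hx v =>
    ⟨(h₁ x x' (hx.trans_le (min_le_left _ _)) v).1, fun hv => ?_, fun hv => ?_, fun hv => ?_⟩⟩
  · rw [← coneU_compl]
    exact (h₂ x x' (hx.trans_le (min_le_right _ _)) v).1 (by rw [S.compl_P, hv, sub_self])
  · exact ((h₁ x x' (hx.trans_le (min_le_left _ _)) v).2 hv).trans
      (mul_le_mul_of_nonneg_right (le_max_left _ _) (fstNorm_nonneg h S _ _))
  · exact ((h₂ x x' (hx.trans_le (min_le_right _ _)) v).2 hv).trans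
      (mul_le_mul_of_nonneg_right (le_max_right _ _) (fstNorm_nonneg h S.compl _ _))

/-- Domination at the Riemannian scale `ρ`, in multiplicative form and at a smaller Euclidean
scale. -/
lemma RespectsDomination.of_tdist_lt {h : TorusMetric d} {S : Splitting d} {g : TorusDiffeo d}
    {α ρ Λ R : ℝ} (hg : RespectsDomination h S g α ρ Λ)
    (hR : ∀ x y, tdist y x < R → h.dist x y < ρ) (x y z : T d) (hy : tdist y x < R)
    (hz : tdist z x < R) (hU : diffVec y x ∈ coneU h S α x)
    (hS : diffVec (g z) (g x) ∈ coneS h S α (g x)) :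
    (y ≠ x → z ≠ x →
      Λ * (h.norm (g x) (diffVec (g z) (g x)) * h.norm x (diffVec y x)) <
        h.norm (g x) (diffVec (g y) (g x)) * h.norm x (diffVec z x)) ∧
    diffVec (g y) (g x) ∈ coneU h S α (g x) ∧ diffVec z x ∈ coneS h S α x := by
  obtain ⟨h1, h2, h3⟩ := hg x y (hR x y hy) z (hR x z hz) hU hS
  refine ⟨fun hyx hzx => ?_, h2, h3⟩
  have h4 := h1 hyx hzx
  have hyp : 0 < h.norm x (diffVec y x) := h.norm_pos x fun h0 => hyx (diffVec_eq_zero.1 h0)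
  have hzp : 0 < h.norm x (diffVec z x) := h.norm_pos x fun h0 => hzx (diffVec_eq_zero.1 h0)
  rw [gt_iff_lt, ← mul_div_assoc, div_lt_div_iff₀ hzp hyp, mul_assoc] at h4
  exact h4

/-- A sparse deformation which respects the domination carries the two cone systems, for itself
and for its inverse, at the scales `R ∼ √ε` and `δ ∼ ε`. -/
lemma exists_coneSystem (h : TorusMetric d) (f : TorusDiffeo d) (S : Splitting d)
    (hf : IsAnosov h f S) {Λ α : ℝ} (hΛ : 1 < Λ) (hα : 0 < α) :
    ∃ ε₁ > 0, ∀ ε, 0 < ε → ε < ε₁ → ∀ (N : ℕ) (g : TorusDiffeo d),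
      IsSparseDeformation h f g ε N → RespectsDomination h S g α (Real.sqrt ε - 2 * ε) Λ →
        ∃ R δ C, ConeSystem h S g α Λ R δ C ∧ ConeSystem h S.compl g.symm α Λ R δ C := by
  have hd : 0 < d := by
    rcases Nat.eq_zero_or_pos d with rfl | hd
    · exact absurd (Subsingleton.elim (S.fst 0) ⊥) (hf.invariant.fst_ne_bot 0)
    · exact hd
  obtain ⟨B, hB1, hB⟩ := h.exists_dist_equiv
  obtain ⟨K, hK, ε₀, hε₀, hclose⟩ := exists_tdist_le_of_isSparseDeformation h f hd
  obtain ⟨L, hL, hLip⟩ := f.exists_lipschitz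
  obtain ⟨L', hL', hLip'⟩ := f.symm.exists_lipschitz
  obtain ⟨R₀, hR₀, C, hC, hcone⟩ := exists_cone_scale_both h S hα
  obtain ⟨μ, hμ0, hμ1, hμ⟩ := hf.exists_norm_D_le
  obtain ⟨μ', hμ'0, hμ'1, hμ'⟩ := hf.exists_norm_D_symm_le
  obtain ⟨κ, hκ, δ₀, hδ₀, hcon⟩ :=
    exists_contract_of_tdist_le h S f hμ0 hμ1 hC hf.invariant.P_D hμ
  obtain ⟨κ', hκ', δ₀', hδ₀', hcon'⟩ :=
    exists_contract_of_tdist_le h S.compl f.symm hμ'0 hμ'1 hC hf.invariant.P_D_symm hμ'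
  have hB0 : 0 < B := by linarith
  -- The scale `δ = A * ε` is large compared with the distances of `g` to `f` and `g⁻¹` to `f⁻¹`.
  set A := max (K / κ) (L' * K / κ') with hA
  have hA0 : 0 < A := lt_max_of_lt_left (by positivity)
  have hAκ : K ≤ κ * A := by
    have : K / κ ≤ A := le_max_left _ _
    rwa [div_le_iff₀' hκ] at this
  have hAκ' : L' * K ≤ κ' * A := by
    have : L' * K / κ' ≤ A := le_max_right _ _
    rwa [div_le_iff₀' hκ'] at this
  set W := max (4 * (C * A)) (max (L * (4 * (C * A)) + 2 * K) (L' * (4 * (C * A)) + 2 * (L' * K)))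
    with hW
  have hW1 : 4 * (C * A) ≤ W := le_max_left _ _
  have hW2 : L * (4 * (C * A)) + 2 * K ≤ W := (le_max_left _ _).trans (le_max_right _ _)
  have hW3 : L' * (4 * (C * A)) + 2 * (L' * K) ≤ W := (le_max_right _ _).trans (le_max_right _ _)
  have hW0 : 0 < W := lt_max_of_lt_left (by positivity)
  set s₁ := min (min (1 / 4) R₀) (min (min (δ₀ / A) (δ₀' / A)) (min ε₀ (1 / (2 * B * W)))) with hs₁
  have hs₁0 : 0 < s₁ := by positivity
  refine ⟨s₁ ^ 2, by positivity, fun ε hε hεs N g hg hdom => ?_⟩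
  set s := Real.sqrt ε with hs
  have hs0 : 0 < s := Real.sqrt_pos.2 hε
  have hss : s * s = ε := Real.mul_self_sqrt hε.le
  have hlt : s < s₁ := (Real.sqrt_lt' hs₁0).2 hεs
  have hs4 : s < 1 / 4 := hlt.trans_le ((min_le_left _ _).trans (min_le_left _ _))
  have hsR : s < R₀ := hlt.trans_le ((min_le_left _ _).trans (min_le_right _ _))
  have hsδ : A * s < δ₀ := by
    have := hlt.trans_le ((min_le_right _ _).trans ((min_le_left _ _).trans (min_le_left _ _)))
    rwa [lt_div_iff₀' hA0] at this
  have hsδ' : A * s < δ₀' := by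
    have := hlt.trans_le ((min_le_right _ _).trans ((min_le_left _ _).trans (min_le_right _ _)))
    rwa [lt_div_iff₀' hA0] at this
  have hsε : s < ε₀ :=
    hlt.trans_le ((min_le_right _ _).trans ((min_le_right _ _).trans (min_le_left _ _)))
  have hsW : s * (2 * B * W) < 1 := by
    have := hlt.trans_le ((min_le_right _ _).trans ((min_le_right _ _).trans (min_le_right _ _)))
    rwa [lt_div_iff₀ (by positivity)] at this
  have hεle : ε ≤ s := by nlinarith
  set R := s / (2 * B) with hR
  have hRs : R ≤ s / 2 := by
    rw [hR]; exact div_le_div_of_nonneg_left hs0.le two_pos (by linarith)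
  have hWR : W * ε < R := by
    rw [hR, lt_div_iff₀ (by positivity), ← hss]
    nlinarith
  have hRdist : ∀ x y, tdist y x < R → h.dist x y < s - 2 * ε := fun x y hxy => by
    refine (hB x y).1.trans_lt ((mul_lt_mul_of_pos_left hxy hB0).trans_le ?_)
    rw [hR, show B * (s / (2 * B)) = s / 2 by field_simp]
    nlinarith
  have hgf := hclose ε hε (hεle.trans_lt hsε) N g hg
  have hgf' : ∀ x, tdist (g.symm x) (f.symm x) ≤ L' * K * ε := fun x => by
    have h1 := hLip' (f (g.symm x)) x
    have h2 := hgf (g.symm x)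
    rw [TorusDiffeo.apply_symm_apply] at h2
    rw [TorusDiffeo.symm_apply_apply, tdist_comm] at h1
    rw [mul_assoc]
    exact h1.trans (mul_le_mul_of_nonneg_left h2 hL'.le)
  have hAε : A * ε ≤ A * s := mul_le_mul_of_nonneg_left hεle hA0.le
  have hconeR : ∀ x x' : T d, tdist x x' < R → tdist x x' < R₀ := fun _ _ hx =>
    hx.trans (hRs.trans_lt (by linarith))
  have hself : ∀ y : T d, tdist y y < R := fun y => by rw [tdist_self]; positivity
  have H : ConeSystem h S g α Λ R (A * ε) C :=
    { one_lt := hΛ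
      R_le := by linarith
      δ_pos := by positivity
      C_pos := hC
      δ_lt := by
        have := mul_le_mul_of_nonneg_right hW1 hε.le
        linarith
      mem_coneU := fun x x' v hx => (hcone x x' (hconeR x x' hx) v).1
      mem_coneS := fun x x' v hx => (hcone x x' (hconeR x x' hx) v).2.1
      norm_le := fun x x' v hx => (hcone x x' (hconeR x x' hx) v).2.2.1
      dom := fun x y z hy hz _ _ hU hS => hdom.of_tdist_lt hRdist x y z hy hz hU hS
      contract := fun q y hq hq' => by
        refine hcon _ (by positivity) (hAε.trans_lt hsδ) g (fun x => (hgf x).trans ?_) q y ?_ hq'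
        · rw [← mul_assoc]; exact mul_le_mul_of_nonneg_right hAκ hε.le
        · exact ((hcone y y (hconeR _ _ (hself y)) _).2.2.1 hq).trans
            (mul_le_mul_of_nonneg_left hq' hC.le)
      close := fun q y hq => by
        have h1 := tdist_le_of_tdist_le hLip hgf q y
        have h2 := mul_le_mul_of_nonneg_left hq hL.le
        have h3 := mul_le_mul_of_nonneg_right hW2 hε.le
        linarith
      close_symm := fun q y hq => by
        have h1 := tdist_le_of_tdist_le hLip' hgf' q y
        have h2 := mul_le_mul_of_nonneg_left hq hL'.le
        have h3 := mul_le_mul_of_nonneg_right hW3 hε.le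
        linarith }
  refine ⟨R, A * ε, C, H, H.symm_compl
    (fun x x' v hx => (hcone x x' (hconeR x x' hx) v).2.2.2) fun q y hq hq' => ?_⟩
  refine hcon' _ (by positivity) (hAε.trans_lt hsδ') g.symm (fun x => (hgf' x).trans ?_) q y ?_ hq'
  · rw [← mul_assoc]; exact mul_le_mul_of_nonneg_right hAκ' hε.le
  · exact ((hcone y y (hconeR _ _ (hself y)) _).2.2.2 hq).trans
      (mul_le_mul_of_nonneg_left hq' hC.le)

end TorusDyn

end

theorem theorem3p1 (d : ℕ) (h : TorusDyn.TorusMetric d) (f : TorusDyn.TorusDiffeo d)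
    (S : TorusDyn.Splitting d) (hf : TorusDyn.IsAnosov h f S)
    (Λ α : ℝ) (hΛ : 1 < Λ) (hΛ' : Λ < TorusDyn.hyperbolicityStrength h f S) (hα : 0 < α) :
    ∃ ε₁ : ℝ, 0 < ε₁ ∧ ∀ ε : ℝ, 0 < ε → ε < ε₁ →
      ∀ N : ℕ, 1 ≤ N → ∀ g : TorusDyn.TorusDiffeo d,
        TorusDyn.IsSparseDeformation h f g ε N →
        TorusDyn.RespectsDomination h S g α (Real.sqrt ε - 2 * ε) Λ →
        ∃ (S' : TorusDyn.Splitting d) (k : ℕ),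
          TorusDyn.IsDominatedSplitting h g S' ∧
          (∀ x, Module.finrank ℝ (S.fst x) = k) ∧
          (∀ x, Module.finrank ℝ (S'.fst x) = k) ∧
          ∃ (Fcs : TorusDyn.C1Foliation d k) (Fcu : TorusDyn.C1Foliation d (d - k)),
            Fcs.IsTangentTo S'.fst ∧ Fcu.IsTangentTo S'.snd ∧
            Fcs.IsInvariant g ∧ Fcu.IsInvariant g := by
  obtain ⟨ε₁, hε₁, hH⟩ := TorusDyn.exists_coneSystem h f S hf hΛ hα
  refine ⟨ε₁, hε₁, fun ε hε hεlt N _ g hg hdom => ?_⟩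
  obtain ⟨R, δ, C, H, H'⟩ := hH ε hε hεlt N g hg hdom
  exact H.exists_dominated_foliations H' hf.invariant.fst_ne_bot hf.invariant.snd_ne_bot
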